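/- Let $M$ be a smooth $2$-manifold, $U$ a smooth $1$-manifold, and $\dot q=f(q,u)$, $q\in M$, $u\in U$, a smooth control system satisfying the regularity assumptions $f\wedge\partial_uf\neq0$ and $\partial_uf\wedge\partial_u^2f\ne 0$, both bivectors having the same sign (the curves $f(q,\cdot)$ are strictly convex around the origin; this condition does not depend on coordinates). *Invariants.* Let $h(\lambda)=\max_u\langle\lambda,f(q,u)\rangle$, $\lambda\in T_q^*M$, be the maximized Hamiltonian of the time-optimal problem (the maximum being taken over controls near a given one), $\mathcal H=h^{-1}(1)$, $s$ the restriction to $\mathcal H$ of the Liouville form $p\,dq$, and $\vec h$ the Hamiltonian field, $\sigma(\cdot,\vec h)=dh$, $\sigma=dp\wedge dq$. The pairs $(q,u)$ are coordinates on $\mathcal H$: $(q,u)$ corresponds to the covector $\lambda\in\mathcal H\cap T^*_qM$ at which the maximum is attained at $u$. The invariants are a smooth vertical vector field $v$ on $\mathcal H$ (determined up to sign) and smooth functions $b$, $\kappa$ on $\mathcal H$ with $$L_v^2s=-s+b\,L_vs,\qquad [\vec h,[v,\vec h]]=\kappa v .$$ A control is called *natural* if $v=\partial/\partial u$ in the coordinates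 $(q,u)$. A *local feedback transformation* near $(q_0,u_0)$ is a diffeomorphism $\Theta(q,u)=(\phi(q),\psi(q,u))$ of a neighbourhood of $(q_0,u_0)$ onto a product $O\times V$ of open sets $O\subset\mathbb R^2$, $V\subset\mathbb R$, where $\phi$ is a diffeomorphism onto $O$; it carries $f$ to the system $\tilde f$ on $O\times V$ with $T_q\phi(f(q,u))=\tilde f(\phi(q),\psi(q,u))$. **Theorem.** Such $v,b,\kappa$ exist, and the following hold (for every choice of them). 1. $\kappa$ and $L_{\vec h}b$ vanish identically if and only if near every $(q_0,u_0)\in M\times U$ there is a local feedback transformation to a system $\tilde f(q,w)$ with natural control $w$ such that $$\Big[\tilde f(\cdot,w),\tfrac{\partial\tilde f(\cdot,w)}{\partial w}\Big]=0\quad\text{for all }w .$$ If near every point there is a local feedback transformation to a system with this commutation property in a control $w$ that is not assumed to be natural, then still $\kappa\equiv0$. 2. These systems are parametrized by families of diffeomorphisms generated by the time-dependent vector fields $$X_w=(a_1(w)+q_2)\,\partial_{q_1}+(a_2(w,q_2)-q_1)\,\partial_{q_2},\qquad a_1,a_2\ \text{smooth},$$ in the following sense. (a) $\kappa$ and $L_{\vec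 h}b$ vanish identically if and only if near every $(q_0,u_0)$ there is a local feedback transformation to a system $\tilde f$ on $O\times V$ for which there is a smooth family of diffeomorphisms $P_w$, $w\in V$, of $O$ onto open subsets of $\mathbb R^2$ with $$\frac{d}{dw}P_w=X_w\circ P_w,\qquad P_{w_0}=\mathrm{Id}\ \ (w_0=\psi(q_0,u_0)),\qquad P_{w*}\Big(\tilde f(\cdot,w),\tfrac{\partial\tilde f(\cdot,w)}{\partial w}\Big)=\Big(\tbinom10,\tbinom01\Big)$$ for some smooth $a_1,a_2$. (b) In any local coordinates, if the control $w$ of $\tilde f$ is natural and $\tilde f(\cdot,w)$, $\partial_w\tilde f(\cdot,w)$ commute for every $w$, then near every point $(q_0,w_0)$ there is such a family $P_w$ (without the condition $P_{w_0}=\mathrm{Id}$, which can be added if $\tilde f(\cdot,w_0)=\partial_{q_1}$ and $\partial_w\tilde f(\cdot,w_0)=\partial_{q_2}$). (c) Conversely, for every smooth family of diffeomorphisms $P_w$ of an open set $O$ onto open sets with $\frac{d}{dw}P_w=X_w\circ P_w$, the system $\tilde f$ defined by $P_{w*}\tilde f(\cdot,w)=\binom10$ is smooth, has natural control $w$, satisfies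 $P_{w*}\partial_w\tilde f(\cdot,w)=\binom01$, and its fields $\tilde f(\cdot,w)$, $\partial_w\tilde f(\cdot,w)$ commute. -/

import Mathlib

open Set Filter Topology
open scoped Manifold ContDiff

/-- The coordinate plane of the state space. -/
abbrev Plane : Type := EuclideanSpace ℝ (Fin 2)

/-- Covectors of the coordinate plane. -/
abbrev Coplane : Type := Plane →L[ℝ] ℝ

/-- The coordinate vector field `∂/∂q₁`. -/
noncomputable def e₁ : Plane := !₂[1, 0]

/-- The coordinate vector field `∂/∂q₂`. -/
noncomputable def e₂ : Plane := !₂[0, 1]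

/-- The wedge product `a ∧ b` of two plane vectors (as a determinant). -/
def wedge (a b : Plane) : ℝ := a 0 * b 1 - a 1 * b 0

/-- The partial derivative `∂F/∂u` of a map of `(q, u)`. -/
noncomputable def dU (F : Plane × ℝ → Plane) (x : Plane × ℝ) : Plane :=
  deriv (fun t => F (x.1, t)) x.2

/-- The control `u` of the system `q' = F (q, u)` is such that, for every fixed value of `u`,
the vector fields `F (·, u)` and `∂F/∂u (·, u)` commute. -/
def Commuting (F : Plane × ℝ → Plane) (O : Set Plane) (V : Set ℝ) : Prop :=
  ∀ q ∈ O, ∀ u ∈ V,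
    VectorField.lieBracket ℝ (fun y => F (y, u)) (fun y => dU F (y, u)) q = 0

/-! ### The maximized Hamiltonian and the invariant moving frame, in coordinates

A system `q' = F (q, u)` with `(q, u) ∈ O × V`, `O` open in the plane and `V` open in the line.
The level surface `ℋ = {h = 1}` of the maximized Hamiltonian in the cotangent bundle is
parametrized by `(q, u)`, through `(q, u) ↦ (q, p (q, u))`, where `p (q, u)` is the covector of
`ℋ_q` at which the maximum is attained at the control `u`. -/

/-- The symplectic form `σ = dp ∧ dq` of the cotangent bundle; a tangent vector is
`(δq, δp)`. -/
def symplectic (ξ η : Plane × Coplane) : ℝ := ξ.2 η.1 - η.2 ξ.1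

/-- `w` is the value at `lam` of the Hamiltonian vector field of `h`:
`σ(·, w) = dh` at `lam`. -/
def IsHamiltonianVector (h : Plane × Coplane → ℝ) (lam w : Plane × Coplane) : Prop :=
  ∀ ξ, symplectic ξ w = fderiv ℝ h lam ξ

/-- `h` is, near the point `(q, p)` of the cotangent bundle, the maximized Hamiltonian
`h (q', p') = max ⟨p', F (q', w)⟩`, the maximum being taken over the controls `w` in a
neighbourhood `N` of `u` (`N` may be all of `V`). -/
def IsMaximizedHamiltonian (F : Plane × ℝ → Plane) (V : Set ℝ) (q : Plane) (u : ℝ)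
    (p : Coplane) (h : Plane × Coplane → ℝ) : Prop :=
  ∃ N ⊆ V, N ∈ 𝓝 u ∧
    ∀ᶠ lam : Plane × Coplane in 𝓝 (q, p),
      IsGreatest ((fun w => lam.2 (F (lam.1, w))) '' N) (h lam)

/-- The Lie derivative `L_X η` of a one-form `η` along a vector field `X`. -/
noncomputable def lieDerivForm (X : Plane × ℝ → Plane × ℝ)
    (η : Plane × ℝ → (Plane × ℝ →L[ℝ] ℝ)) (x : Plane × ℝ) : Plane × ℝ →L[ℝ] ℝ :=
  fderiv ℝ η x (X x) + (η x).comp (fderiv ℝ X x)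

/-- The restriction to `ℋ` of the Liouville one-form `p dq`, in the coordinates `(q, u)`. -/
noncomputable def liouville (p : Plane × ℝ → Coplane) (x : Plane × ℝ) : Plane × ℝ →L[ℝ] ℝ :=
  (p x).comp (ContinuousLinearMap.fst ℝ Plane ℝ)

/-- The feedback-invariant objects of the system `q' = F (q, u)`, `(q, u) ∈ O × V`, as objects on
the level surface `ℋ` in the coordinates `(q, u)`: the covector `p`, the Hamiltonian vector field
`H`, the vertical vector field `v`, the function `b` and the curvature `k`. -/
structure IsMovingFrame (F : Plane × ℝ → Plane) (O : Set Plane) (V : Set ℝ)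
    (p : Plane × ℝ → Coplane) (H v : Plane × ℝ → Plane × ℝ) (b k : Plane × ℝ → ℝ) : Prop where
  smooth_p : ContDiffOn ℝ ∞ p (O ×ˢ V)
  smooth_H : ContDiffOn ℝ ∞ H (O ×ˢ V)
  smooth_v : ContDiffOn ℝ ∞ v (O ×ˢ V)
  smooth_b : ContDiffOn ℝ ∞ b (O ×ˢ V)
  smooth_k : ContDiffOn ℝ ∞ k (O ×ˢ V)
  /-- `(q, p (q, u))` lies on the level `h = 1` of the maximized Hamiltonian, the maximum is
  attained at `u`, and `H`, carried to the cotangent bundle, is the Hamiltonian field of `h`. -/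
  hamiltonian : ∀ x ∈ O ×ˢ V, ∃ h : Plane × Coplane → ℝ,
    IsMaximizedHamiltonian F V x.1 x.2 (p x) h ∧
    ContDiffAt ℝ ∞ h (x.1, p x) ∧
    h (x.1, p x) = 1 ∧ p x (F x) = 1 ∧
    IsHamiltonianVector h (x.1, p x)
      (fderiv ℝ (fun y : Plane × ℝ => (y.1, p y)) x (H x))
  /-- `v` is tangent to the fibres `ℋ_q`. -/
  vertical : ∀ x ∈ O ×ˢ V, (v x).1 = 0
  /-- `L_v² s = -s + b L_v s`. -/
  natural : ∀ x ∈ O ×ˢ V,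
    lieDerivForm v (lieDerivForm v (liouville p)) x
      = - liouville p x + b x • lieDerivForm v (liouville p) x
  /-- `[H, [v, H]] = k v`. -/
  curvature : ∀ x ∈ O ×ˢ V,
    VectorField.lieBracket ℝ H (VectorField.lieBracket ℝ v H) x = k x • v x

/-- The control `u` is a natural parameter of the fibres `ℋ_q`: the invariant vertical field `v`
is `∂/∂u`. -/
def IsNaturalControl (F : Plane × ℝ → Plane) (O : Set Plane) (V : Set ℝ) : Prop :=
  ∃ p H b k, IsMovingFrame F O V p H (fun _ => (0, 1)) b k

/-! ### Families of diffeomorphisms generated by the fields `X_u` -/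

/-- The field `X_u = (a₁(u) + q₂) ∂/∂q₁ + (a₂(u, q₂) - q₁) ∂/∂q₂`. -/
noncomputable def fieldX (a₁ : ℝ → ℝ) (a₂ : ℝ × ℝ → ℝ) (u : ℝ) (q : Plane) : Plane :=
  !₂[a₁ u + q 1, a₂ (u, q 1) - q 0]

/-- `P u`, `u ∈ V`, is a smooth family of diffeomorphisms from `O` onto open subsets of the plane
that is generated by a time-dependent vector field of the form `fieldX a₁ a₂`, with smooth `a₁`
and `a₂` (`a₂` being defined on an open set that contains all the values at which it is used):
`dP_u/du = X_u ∘ P_u`. -/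
structure IsGeneratedFamily (a₁ : ℝ → ℝ) (a₂ : ℝ × ℝ → ℝ) (P : ℝ → Plane → Plane)
    (O : Set Plane) (V : Set ℝ) : Prop where
  isOpen_O : IsOpen O
  isOpen_V : IsOpen V
  smooth_a₁ : ContDiffOn ℝ ∞ a₁ V
  smooth_a₂ : ∃ D : Set (ℝ × ℝ), IsOpen D ∧ ContDiffOn ℝ ∞ a₂ D ∧
    ∀ q ∈ O, ∀ u ∈ V, (u, P u q 1) ∈ D
  smooth_P : ContDiffOn ℝ ∞ (fun x : Plane × ℝ => P x.2 x.1) (O ×ˢ V)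
  injOn : ∀ u ∈ V, InjOn (P u) O
  bijective : ∀ q ∈ O, ∀ u ∈ V, Function.Bijective (fderiv ℝ (P u) q)
  generated : ∀ q ∈ O, ∀ u ∈ V, HasDerivAt (fun t => P t q) (fieldX a₁ a₂ u (P u q)) u

/-- `P_{u*} (F (·, u), ∂F/∂u (·, u)) = (∂/∂q₁, ∂/∂q₂)`. -/
def Straightens (P : ℝ → Plane → Plane) (F : Plane × ℝ → Plane)
    (O : Set Plane) (V : Set ℝ) : Prop :=
  ∀ q ∈ O, ∀ u ∈ V, fderiv ℝ (P u) q (F (q, u)) = e₁ ∧ fderiv ℝ (P u) q (dU F (q, u)) = e₂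

/-! ### Control systems on manifolds -/

section Manifolds

variable {M : Type*} [TopologicalSpace M] [ChartedSpace Plane M]
variable {U : Type*} [TopologicalSpace U] [ChartedSpace ℝ U]

/-- The right-hand side of the control system `q' = f (q, u)` is smooth. -/
def IsSmoothSystem [IsManifold (𝓡 2) ∞ M]
    (f : (q : M) → U → TangentSpace (𝓡 2) q) : Prop :=
  ContMDiff ((𝓡 2).prod 𝓘(ℝ, ℝ)) (𝓡 2).tangent ∞
    (fun x : M × U => (⟨x.1, f x.1 x.2⟩ : TangentBundle (𝓡 2) M))

/-- The right-hand side of the system in a chart `e` of the state space and a chart `e'` of the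
control set; it is meaningful on `e.target ×ˢ e'.target`. -/
noncomputable def localRep (f : (q : M) → U → TangentSpace (𝓡 2) q)
    (e : OpenPartialHomeomorph M Plane) (e' : OpenPartialHomeomorph U ℝ)
    (x : Plane × ℝ) : Plane :=
  mfderiv (𝓡 2) 𝓘(ℝ, Plane) e (e.symm x.1) (f (e.symm x.1) (e'.symm x.2))

/-- The regularity assumptions: `f ∧ ∂f/∂u ≠ 0`, and `∂f/∂u ∧ ∂²f/∂u²` is nonzero and of the same
sign, that is, the curves `f (q, ·)` are strictly convex around the origin. The condition does
not depend on the charts nor on orientations. -/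
def IsRegularSystem (f : (q : M) → U → TangentSpace (𝓡 2) q) : Prop :=
  ∀ e ∈ IsManifold.maximalAtlas (𝓡 2) ∞ M, ∀ e' ∈ IsManifold.maximalAtlas 𝓘(ℝ, ℝ) ∞ U,
    ∀ x ∈ e.target ×ˢ e'.target,
      0 < wedge (localRep f e e' x) (dU (localRep f e e') x)
        * wedge (dU (localRep f e e') x) (dU (dU (localRep f e e')) x)

/-- In all charts the moving frame with its invariants `b` and `k` exists. -/
def HasInvariants (f : (q : M) → U → TangentSpace (𝓡 2) q) : Prop :=
  ∀ e ∈ IsManifold.maximalAtlas (𝓡 2) ∞ M, ∀ e' ∈ IsManifold.maximalAtlas 𝓘(ℝ, ℝ) ∞ U,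
    ∃ p H v b k, IsMovingFrame (localRep f e e') e.target e'.target p H v b k

/-- The curvature vanishes identically. -/
def CurvatureVanishes (f : (q : M) → U → TangentSpace (𝓡 2) q) : Prop :=
  ∀ e ∈ IsManifold.maximalAtlas (𝓡 2) ∞ M, ∀ e' ∈ IsManifold.maximalAtlas 𝓘(ℝ, ℝ) ∞ U,
    ∀ p H v b k, IsMovingFrame (localRep f e e') e.target e'.target p H v b k →
      ∀ x ∈ e.target ×ˢ e'.target, k x = 0

/-- The derivative of the invariant `b` along the Hamiltonian field vanishes identically. -/
def DerivBVanishes (f : (q : M) → U → TangentSpace (𝓡 2) q) : Prop :=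
  ∀ e ∈ IsManifold.maximalAtlas (𝓡 2) ∞ M, ∀ e' ∈ IsManifold.maximalAtlas 𝓘(ℝ, ℝ) ∞ U,
    ∀ p H v b k, IsMovingFrame (localRep f e e') e.target e'.target p H v b k →
      ∀ x ∈ e.target ×ˢ e'.target, fderiv ℝ b x (H x) = 0

/-- `Θ (q, u) = (φ q, ψ (q, u))` is a feedback transformation, defined near `(q₀, u₀)`, from the
system `q' = f (q, u)` to the system `q' = G (q, w)`, `(q, w) ∈ O × V`: `Θ` is a diffeomorphism
of its source onto `O × V`, `φ` is a diffeomorphism onto `O` (a chart of the state space), and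
`T_q φ (f (q, u)) = G (φ q, ψ (q, u))`. -/
structure IsLocalFeedback (f : (q : M) → U → TangentSpace (𝓡 2) q) (q₀ : M) (u₀ : U)
    (Θ : OpenPartialHomeomorph (M × U) (Plane × ℝ)) (φ : OpenPartialHomeomorph M Plane)
    (O : Set Plane) (V : Set ℝ) (G : Plane × ℝ → Plane) : Prop where
  mem_source : (q₀, u₀) ∈ Θ.source
  target_eq : Θ.target = O ×ˢ V
  smooth : ContMDiffOn ((𝓡 2).prod 𝓘(ℝ, ℝ)) 𝓘(ℝ, Plane × ℝ) ∞ Θ Θ.source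
  smooth_symm : ContMDiffOn 𝓘(ℝ, Plane × ℝ) ((𝓡 2).prod 𝓘(ℝ, ℝ)) ∞ Θ.symm Θ.target
  chart : φ ∈ IsManifold.maximalAtlas (𝓡 2) ∞ M
  chart_target : φ.target = O
  triangular : ∀ x ∈ Θ.source, x.1 ∈ φ.source ∧ (Θ x).1 = φ x.1
  transforms : ∀ x ∈ Θ.source,
    mfderiv (𝓡 2) 𝓘(ℝ, Plane) φ x.1 (f x.1 x.2) = G (Θ x)

end Manifolds

/-! Everything is reduced to three vector fields in the coordinates `(q, u)`: the Hamiltonian field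
`H`, the vertical field `v`, and `Z = [v, H]`. The covector `p` and its derivative along `v` form
the basis dual to `F` and the horizontal part of `Z`. Hence `L_v² s = -s + b L_v s` is dual to the
statement that `W = [v, Z] + H + b Z` is vertical. Together with `[H, Z] = k v` this gives
`IsBracketFrame`, which no longer mentions covectors. `IsMovingFrame.isBracketFrame` and
`IsBracketFrame.exists_isMovingFrame` translate in the two directions, and `IsBracketFrame.pullback`
carries frames through feedback transformations.

The Jacobi identity yields `[v, [H, Z]] = [H, [v, Z]] = [H, W] - (Hb) Z - b [H, Z]`. Its horizontal
part does two things. It shows that `[H, Z]` is vertical once it is parallel to `Z` horizontally,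
which leaves a single scalar equation for the vertical component of `H` and so gives existence of
the frame (`exists_isBracketFrame`). It also shows `W = -(Hb) v`. So if `k = 0` and `Hb = 0`, the
brackets are `[v, H] = Z`, `[H, Z] = 0`, `[v, Z] = -H - b Z`, and the span of `H` and `Z` is
preserved by `v` and closed under brackets.

The one-form `θ` that vanishes on `H` and `Z` and equals `1` on `v` is then closed. A local
primitive of `θ`, taken as the new control, makes `v = ∂/∂u` and makes `H` horizontal; `[H, Z] = 0`
then says that `F` and `∂F/∂u` commute (`IsBracketFrame.exists_natural_control`,
`IsBracketFrame.commuting`). Conversely, commutation in any control forces `H` and `Z` to be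
horizontal, hence `k = 0`; if moreover `v = ±∂/∂u`, then `Hb = 0` (`IsBracketFrame.of_commuting`,
`IsBracketFrame.fderiv_b_of_commuting`).

For the normal form, let `A = DP_w` be the coframe that sends `G` and `∂G/∂w` to `e₁` and `e₂`.
Commutation means that `A` is closed in `q`, so that it has a primitive `P_w`. In a natural control
`G_ww = -G - b G_w`, and this is equivalent to `∂A/∂w` being `A` followed by the matrix with rows
`(0, 1)` and `(-1, b)`. That matrix is the Jacobian of the field generating `P_w`, which therefore
has the form `X_w`, with `b = ∂a₂/∂q₂` (`exists_generatedFamily`, and conversely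
`IsGeneratedFamily.straightens`). -/

open VectorField (lieBracket)

/-! ### Calculus on open sets -/

theorem minSmoothness_two_le_infty : minSmoothness ℝ 2 ≤ ∞ := by
  rw [minSmoothness_of_isRCLikeNormedField]
  exact WithTop.coe_le_coe.2 (le_top : (2 : ℕ∞) ≤ ⊤)

section Calculus

variable {E F G : Type*} [NormedAddCommGroup E] [NormedSpace ℝ E]
  [NormedAddCommGroup F] [NormedSpace ℝ F] [NormedAddCommGroup G] [NormedSpace ℝ G]
  {Ω : Set E}

theorem ContDiffOn.differentiableAt_of_isOpen {f : E → F} (hf : ContDiffOn ℝ ∞ f Ω)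
    (hΩ : IsOpen Ω) {x : E} (hx : x ∈ Ω) : DifferentiableAt ℝ f x :=
  (hf.contDiffAt (hΩ.mem_nhds hx)).differentiableAt (by simp)

theorem ContDiffOn.fderiv_infty {f : E → F} (hf : ContDiffOn ℝ ∞ f Ω) (hΩ : IsOpen Ω) :
    ContDiffOn ℝ ∞ (fderiv ℝ f) Ω :=
  hf.fderiv_of_isOpen hΩ (by simp)

theorem ContDiffOn.fderiv_along {f : E → F} {X : E → E} (hf : ContDiffOn ℝ ∞ f Ω)
    (hX : ContDiffOn ℝ ∞ X Ω) (hΩ : IsOpen Ω) :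
    ContDiffOn ℝ ∞ (fun x => fderiv ℝ f x (X x)) Ω :=
  (hf.fderiv_infty hΩ).clm_apply hX

theorem ContDiffOn.lieBracket_of_isOpen {X Y : E → E} (hX : ContDiffOn ℝ ∞ X Ω)
    (hY : ContDiffOn ℝ ∞ Y Ω) (hΩ : IsOpen Ω) :
    ContDiffOn ℝ ∞ (VectorField.lieBracket ℝ X Y) Ω :=
  (hY.fderiv_along hX hΩ).sub (hX.fderiv_along hY hΩ)

theorem Set.EqOn.fderiv_eq_of_isOpen {f g : E → F} (h : EqOn f g Ω) (hΩ : IsOpen Ω) {x : E}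
    (hx : x ∈ Ω) : fderiv ℝ f x = fderiv ℝ g x :=
  (h.eventuallyEq_of_mem (hΩ.mem_nhds hx)).fderiv_eq

theorem Set.EqOn.lieBracket_eq_of_isOpen {X X' Y Y' : E → E} (h : EqOn X X' Ω) (h' : EqOn Y Y' Ω)
    (hΩ : IsOpen Ω) {x : E} (hx : x ∈ Ω) :
    VectorField.lieBracket ℝ X Y x = VectorField.lieBracket ℝ X' Y' x := by
  simp only [VectorField.lieBracket, h.fderiv_eq_of_isOpen hΩ hx, h'.fderiv_eq_of_isOpen hΩ hx,
    h hx, h' hx]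

theorem fderiv_eq_zero_of_eqOn_const {f : E → F} {c : F} (h : ∀ x ∈ Ω, f x = c) (hΩ : IsOpen Ω)
    {x : E} (hx : x ∈ Ω) : fderiv ℝ f x = 0 := by
  have : EqOn f (fun _ => c) Ω := h
  rw [this.fderiv_eq_of_isOpen hΩ hx]
  simp

theorem fderiv_clm_apply_apply {p : E → F →L[ℝ] G} {Y : E → F} {x : E}
    (hp : DifferentiableAt ℝ p x) (hY : DifferentiableAt ℝ Y x) (ξ : E) :
    fderiv ℝ (fun y => p y (Y y)) x ξ = p x (fderiv ℝ Y x ξ) + fderiv ℝ p x ξ (Y x) := by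
  rw [fderiv_clm_apply hp hY]
  simp

theorem fderiv_fderiv_along {f : E → F} {X : E → E} (hf : ContDiffOn ℝ ∞ f Ω)
    (hX : ContDiffOn ℝ ∞ X Ω) (hΩ : IsOpen Ω) {x : E} (hx : x ∈ Ω) (ξ : E) :
    fderiv ℝ (fun y => fderiv ℝ f y (X y)) x ξ
      = fderiv ℝ f x (fderiv ℝ X x ξ) + fderiv ℝ (fderiv ℝ f) x ξ (X x) :=
  fderiv_clm_apply_apply ((hf.fderiv_infty hΩ).differentiableAt_of_isOpen hΩ hx)
    (hX.differentiableAt_of_isOpen hΩ hx) ξ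

theorem ContDiffOn.fderiv_fderiv_symm {f : E → F} (hf : ContDiffOn ℝ ∞ f Ω) (hΩ : IsOpen Ω)
    {x : E} (hx : x ∈ Ω) (ξ η : E) :
    fderiv ℝ (fderiv ℝ f) x ξ η = fderiv ℝ (fderiv ℝ f) x η ξ :=
  ((hf.contDiffAt (hΩ.mem_nhds hx)).isSymmSndFDerivAt
    minSmoothness_two_le_infty).eq ξ η

theorem lieBracket_jacobi {X Y Z : E → E} (hX : ContDiffOn ℝ ∞ X Ω)
    (hY : ContDiffOn ℝ ∞ Y Ω) (hZ : ContDiffOn ℝ ∞ Z Ω) (hΩ : IsOpen Ω) {x : E} (hx : x ∈ Ω) :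
    VectorField.lieBracket ℝ X (VectorField.lieBracket ℝ Y Z) x
      = VectorField.lieBracket ℝ (VectorField.lieBracket ℝ X Y) Z x
        + VectorField.lieBracket ℝ Y (VectorField.lieBracket ℝ X Z) x :=
  VectorField.leibniz_identity_lieBracket (n := ∞) minSmoothness_two_le_infty
    (hX.contDiffAt (hΩ.mem_nhds hx)) (hY.contDiffAt (hΩ.mem_nhds hx))
    (hZ.contDiffAt (hΩ.mem_nhds hx))

theorem fderiv_fst_apply' {X : E → F × G} {x : E} (hX : DifferentiableAt ℝ X x) (ξ : E) :
    (fderiv ℝ X x ξ).1 = fderiv ℝ (fun y => (X y).1) x ξ := by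
  rw [fderiv.fst hX]
  rfl

theorem fderiv_snd_apply' {X : E → F × G} {x : E} (hX : DifferentiableAt ℝ X x) (ξ : E) :
    (fderiv ℝ X x ξ).2 = fderiv ℝ (fun y => (X y).2) x ξ := by
  rw [fderiv.snd hX]
  rfl

theorem lieBracket_fst {X Y : E × F → E × F} {x : E × F} (hX : DifferentiableAt ℝ X x)
    (hY : DifferentiableAt ℝ Y x) :
    (VectorField.lieBracket ℝ X Y x).1
      = fderiv ℝ (fun y => (Y y).1) x (X x) - fderiv ℝ (fun y => (X y).1) x (Y x) := by
  simp only [VectorField.lieBracket, Prod.fst_sub, fderiv_fst_apply' hX, fderiv_fst_apply' hY]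

theorem lieBracket_snd {X Y : E × F → E × F} {x : E × F} (hX : DifferentiableAt ℝ X x)
    (hY : DifferentiableAt ℝ Y x) :
    (VectorField.lieBracket ℝ X Y x).2
      = fderiv ℝ (fun y => (Y y).2) x (X x) - fderiv ℝ (fun y => (X y).2) x (Y x) := by
  simp only [VectorField.lieBracket, Prod.snd_sub, fderiv_snd_apply' hX, fderiv_snd_apply' hY]

theorem fderiv_partial_fst {f : E × F → G} {q : E} {u : F} (hf : DifferentiableAt ℝ f (q, u))
    (ξ : E) : fderiv ℝ (fun y => f (y, u)) q ξ = fderiv ℝ f (q, u) (ξ, 0) := by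
  have h : HasFDerivAt (fun y : E => (y, u)) (ContinuousLinearMap.inl ℝ E F) q :=
    hasFDerivAt_prodMk_left q u
  have := (hf.hasFDerivAt.comp q h).fderiv
  simp only [Function.comp_def] at this
  rw [this]
  simp

end Calculus

/-! ### The plane and the partial derivative in the control -/

theorem hasDerivAt_control {G : Type*} [NormedAddCommGroup G] [NormedSpace ℝ G]
    {F : Plane × ℝ → G} {x : Plane × ℝ} (hF : DifferentiableAt ℝ F x) :
    HasDerivAt (fun t => F (x.1, t)) (fderiv ℝ F x (0, 1)) x.2 := by
  have h : HasDerivAt (fun t : ℝ => (x.1, t)) ((0 : Plane), (1 : ℝ)) x.2 :=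
    (hasDerivAt_const _ _).prodMk (hasDerivAt_id _)
  exact HasFDerivAt.comp_hasDerivAt x.2 (f := fun t : ℝ => (x.1, t)) (l := F)
    hF.hasFDerivAt h

theorem dU_eq_fderiv {F : Plane × ℝ → Plane} {x : Plane × ℝ} (hF : DifferentiableAt ℝ F x) :
    dU F x = fderiv ℝ F x (0, 1) :=
  (hasDerivAt_control hF).deriv

theorem eqOn_dU {F : Plane × ℝ → Plane} {Ω : Set (Plane × ℝ)} (hΩ : IsOpen Ω)
    (hF : ContDiffOn ℝ ∞ F Ω) : EqOn (dU F) (fun x => fderiv ℝ F x (0, 1)) Ω :=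
  fun _ hx => dU_eq_fderiv (hF.differentiableAt_of_isOpen hΩ hx)

theorem contDiffOn_dU {F : Plane × ℝ → Plane} {Ω : Set (Plane × ℝ)} (hΩ : IsOpen Ω)
    (hF : ContDiffOn ℝ ∞ F Ω) : ContDiffOn ℝ ∞ (dU F) Ω :=
  (hF.fderiv_along contDiffOn_const hΩ).congr (eqOn_dU hΩ hF)

theorem fderiv_vertical {F : Plane × ℝ → Plane} {x : Plane × ℝ} (hF : DifferentiableAt ℝ F x)
    {ξ : Plane × ℝ} (hξ : ξ.1 = 0) : fderiv ℝ F x ξ = ξ.2 • dU F x := by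
  have : ξ = ξ.2 • ((0 : Plane), (1 : ℝ)) := by
    ext1 <;> simp [hξ]
  rw [this, map_smul, dU_eq_fderiv hF]
  simp

theorem fderiv_eq_horizontal_add {F : Plane × ℝ → Plane} {x : Plane × ℝ}
    (hF : DifferentiableAt ℝ F x) (ξ : Plane × ℝ) :
    fderiv ℝ F x ξ = fderiv ℝ F x (ξ.1, 0) + ξ.2 • dU F x := by
  have : ξ = (ξ.1, 0) + ((0 : Plane), ξ.2) := by
    ext1 <;> simp
  conv_lhs => rw [this, map_add]
  rw [fderiv_vertical hF (ξ := (0, ξ.2)) rfl]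

/-- The commutator of `F (·, u)` and `∂F/∂u (·, u)` in terms of derivatives on the product. -/
theorem lieBracket_slice_eq {F : Plane × ℝ → Plane} {Ω : Set (Plane × ℝ)} (hΩ : IsOpen Ω)
    (hF : ContDiffOn ℝ ∞ F Ω) {x : Plane × ℝ} (hx : x ∈ Ω) :
    VectorField.lieBracket ℝ (fun y => F (y, x.2)) (fun y => dU F (y, x.2)) x.1
      = fderiv ℝ (dU F) x (F x, 0) - fderiv ℝ F x (dU F x, 0) := by
  simp only [VectorField.lieBracket]
  rw [fderiv_partial_fst (hF.differentiableAt_of_isOpen hΩ hx),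
    fderiv_partial_fst ((contDiffOn_dU hΩ hF).differentiableAt_of_isOpen hΩ hx)]

/-- The wedge product as a continuous bilinear map. -/
noncomputable def wedgeL : Plane →L[ℝ] Plane →L[ℝ] ℝ :=
  LinearMap.mkContinuous₂ (LinearMap.mk₂ ℝ wedge
    (by intros; simp [wedge]; ring) (by intros; simp [wedge]; ring)
    (by intros; simp [wedge]; ring) (by intros; simp [wedge]; ring)) 2 (by
      intro a b
      simp only [LinearMap.mk₂_apply, wedge]
      have h (c : Plane) (i : Fin 2) : |c i| ≤ ‖c‖ := by
        simpa using PiLp.norm_apply_le c i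
      calc |a 0 * b 1 - a 1 * b 0| ≤ |a 0 * b 1| + |a 1 * b 0| := abs_sub _ _
        _ ≤ ‖a‖ * ‖b‖ + ‖a‖ * ‖b‖ := by
          rw [abs_mul, abs_mul]
          gcongr <;> exact h _ _
        _ = 2 * ‖a‖ * ‖b‖ := by ring)

@[simp] theorem wedgeL_apply (a b : Plane) : wedgeL a b = wedge a b := rfl

theorem ContDiffOn.wedge {E : Type*} [NormedAddCommGroup E] [NormedSpace ℝ E] {Ω : Set E}
    {a b : E → Plane} (ha : ContDiffOn ℝ ∞ a Ω) (hb : ContDiffOn ℝ ∞ b Ω) :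
    ContDiffOn ℝ ∞ (fun x => wedge (a x) (b x)) Ω :=
  (wedgeL.contDiff.comp_contDiffOn ha).clm_apply hb

theorem fderiv_wedge {E : Type*} [NormedAddCommGroup E] [NormedSpace ℝ E] {a b : E → Plane}
    {x : E} (ha : DifferentiableAt ℝ a x) (hb : DifferentiableAt ℝ b x) (ξ : E) :
    fderiv ℝ (fun y => wedge (a y) (b y)) x ξ
      = wedge (fderiv ℝ a x ξ) (b x) + wedge (a x) (fderiv ℝ b x ξ) := by
  have := wedgeL.fderiv_of_bilinear ha hb
  simp only [wedgeL_apply] at this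
  rw [this]
  simp [add_comm]

theorem wedge_smul_left (r : ℝ) (a b : Plane) : wedge (r • a) b = r * wedge a b := by
  simp [wedge]; ring

theorem wedge_smul_right (r : ℝ) (a b : Plane) : wedge a (r • b) = r * wedge a b := by
  simp [wedge]; ring

theorem wedge_add_left (a b c : Plane) : wedge (a + b) c = wedge a c + wedge b c := by
  simp [wedge]; ring

theorem wedge_sub_left (a b c : Plane) : wedge (a - b) c = wedge a c - wedge b c := by
  simp [wedge]; ring

theorem wedge_add_right (a b c : Plane) : wedge a (b + c) = wedge a b + wedge a c := by
  simp [wedge]; ring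

theorem wedge_sub_right (a b c : Plane) : wedge a (b - c) = wedge a b - wedge a c := by
  simp [wedge]; ring

theorem wedge_neg_right (a b : Plane) : wedge a (-b) = -wedge a b := by
  simp [wedge]; ring

@[simp] theorem wedge_self (a : Plane) : wedge a a = 0 := by
  simp [wedge]; ring

@[simp] theorem wedge_zero_left (a : Plane) : wedge 0 a = 0 := by
  simp [wedge]

@[simp] theorem wedge_zero_right (a : Plane) : wedge a 0 = 0 := by
  simp [wedge]

theorem wedge_swap (a b : Plane) : wedge a b = -wedge b a := by
  simp [wedge]; ring

/-- Cramer's rule in the plane. -/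
theorem wedge_smul_eq (a b c : Plane) : wedge a b • c = wedge c b • a + wedge a c • b := by
  ext i
  fin_cases i <;> simp [wedge] <;> ring

theorem eq_smul_add_smul {a b : Plane} (h : wedge a b ≠ 0) (c : Plane) :
    c = (wedge c b / wedge a b) • a + (wedge a c / wedge a b) • b := by
  have := congrArg (fun z => (wedge a b)⁻¹ • z) (wedge_smul_eq a b c)
  simp only [smul_add, smul_smul, inv_mul_cancel₀ h, one_smul] at this
  rwa [← div_eq_inv_mul, ← div_eq_inv_mul] at this

theorem wedge_ne_zero_iff {a b : Plane} :
    wedge a b ≠ 0 ↔ ∀ s t : ℝ, s • a + t • b = 0 → s = 0 ∧ t = 0 := by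
  constructor
  · intro h s t hst
    have h1 := congrArg (fun z => wedge z b) hst
    have h2 := congrArg (fun z => wedge a z) hst
    simp only [wedge_add_left, wedge_add_right, wedge_smul_left, wedge_smul_right, wedge_self,
      mul_zero, add_zero, zero_add, wedge_zero_left, wedge_zero_right] at h1 h2
    exact ⟨(mul_eq_zero.1 h1).resolve_right h, (mul_eq_zero.1 h2).resolve_right h⟩
  · intro h h0
    have key (i : Fin 2) : b i • a + (-(a i)) • b = 0 := by
      ext j
      fin_cases i <;> fin_cases j <;> simp [wedge] at h0 ⊢ <;> linarith
    have h1 : a = 0 := by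
      ext i
      simpa using (h _ _ (key i)).2
    have := (h 1 0 (by simp [h1])).1
    exact one_ne_zero this

/-- Linear functionals on the plane are determined by their values on two independent vectors. -/
theorem clm_ext_of_wedge {G : Type*} [NormedAddCommGroup G] [NormedSpace ℝ G] {a b : Plane}
    (h : wedge a b ≠ 0) {p p' : Plane →L[ℝ] G} (ha : p a = p' a) (hb : p b = p' b) : p = p' := by
  ext c
  rw [eq_smul_add_smul h c]
  simp only [map_add, map_smul, ha, hb]

/-! ### Moving frames in terms of brackets of vector fields -/

/-- The invariant frame of the system `F` on an open set `Ω` of the space of pairs `(q, u)`,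
described by brackets of vector fields only, without reference to covectors. -/
structure IsBracketFrame (F : Plane × ℝ → Plane) (Ω : Set (Plane × ℝ))
    (H v : Plane × ℝ → Plane × ℝ) (b k : Plane × ℝ → ℝ) : Prop where
  smooth_H : ContDiffOn ℝ ∞ H Ω
  smooth_v : ContDiffOn ℝ ∞ v Ω
  smooth_b : ContDiffOn ℝ ∞ b Ω
  smooth_k : ContDiffOn ℝ ∞ k Ω
  fst_H : ∀ x ∈ Ω, (H x).1 = F x
  fst_v : ∀ x ∈ Ω, (v x).1 = 0
  indep : ∀ x ∈ Ω, wedge (F x) (lieBracket ℝ v H x).1 ≠ 0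
  natural : ∀ x ∈ Ω, (lieBracket ℝ v (lieBracket ℝ v H) x).1
    = -F x - b x • (lieBracket ℝ v H x).1
  curvature : ∀ x ∈ Ω, lieBracket ℝ H (lieBracket ℝ v H) x = k x • v x

section VerticalFields

variable {F : Plane × ℝ → Plane} {Ω : Set (Plane × ℝ)} {H v Y : Plane × ℝ → Plane × ℝ}

/-- The horizontal part of the bracket of a vertical field with any field. -/
theorem lieBracket_vertical_fst (hΩ : IsOpen Ω) (hv : ContDiffOn ℝ ∞ v Ω)
    (hY : ContDiffOn ℝ ∞ Y Ω) (hv1 : ∀ x ∈ Ω, (v x).1 = 0) {x : Plane × ℝ} (hx : x ∈ Ω) :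
    (lieBracket ℝ v Y x).1 = fderiv ℝ (fun y => (Y y).1) x (v x) := by
  rw [lieBracket_fst (hv.differentiableAt_of_isOpen hΩ hx) (hY.differentiableAt_of_isOpen hΩ hx),
    fderiv_eq_zero_of_eqOn_const hv1 hΩ hx]
  simp

theorem eqOn_lieBracket_vertical_fst (hΩ : IsOpen Ω) (hv : ContDiffOn ℝ ∞ v Ω)
    (hH : ContDiffOn ℝ ∞ H Ω) (hv1 : ∀ x ∈ Ω, (v x).1 = 0) (hH1 : ∀ x ∈ Ω, (H x).1 = F x) :
    EqOn (fun x => (lieBracket ℝ v H x).1) (fun x => fderiv ℝ F x (v x)) Ω := by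
  intro x hx
  have : EqOn (fun y => (H y).1) F Ω := hH1
  simp only [lieBracket_vertical_fst hΩ hv hH hv1 hx, this.fderiv_eq_of_isOpen hΩ hx]

theorem eqOn_lieBracket_lieBracket_vertical_fst (hΩ : IsOpen Ω) (hv : ContDiffOn ℝ ∞ v Ω)
    (hH : ContDiffOn ℝ ∞ H Ω) (hv1 : ∀ x ∈ Ω, (v x).1 = 0) (hH1 : ∀ x ∈ Ω, (H x).1 = F x) :
    EqOn (fun x => (lieBracket ℝ v (lieBracket ℝ v H) x).1)
      (fun x => fderiv ℝ (fun y => fderiv ℝ F y (v y)) x (v x)) Ω := by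
  intro x hx
  simp only [lieBracket_vertical_fst hΩ hv (hv.lieBracket_of_isOpen hH hΩ) hv1 hx,
    (eqOn_lieBracket_vertical_fst hΩ hv hH hv1 hH1).fderiv_eq_of_isOpen hΩ hx]

end VerticalFields

/-! ### From the symplectic description to brackets -/

/-- The term `η ∘ Dv` of the Lie derivative drops out: the form sees only horizontal components, and
that of `v` is identically zero. Only the coefficient is differentiated. -/
theorem lieDerivForm_comp_fst {v : Plane × ℝ → Plane × ℝ} {p : Plane × ℝ → Coplane}
    {Ω : Set (Plane × ℝ)} (hΩ : IsOpen Ω) (hv : ContDiffOn ℝ ∞ v Ω) (hp : ContDiffOn ℝ ∞ p Ω)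
    (hv1 : ∀ x ∈ Ω, (v x).1 = 0) {x : Plane × ℝ} (hx : x ∈ Ω) :
    lieDerivForm v (fun y => (p y).comp (ContinuousLinearMap.fst ℝ Plane ℝ)) x
      = (fderiv ℝ p x (v x)).comp (ContinuousLinearMap.fst ℝ Plane ℝ) := by
  have hpx := hp.differentiableAt_of_isOpen hΩ hx
  refine ContinuousLinearMap.ext fun ξ => ?_
  have h2 : (fderiv ℝ v x ξ).1 = 0 := by
    rw [fderiv_fst_apply' (hv.differentiableAt_of_isOpen hΩ hx),
      fderiv_eq_zero_of_eqOn_const hv1 hΩ hx]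
    simp
  have h1 : fderiv ℝ (fun y => (p y).comp (ContinuousLinearMap.fst ℝ Plane ℝ)) x (v x)
      = (fderiv ℝ p x (v x)).comp (ContinuousLinearMap.fst ℝ Plane ℝ) := by
    rw [fderiv_clm_comp hpx (differentiableAt_const _)]
    refine ContinuousLinearMap.ext fun η => ?_
    simp
  rw [lieDerivForm, h1]
  simp [h2]

theorem lieDerivForm_lieDerivForm_liouville {v : Plane × ℝ → Plane × ℝ} {p : Plane × ℝ → Coplane}
    {Ω : Set (Plane × ℝ)} (hΩ : IsOpen Ω) (hv : ContDiffOn ℝ ∞ v Ω) (hp : ContDiffOn ℝ ∞ p Ω)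
    (hv1 : ∀ x ∈ Ω, (v x).1 = 0) {x : Plane × ℝ} (hx : x ∈ Ω) :
    lieDerivForm v (lieDerivForm v (liouville p)) x
      = (fderiv ℝ (fun y => fderiv ℝ p y (v y)) x (v x)).comp
          (ContinuousLinearMap.fst ℝ Plane ℝ) := by
  rw [← lieDerivForm_comp_fst hΩ hv (hp.fderiv_along hv hΩ) hv1 hx]
  have : EqOn (lieDerivForm v (liouville p))
      (fun y => (fderiv ℝ p y (v y)).comp (ContinuousLinearMap.fst ℝ Plane ℝ)) Ω :=
    fun y hy => lieDerivForm_comp_fst hΩ hv hp hv1 hy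
  rw [lieDerivForm, this hx, this.fderiv_eq_of_isOpen hΩ hx]
  rfl

/-- The equation `L_v² s = -s + b L_v s` as an equation for the covector. -/
theorem natural_iff {v : Plane × ℝ → Plane × ℝ} {p : Plane × ℝ → Coplane} {r : ℝ}
    {Ω : Set (Plane × ℝ)} (hΩ : IsOpen Ω) (hv : ContDiffOn ℝ ∞ v Ω) (hp : ContDiffOn ℝ ∞ p Ω)
    (hv1 : ∀ x ∈ Ω, (v x).1 = 0) {x : Plane × ℝ} (hx : x ∈ Ω) :
    lieDerivForm v (lieDerivForm v (liouville p)) x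
        = - liouville p x + r • lieDerivForm v (liouville p) x ↔
      fderiv ℝ (fun y => fderiv ℝ p y (v y)) x (v x) = - p x + r • fderiv ℝ p x (v x) := by
  rw [lieDerivForm_lieDerivForm_liouville hΩ hv hp hv1 hx,
    show lieDerivForm v (liouville p) x = _ from lieDerivForm_comp_fst hΩ hv hp hv1 hx]
  constructor
  · intro h
    ext1 ξ
    simpa [liouville] using congrArg (fun l => l (ξ, 0)) h
  · intro h
    rw [h]
    refine ContinuousLinearMap.ext fun ξ => ?_
    simp [liouville]

/-- The differential of the maximized Hamiltonian (envelope theorem). -/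
theorem fderiv_maximizedHamiltonian {F : Plane × ℝ → Plane} {V : Set ℝ} {x : Plane × ℝ}
    {p : Coplane} {h : Plane × Coplane → ℝ} (hF : DifferentiableAt ℝ F x)
    (hmax : IsMaximizedHamiltonian F V x.1 x.2 p h) (hd : DifferentiableAt ℝ h (x.1, p))
    (h1 : h (x.1, p) = p (F x)) (ξ : Plane × Coplane) :
    fderiv ℝ h (x.1, p) ξ = p (fderiv ℝ F x (ξ.1, 0)) + ξ.2 (F x) := by
  obtain ⟨N, -, hN, hev⟩ := hmax
  have hu : x.2 ∈ N := mem_of_mem_nhds hN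
  have hFs : HasFDerivAt (fun lam : Plane × Coplane => F (lam.1, x.2))
      ((fderiv ℝ F x).comp ((ContinuousLinearMap.inl ℝ Plane ℝ).comp
        (ContinuousLinearMap.fst ℝ Plane Coplane))) (x.1, p) := by
    have h0 : HasFDerivAt (fun lam : Plane × Coplane => (lam.1, x.2))
      ((ContinuousLinearMap.inl ℝ Plane ℝ).comp
        (ContinuousLinearMap.fst ℝ Plane Coplane)) (x.1, p) :=
      HasFDerivAt.comp (x.1, p) (f := Prod.fst) (g := fun q : Plane => (q, x.2))
        (hasFDerivAt_prodMk_left x.1 x.2) hasFDerivAt_fst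
    exact HasFDerivAt.comp (x.1, p) (g := F) hF.hasFDerivAt h0
  have hg := (hasFDerivAt_snd (𝕜 := ℝ) (p := (x.1, p))).clm_apply hFs
  -- With the control frozen at `u`, the value of the covector on `F` never exceeds `h` nearby and
  -- equals it at the base point. The difference is minimal there, so the two differentials agree.
  have hmin : IsLocalMin (fun lam : Plane × Coplane => h lam - lam.2 (F (lam.1, x.2)))
      (x.1, p) := by
    filter_upwards [hev] with lam hlam
    have : lam.2 (F (lam.1, x.2)) ≤ h lam := hlam.2 ⟨x.2, hu, rfl⟩
    simp only [h1]
    linarith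
  have h0 := hmin.hasFDerivAt_eq_zero (hd.hasFDerivAt.sub hg)
  have := congrArg (fun l => l ξ) h0
  simp only [sub_apply, add_apply,
    ContinuousLinearMap.comp_apply, zero_apply] at this
  rw [sub_eq_zero] at this
  rw [this]
  simp

theorem maximizedHamiltonian_control {F : Plane × ℝ → Plane} {V : Set ℝ} {x : Plane × ℝ}
    {p : Coplane} {h : Plane × Coplane → ℝ} (hF : DifferentiableAt ℝ F x)
    (hmax : IsMaximizedHamiltonian F V x.1 x.2 p h) (h1 : h (x.1, p) = p (F x)) :
    p (dU F x) = 0 := by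
  obtain ⟨N, -, hN, hev⟩ := hmax
  have hgr := hev.self_of_nhds
  have hmax : IsLocalMax (fun t => p (F (x.1, t))) x.2 := by
    filter_upwards [hN] with t ht
    have : p (F (x.1, t)) ≤ h (x.1, p) := hgr.2 ⟨t, ht, rfl⟩
    rwa [h1] at this
  have hd : HasDerivAt (fun t => p (F (x.1, t))) (p (dU F x)) x.2 := by
    rw [dU_eq_fderiv hF]
    exact p.hasFDerivAt.comp_hasDerivAt x.2 (hasDerivAt_control hF)
  exact hmax.hasDerivAt_eq_zero hd

theorem fderiv_graph_apply {p : Plane × ℝ → Coplane} {x : Plane × ℝ}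
    (hp : DifferentiableAt ℝ p x) (ξ : Plane × ℝ) :
    fderiv ℝ (fun y : Plane × ℝ => (y.1, p y)) x ξ = (ξ.1, fderiv ℝ p x ξ) := by
  rw [(hasFDerivAt_fst.prodMk hp.hasFDerivAt).fderiv]
  rfl

/-- Differentiating `p F = 1` and `p F_u = 0` along `v` shows that `p` and its derivative `p'` along
`v` are dual to `F` and `Z = vF`. Differentiating once more turns the equation for `p''` into the
equation for `vZ`. -/
theorem IsMovingFrame.isBracketFrame {F : Plane × ℝ → Plane} {O : Set Plane} {V : Set ℝ}
    {p : Plane × ℝ → Coplane} {H v : Plane × ℝ → Plane × ℝ} {b k : Plane × ℝ → ℝ}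
    (hO : IsOpen O) (hV : IsOpen V) (hF : ContDiffOn ℝ ∞ F (O ×ˢ V))
    (h : IsMovingFrame F O V p H v b k) : IsBracketFrame F (O ×ˢ V) H v b k := by
  have hΩ : IsOpen (O ×ˢ V) := hO.prod hV
  have hFd {x} (hx : x ∈ O ×ˢ V) := hF.differentiableAt_of_isOpen hΩ hx
  have hpF : ∀ x ∈ O ×ˢ V, p x (F x) = 1 := fun x hx => by
    obtain ⟨h, -, -, -, h1, -⟩ := h.hamiltonian x hx
    exact h1
  have hH1 : ∀ x ∈ O ×ˢ V, (H x).1 = F x := by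
    intro x hx
    obtain ⟨hh, hmax, hcd, hh1, hpF, hham⟩ := h.hamiltonian x hx
    have hhp : hh (x.1, p x) = p x (F x) := by rw [hh1, hpF]
    by_contra hne
    -- Testing the Hamiltonian equation on the vertical vectors `(0, η)` isolates the horizontal
    -- part of `H`.
    obtain ⟨η, hη⟩ := SeparatingDual.exists_separating_of_ne (R := ℝ) hne
    apply hη
    have := hham (0, η)
    rw [fderiv_graph_apply (h.smooth_p.differentiableAt_of_isOpen hΩ hx),
      fderiv_maximizedHamiltonian (hFd hx) hmax (hcd.differentiableAt (by simp)) hhp] at this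
    simpa [symplectic, Prod.mk_zero_zero] using this
  have hpU : ∀ x ∈ O ×ˢ V, p x (dU F x) = 0 := by
    intro x hx
    obtain ⟨hh, hmax, hcd, hh1, hpF, hham⟩ := h.hamiltonian x hx
    exact maximizedHamiltonian_control (hFd hx) hmax (by rw [hh1, hpF])
  have hv := h.smooth_v
  have hp := h.smooth_p
  have hv1 := h.vertical
  have hpZ : ∀ x ∈ O ×ˢ V, p x (fderiv ℝ F x (v x)) = 0 := by
    intro x hx
    rw [fderiv_vertical (hFd hx) (hv1 x hx), map_smul, hpU x hx, smul_zero]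
  have hp'F : ∀ x ∈ O ×ˢ V, fderiv ℝ p x (v x) (F x) = 0 := by
    intro x hx
    have := fderiv_clm_apply_apply (hp.differentiableAt_of_isOpen hΩ hx) (hFd hx) (v x)
    rw [fderiv_eq_zero_of_eqOn_const hpF hΩ hx, hpZ x hx] at this
    simpa using this.symm
  have hnat : ∀ x ∈ O ×ˢ V, fderiv ℝ (fun y => fderiv ℝ p y (v y)) x (v x)
      = - p x + b x • fderiv ℝ p x (v x) := fun x hx =>
    (natural_iff hΩ hv hp hv1 hx).1 (h.natural x hx)
  have hp'd {x} (hx : x ∈ O ×ˢ V) := (hp.fderiv_along hv hΩ).differentiableAt_of_isOpen hΩ hx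
  have hZd {x} (hx : x ∈ O ×ˢ V) := (hF.fderiv_along hv hΩ).differentiableAt_of_isOpen hΩ hx
  have hp'Z : ∀ x ∈ O ×ˢ V, fderiv ℝ p x (v x) (fderiv ℝ F x (v x)) = 1 := by
    intro x hx
    have := fderiv_clm_apply_apply (hp'd hx) (hFd hx) (v x)
    rw [fderiv_eq_zero_of_eqOn_const hp'F hΩ hx, hnat x hx] at this
    simp [hpF x hx, hp'F x hx] at this
    linarith
  have hind : ∀ x ∈ O ×ˢ V, wedge (F x) (fderiv ℝ F x (v x)) ≠ 0 := by
    intro x hx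
    rw [wedge_ne_zero_iff]
    intro s t hst
    have e1 := congrArg (p x) hst
    have e2 := congrArg (fderiv ℝ p x (v x)) hst
    simp only [map_add, map_smul, hpF x hx, hpZ x hx, hp'F x hx, hp'Z x hx, map_zero,
      smul_eq_mul] at e1 e2
    constructor <;> linarith
  have eZ := eqOn_lieBracket_vertical_fst hΩ hv h.smooth_H hv1 hH1
  refine ⟨h.smooth_H, hv, h.smooth_b, h.smooth_k, hH1, hv1, fun x hx => ?_, fun x hx => ?_,
    h.curvature⟩
  · have := eZ hx
    simp only at this
    rw [this]
    exact hind x hx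
  · have e1 := eZ hx
    have e2 := eqOn_lieBracket_lieBracket_vertical_fst hΩ hv h.smooth_H hv1 hH1 hx
    simp only at e1 e2
    rw [e1, e2]
    set W := fderiv ℝ (fun y => fderiv ℝ F y (v y)) x (v x) with hW
    have d1 := fderiv_clm_apply_apply (hp.differentiableAt_of_isOpen hΩ hx) (hZd hx) (v x)
    have d2 := fderiv_clm_apply_apply (hp'd hx) (hZd hx) (v x)
    rw [fderiv_eq_zero_of_eqOn_const hpZ hΩ hx, hp'Z x hx] at d1
    rw [fderiv_eq_zero_of_eqOn_const hp'Z hΩ hx, hnat x hx] at d2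
    simp [hpZ x hx, hp'Z x hx] at d1 d2
    -- The covectors `p` and `p'` are a basis, so it suffices to compare the two sides under both of
    -- them.
    have hsub (y : Plane) (h1 : p x y = 0) (h2 : fderiv ℝ p x (v x) y = 0) : y = 0 := by
      have hy := eq_smul_add_smul (hind x hx) y
      have e1 := congrArg (p x) hy
      have e2 := congrArg (fderiv ℝ p x (v x)) hy
      simp only [map_add, map_smul, hpF x hx, hpZ x hx, hp'F x hx, hp'Z x hx, smul_eq_mul,
        h1, h2, mul_one, mul_zero, add_zero, zero_add] at e1 e2
      rw [hy, ← e1, ← e2]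
      simp
    rw [← sub_eq_zero]
    apply hsub
    · simp only [map_sub, map_neg, map_smul, hpF x hx, hpZ x hx, smul_zero]
      linarith
    · simp only [map_sub, map_neg, map_smul, hp'F x hx, hp'Z x hx, smul_eq_mul]
      linarith

/-! ### The maximized Hamiltonian near a regular point -/

/-- A concave function on an interval is largest at its critical point. -/
theorem le_of_hasDerivAt_of_hasDerivAt_nonpos {φ m n : ℝ → ℝ} {a b g w : ℝ}
    (hφ : ∀ t ∈ Icc a b, HasDerivAt φ (m t) t) (hm : ∀ t ∈ Icc a b, HasDerivAt m (n t) t)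
    (hn : ∀ t ∈ Icc a b, n t ≤ 0) (hg : g ∈ Icc a b) (hg0 : m g = 0) (hw : w ∈ Icc a b) :
    φ w ≤ φ g := by
  have hanti : AntitoneOn m (Icc a b) := by
    refine antitoneOn_of_deriv_nonpos (convex_Icc a b)
      (fun t ht => (hm t ht).continuousAt.continuousWithinAt) (fun t ht => ?_) (fun t ht => ?_)
    · exact (hm t (interior_subset ht)).differentiableAt.differentiableWithinAt
    · rw [(hm t (interior_subset ht)).deriv]
      exact hn t (interior_subset ht)
  rcases le_total w g with h | h
  · have hs : Icc w g ⊆ Icc a b := Icc_subset_Icc hw.1 hg.2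
    have hmono : MonotoneOn φ (Icc w g) := by
      refine monotoneOn_of_deriv_nonneg (convex_Icc w g)
        (fun t ht => (hφ t (hs ht)).continuousAt.continuousWithinAt) (fun t ht => ?_)
        (fun t ht => ?_)
      · exact (hφ t (hs (interior_subset ht))).differentiableAt.differentiableWithinAt
      · have ht := interior_subset ht
        rw [(hφ t (hs ht)).deriv, ← hg0]
        exact hanti (hs ht) hg ht.2
    exact hmono (left_mem_Icc.2 h) (right_mem_Icc.2 h) h
  · have hs : Icc g w ⊆ Icc a b := Icc_subset_Icc hg.1 hw.2
    have hmono : AntitoneOn φ (Icc g w) := by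
      refine antitoneOn_of_deriv_nonpos (convex_Icc g w)
        (fun t ht => (hφ t (hs ht)).continuousAt.continuousWithinAt) (fun t ht => ?_)
        (fun t ht => ?_)
      · exact (hφ t (hs (interior_subset ht))).differentiableAt.differentiableWithinAt
      · have ht := interior_subset ht
        rw [(hφ t (hs ht)).deriv, ← hg0]
        exact hanti hg (hs ht) ht.1
    exact hmono (left_mem_Icc.2 h) (right_mem_Icc.2 h) h

theorem isInvertible_real_of_ne_zero {l : ℝ →L[ℝ] ℝ} (h : l 1 ≠ 0) : l.IsInvertible := by
  refine ⟨ContinuousLinearEquiv.unitsEquivAut ℝ (Units.mk0 (l 1) h), ?_⟩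
  ext
  simp

theorem contDiffAt_covector_apply {F : Plane × ℝ → Plane} {z : (Plane × Coplane) × ℝ}
    (hF : ContDiffAt ℝ ∞ F (z.1.1, z.2)) :
    ContDiffAt ℝ ∞ (fun z : (Plane × Coplane) × ℝ => z.1.2 (F (z.1.1, z.2))) z := by
  refine (contDiffAt_fst.snd).clm_apply ?_
  exact ContDiffAt.comp z (f := fun z : (Plane × Coplane) × ℝ => (z.1.1, z.2)) (g := F) hF
    (contDiffAt_fst.fst.prodMk contDiffAt_snd)

theorem hasDerivAt_covector_control {F : Plane × ℝ → Plane} {q : Plane} {w : ℝ} (p : Coplane)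
    (hF : DifferentiableAt ℝ F (q, w)) :
    HasDerivAt (fun t => p (F (q, t))) (p (dU F (q, w))) w := by
  rw [dU_eq_fderiv hF]
  exact p.hasFDerivAt.comp_hasDerivAt w (hasDerivAt_control hF)

/-- The implicit function theorem solves the critical equation `⟨p, F_u⟩ = 0` for the control as a
smooth function `g` of the covector. On a fixed small interval of controls the function `⟨p, F⟩`
stays concave for all nearby covectors, so the critical value is the maximum over that interval. -/
theorem exists_maximizedHamiltonian {F : Plane × ℝ → Plane} {O : Set Plane} {V : Set ℝ}
    (hO : IsOpen O) (hV : IsOpen V) (hF : ContDiffOn ℝ ∞ F (O ×ˢ V)) {x : Plane × ℝ}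
    (hx : x ∈ O ×ˢ V) {p : Coplane} (h1 : p (dU F x) = 0) (h2 : p (dU (dU F) x) < 0) :
    ∃ h, IsMaximizedHamiltonian F V x.1 x.2 p h ∧ ContDiffAt ℝ ∞ h (x.1, p) ∧
      h (x.1, p) = p (F x) := by
  obtain ⟨q, u⟩ := x
  have hΩ : IsOpen (O ×ˢ V) := hO.prod hV
  have hF1 := contDiffOn_dU hΩ hF
  have hF2 := contDiffOn_dU hΩ hF1
  have hsm {K : Plane × ℝ → Plane} (hK : ContDiffOn ℝ ∞ K (O ×ˢ V)) :
      ContDiffAt ℝ ∞ (fun z : (Plane × Coplane) × ℝ => z.1.2 (K (z.1.1, z.2))) ((q, p), u) :=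
    contDiffAt_covector_apply (z := ((q, p), u)) (hK.contDiffAt (hΩ.mem_nhds hx))
  have hinv : (fderiv ℝ (fun z : (Plane × Coplane) × ℝ => z.1.2 (dU F (z.1.1, z.2))) ((q, p), u)
      ∘L .inr ℝ (Plane × Coplane) ℝ).IsInvertible := by
    apply isInvertible_real_of_ne_zero
    have hd := ((hsm hF1).differentiableAt (by simp)).hasFDerivAt
    have hc : HasDerivAt (fun t : ℝ => (((q, p) : Plane × Coplane), t)) (0, 1) u :=
      (hasDerivAt_const _ _).prodMk (hasDerivAt_id _)
    have := HasFDerivAt.comp_hasDerivAt u (f := fun t : ℝ => (((q, p) : Plane × Coplane), t))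
      hd hc
    have h3 := this.unique
      (hasDerivAt_covector_control p (hF1.differentiableAt_of_isOpen hΩ hx))
    simp only [ContinuousLinearMap.comp_apply, ContinuousLinearMap.inr_apply, h3]
    exact h2.ne
  set g := (hsm hF1).implicitFunction (by simp) hinv with hg
  have hgs : ContDiffAt ℝ ∞ g (q, p) := (hsm hF1).contDiffAt_implicitFunction (by simp) hinv
  have hg0 : g (q, p) = u := (hsm hF1).implicitFunction_apply_self (by simp) hinv
  have hgz : ∀ᶠ lam in 𝓝 ((q, p) : Plane × Coplane), lam.2 (dU F (lam.1, g lam)) = 0 := by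
    filter_upwards [(hsm hF1).eventually_apply_implicitFunction (by simp) hinv] with lam hlam
    exact hlam.trans h1
  have hneg : ∀ᶠ z in 𝓝 (((q, p), u) : (Plane × Coplane) × ℝ),
      (z.1.1, z.2) ∈ O ×ˢ V ∧ z.1.2 (dU (dU F) (z.1.1, z.2)) < 0 := by
    refine Filter.Eventually.and ?_ ((hsm hF2).continuousAt.eventually_lt_const h2)
    have : ContinuousAt (fun z : (Plane × Coplane) × ℝ => (z.1.1, z.2)) ((q, p), u) := by
      fun_prop
    exact this.eventually_mem (hΩ.mem_nhds hx)
  rw [nhds_prod_eq, Filter.eventually_prod_iff] at hneg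
  obtain ⟨A, hA, B, hB, hAB⟩ := hneg
  obtain ⟨ε, hε, hεB⟩ := Metric.nhds_basis_closedBall.eventually_iff.1 hB
  rw [Real.closedBall_eq_Icc] at hεB
  refine ⟨fun lam => lam.2 (F (lam.1, g lam)), ⟨Icc (u - ε) (u + ε), fun w hw => ?_,
    Icc_mem_nhds (by linarith) (by linarith), ?_⟩, ?_, by simp [hg0]⟩
  · exact (hAB hA.self_of_nhds (hεB hw)).1.2
  · have hgN : ∀ᶠ lam in 𝓝 ((q, p) : Plane × Coplane), g lam ∈ Icc (u - ε) (u + ε) := by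
      apply hgs.continuousAt.eventually_mem
      rw [hg0]
      exact Icc_mem_nhds (by linarith) (by linarith)
    filter_upwards [hgz, hA, hgN] with lam hz hAl hN
    refine ⟨⟨g lam, hN, rfl⟩, ?_⟩
    rintro _ ⟨w, hw, rfl⟩
    refine le_of_hasDerivAt_of_hasDerivAt_nonpos (φ := fun t => lam.2 (F (lam.1, t)))
      (m := fun t => lam.2 (dU F (lam.1, t))) (fun t ht => ?_) (fun t ht => ?_) (fun t ht => (hAB hAl (hεB ht)).2.le) hN hz hw
    · exact hasDerivAt_covector_control _
        (hF.differentiableAt_of_isOpen hΩ (hAB hAl (hεB ht)).1)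
    · exact hasDerivAt_covector_control _
        (hF1.differentiableAt_of_isOpen hΩ (hAB hAl (hεB ht)).1)
  · have : ContDiffAt ℝ ∞ (fun lam : Plane × Coplane => (lam, g lam)) (q, p) :=
      contDiffAt_id.prodMk hgs
    refine ContDiffAt.comp (q, p) (f := fun lam : Plane × Coplane => (lam, g lam))
      (g := fun z : (Plane × Coplane) × ℝ => z.1.2 (F (z.1.1, z.2))) ?_ this
    rw [hg0]
    exact hsm hF

/-! ### From brackets to the symplectic description -/

theorem IsBracketFrame.lieBracket_fst_eq {F : Plane × ℝ → Plane} {Ω : Set (Plane × ℝ)}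
    {H v : Plane × ℝ → Plane × ℝ} {b k : Plane × ℝ → ℝ} (hΩ : IsOpen Ω)
    (hF : ContDiffOn ℝ ∞ F Ω) (h : IsBracketFrame F Ω H v b k) {x : Plane × ℝ} (hx : x ∈ Ω) :
    (lieBracket ℝ v H x).1 = (v x).2 • dU F x :=
  (eqOn_lieBracket_vertical_fst hΩ h.smooth_v h.smooth_H h.fst_v h.fst_H hx).trans
    (fderiv_vertical (hF.differentiableAt_of_isOpen hΩ hx) (h.fst_v x hx))

theorem IsBracketFrame.snd_v_ne_zero {F : Plane × ℝ → Plane} {Ω : Set (Plane × ℝ)}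
    {H v : Plane × ℝ → Plane × ℝ} {b k : Plane × ℝ → ℝ} (hΩ : IsOpen Ω)
    (hF : ContDiffOn ℝ ∞ F Ω) (h : IsBracketFrame F Ω H v b k) {x : Plane × ℝ} (hx : x ∈ Ω) :
    (v x).2 ≠ 0 := by
  have := h.indep x hx
  rw [h.lieBracket_fst_eq hΩ hF hx, wedge_smul_right] at this
  exact left_ne_zero_of_mul this

/-- The covector is forced by `p F = 1` and `p Z = 0`. The equation for `vZ` gives `p' Z = 1`, hence
the strict concavity needed for a maximum at `u`, and the horizontal part of `[H, Z] = k v` gives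
Hamilton's equation for `p`. -/
theorem IsBracketFrame.exists_isMovingFrame {F : Plane × ℝ → Plane} {O : Set Plane} {V : Set ℝ}
    {H v : Plane × ℝ → Plane × ℝ} {b k : Plane × ℝ → ℝ} (hO : IsOpen O) (hV : IsOpen V)
    (hF : ContDiffOn ℝ ∞ F (O ×ˢ V)) (h : IsBracketFrame F (O ×ˢ V) H v b k) :
    ∃ p, IsMovingFrame F O V p H v b k := by
  have hΩ : IsOpen (O ×ˢ V) := hO.prod hV
  have hFd {x} (hx : x ∈ O ×ˢ V) := hF.differentiableAt_of_isOpen hΩ hx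
  have hv := h.smooth_v
  have hH := h.smooth_H
  have hv1 := h.fst_v
  set Z := fun x => fderiv ℝ F x (v x) with hZ
  have eZ : EqOn (fun x => (lieBracket ℝ v H x).1) Z (O ×ˢ V) :=
    eqOn_lieBracket_vertical_fst hΩ hv hH hv1 h.fst_H
  have hZs : ContDiffOn ℝ ∞ Z (O ×ˢ V) := hF.fderiv_along hv hΩ
  have hZd {x} (hx : x ∈ O ×ˢ V) := hZs.differentiableAt_of_isOpen hΩ hx
  have hind : ∀ x ∈ O ×ˢ V, wedge (F x) (Z x) ≠ 0 := fun x hx => by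
    rw [← eZ hx]
    exact h.indep x hx
  have hZc : ∀ x ∈ O ×ˢ V, Z x = (v x).2 • dU F x := fun x hx =>
    fderiv_vertical (hFd hx) (hv1 x hx)
  have hnat : ∀ x ∈ O ×ˢ V, fderiv ℝ Z x (v x) = -F x - b x • Z x := fun x hx => by
    have e1 := eZ hx
    have e2 := eqOn_lieBracket_lieBracket_vertical_fst hΩ hv hH hv1 h.fst_H hx
    have e3 := h.natural x hx
    simp only at e1 e2
    rw [e1, e2] at e3
    exact e3
  -- Cramer's rule: `p ξ = (ξ ∧ Z) / (F ∧ Z)`.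
  set p : Plane × ℝ → Coplane := fun x => (wedge (F x) (Z x))⁻¹ • wedgeL.flip (Z x) with hp
  have hps : ContDiffOn ℝ ∞ p (O ×ˢ V) :=
    ((hF.wedge hZs).inv hind).smul (wedgeL.flip.contDiff.comp_contDiffOn hZs)
  have hpd {x} (hx : x ∈ O ×ˢ V) := hps.differentiableAt_of_isOpen hΩ hx
  have hpF : ∀ x ∈ O ×ˢ V, p x (F x) = 1 := fun x hx => by
    simp [hp, hind x hx]
  have hpZ : ∀ x ∈ O ×ˢ V, p x (Z x) = 0 := fun x hx => by simp [hp]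
  have hc : ∀ x ∈ O ×ˢ V, (v x).2 ≠ 0 := fun x hx => h.snd_v_ne_zero hΩ hF hx
  have hpU : ∀ x ∈ O ×ˢ V, p x (dU F x) = 0 := fun x hx => by
    have := hpZ x hx
    rw [hZc x hx, map_smul, smul_eq_mul] at this
    exact (mul_eq_zero.1 this).resolve_left (hc x hx)
  have hp'F : ∀ x ∈ O ×ˢ V, fderiv ℝ p x (v x) (F x) = 0 := by
    intro x hx
    have := fderiv_clm_apply_apply (hpd hx) (hFd hx) (v x)
    rw [fderiv_eq_zero_of_eqOn_const hpF hΩ hx, show fderiv ℝ F x (v x) = Z x from rfl,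
      hpZ x hx] at this
    simpa using this.symm
  have hp'Z : ∀ x ∈ O ×ˢ V, fderiv ℝ p x (v x) (Z x) = 1 := by
    intro x hx
    have := fderiv_clm_apply_apply (hpd hx) (hZd hx) (v x)
    rw [fderiv_eq_zero_of_eqOn_const hpZ hΩ hx, hnat x hx] at this
    simp [hpF x hx, hpZ x hx] at this
    linarith
  have hpUU : ∀ x ∈ O ×ˢ V, p x (dU (dU F) x) < 0 := by
    intro x hx
    have hU := contDiffOn_dU hΩ hF
    have e1 := fderiv_clm_apply_apply (hpd hx) (hU.differentiableAt_of_isOpen hΩ hx) (v x)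
    rw [fderiv_eq_zero_of_eqOn_const hpU hΩ hx,
      fderiv_vertical (hU.differentiableAt_of_isOpen hΩ hx) (hv1 x hx)] at e1
    have e2 := hp'Z x hx
    rw [hZc x hx] at e2
    simp at e1 e2
    -- Here `e1` is the derivative of `p F_u = 0` along `v` and `e2` is `p' Z = 1`; eliminating `p'
    -- F_u` leaves a value of negative sign.
    have e3 : (v x).2 ^ 2 * p x (dU (dU F) x) = -1 := by
      linear_combination (-(v x).2) * e1 - e2
    by_contra hcon
    nlinarith [sq_nonneg (v x).2]
  have hham : ∀ x ∈ O ×ˢ V, ∀ ξ : Plane, fderiv ℝ p x (H x) ξ = -p x (fderiv ℝ F x (ξ, 0)) := by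
    intro x hx ξ
    -- Both covectors are compared on the basis `F`, `Z`, by differentiating `p F = 1` and `p Z = 0`
    -- along `H`. The vertical parts of `H` and `Z` do not matter, because `p F_u = 0`.
    have key : fderiv ℝ p x (H x)
        = -((p x).comp ((fderiv ℝ F x).comp (ContinuousLinearMap.inl ℝ Plane ℝ))) := by
      apply clm_ext_of_wedge (hind x hx)
      · have := fderiv_clm_apply_apply (hpd hx) (hFd hx) (H x)
        rw [fderiv_eq_zero_of_eqOn_const hpF hΩ hx, fderiv_eq_horizontal_add (hFd hx),
          h.fst_H x hx] at this
        simp [hpU x hx] at this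
        simp
        linarith
      · have := fderiv_clm_apply_apply (hpd hx) (hZd hx) (H x)
        have hcur := congrArg Prod.fst (h.curvature x hx)
        rw [lieBracket_fst (hH.differentiableAt_of_isOpen hΩ hx)
          ((hv.lieBracket_of_isOpen hH hΩ).differentiableAt_of_isOpen hΩ hx),
          eZ.fderiv_eq_of_isOpen hΩ hx,
          show fderiv ℝ (fun y => (H y).1) x = fderiv ℝ F x from
            Set.EqOn.fderiv_eq_of_isOpen h.fst_H hΩ hx, Prod.smul_fst, hv1 x hx, smul_zero,
          sub_eq_zero] at hcur
        have e1 := eZ hx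
        simp only at e1
        rw [fderiv_eq_zero_of_eqOn_const hpZ hΩ hx, hcur, fderiv_eq_horizontal_add (hFd hx),
          e1] at this
        simp [hpU x hx] at this
        simp
        linarith
    simpa using congrArg (fun l => l ξ) key
  refine ⟨p, hps, hH, hv, h.smooth_b, h.smooth_k, fun x hx => ?_, hv1, fun x hx => ?_,
    h.curvature⟩
  · obtain ⟨hh, hmax, hcd, hval⟩ :=
      exists_maximizedHamiltonian hO hV hF hx (hpU x hx) (hpUU x hx)
    refine ⟨hh, hmax, hcd, hval.trans (hpF x hx), hpF x hx, fun ξ => ?_⟩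
    rw [fderiv_graph_apply (hpd hx),
      fderiv_maximizedHamiltonian (hFd hx) hmax (hcd.differentiableAt (by simp)) hval]
    simp only [symplectic, hham x hx, h.fst_H x hx]
    ring
  · rw [natural_iff hΩ hv hps hv1 hx]
    have hp's := hps.fderiv_along hv hΩ
    apply clm_ext_of_wedge (hind x hx)
    · have := fderiv_clm_apply_apply (hp's.differentiableAt_of_isOpen hΩ hx) (hFd hx) (v x)
      rw [fderiv_eq_zero_of_eqOn_const hp'F hΩ hx, show fderiv ℝ F x (v x) = Z x from rfl,
        hp'Z x hx] at this
      simp at this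
      simp [hpF x hx, hp'F x hx]
      linarith
    · have := fderiv_clm_apply_apply (hp's.differentiableAt_of_isOpen hΩ hx) (hZd hx) (v x)
      rw [fderiv_eq_zero_of_eqOn_const hp'Z hΩ hx, hnat x hx] at this
      simp [hp'F x hx, hp'Z x hx] at this
      simp [hpZ x hx, hp'Z x hx]
      linarith

/-! ### Consequences of the Jacobi identity and existence of the frame -/

theorem lieBracket_self_eq_zero {E : Type*} [NormedAddCommGroup E] [NormedSpace ℝ E]
    (X : E → E) (x : E) : lieBracket ℝ X X x = 0 := by
  simp [lieBracket]

section Jacobi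

variable {F : Plane × ℝ → Plane} {Ω : Set (Plane × ℝ)} {H v : Plane × ℝ → Plane × ℝ}
  {b k : Plane × ℝ → ℝ}

/-- By the Jacobi identity `[v, [H, Z]] = [H, [v, Z]]`, as `[Z, Z] = 0`. The field `W = [v, Z] + H +
b Z` is vertical, so `[H, W]` has horizontal part `-W F`, a multiple of `F_u`; the rest is the
Leibniz rule for `b Z`. -/
theorem lieBracket_vertical_curvature_fst (hΩ : IsOpen Ω) (hF : ContDiffOn ℝ ∞ F Ω)
    (hH : ContDiffOn ℝ ∞ H Ω) (hv : ContDiffOn ℝ ∞ v Ω) (hb : ContDiffOn ℝ ∞ b Ω)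
    (hH1 : ∀ x ∈ Ω, (H x).1 = F x)
    (hnat : ∀ x ∈ Ω, (lieBracket ℝ v (lieBracket ℝ v H) x).1
      = -F x - b x • (lieBracket ℝ v H x).1) {x : Plane × ℝ} (hx : x ∈ Ω) :
    (lieBracket ℝ v (lieBracket ℝ H (lieBracket ℝ v H)) x).1
      = -(lieBracket ℝ v (lieBracket ℝ v H) x + H x + b x • lieBracket ℝ v H x).2 • dU F x
        - fderiv ℝ b x (H x) • (lieBracket ℝ v H x).1
        - b x • (lieBracket ℝ H (lieBracket ℝ v H) x).1 := by
  set Z := lieBracket ℝ v H with hZ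
  have hZs : ContDiffOn ℝ ∞ Z Ω := hv.lieBracket_of_isOpen hH hΩ
  have hvZ : ContDiffOn ℝ ∞ (lieBracket ℝ v Z) Ω := hv.lieBracket_of_isOpen hZs hΩ
  set W := (lieBracket ℝ v Z + H) + (b • Z) with hW
  have hWs : ContDiffOn ℝ ∞ W Ω := (hvZ.add hH).add (hb.smul hZs)
  have hW1 : ∀ y ∈ Ω, (W y).1 = 0 := fun y hy => by
    simp only [hW, Pi.add_apply, Pi.smul_apply', Prod.fst_add, Prod.smul_fst, hnat y hy, hH1 y hy]
    abel
  have d {X : Plane × ℝ → Plane × ℝ} (hX : ContDiffOn ℝ ∞ X Ω) : DifferentiableAt ℝ X x :=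
    hX.differentiableAt_of_isOpen hΩ hx
  have hbd := hb.differentiableAt_of_isOpen hΩ hx
  have hjac := lieBracket_jacobi hv hH hZs hΩ hx
  rw [lieBracket_self_eq_zero, zero_add] at hjac
  have h1 : lieBracket ℝ H W x = lieBracket ℝ H (lieBracket ℝ v Z) x
      + (fderiv ℝ b x (H x) • Z x + b x • lieBracket ℝ H Z x) := by
    rw [hW, VectorField.lieBracket_add_right ((d hvZ).add (d hH)) (d (hb.smul hZs)),
      VectorField.lieBracket_add_right (d hvZ) (d hH), lieBracket_self_eq_zero, add_zero,
      show b • Z = fun y => b y • Z y from rfl, VectorField.lieBracket_smul_right hbd (d hZs)]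
  have h2 : (lieBracket ℝ H W x).1 = -(W x).2 • dU F x := by
    have e1 : (lieBracket ℝ W H x).1 = fderiv ℝ F x (W x) :=
      eqOn_lieBracket_vertical_fst hΩ hWs hH hW1 hH1 hx
    rw [VectorField.lieBracket_swap, Prod.fst_neg, e1,
      fderiv_vertical (hF.differentiableAt_of_isOpen hΩ hx) (hW1 x hx), neg_smul]
  rw [hjac]
  have h3 := congrArg Prod.fst h1
  rw [h2] at h3
  have h4 : (W x).2 = (lieBracket ℝ v Z x + H x + b x • Z x).2 := rfl
  rw [← h4, h3]
  simp only [Prod.fst_add, Prod.smul_fst]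
  abel

/-- The brackets `[H, [v, H]]` have no horizontal part as soon as the part transversal to
`[v, H]` vanishes. -/
theorem isBracketFrame_of_wedge (hΩ : IsOpen Ω) (hF : ContDiffOn ℝ ∞ F Ω)
    (hH : ContDiffOn ℝ ∞ H Ω) (hv : ContDiffOn ℝ ∞ v Ω) (hb : ContDiffOn ℝ ∞ b Ω)
    (hH1 : ∀ x ∈ Ω, (H x).1 = F x) (hv1 : ∀ x ∈ Ω, (v x).1 = 0)
    (hind : ∀ x ∈ Ω, wedge (F x) (lieBracket ℝ v H x).1 ≠ 0)
    (hnat : ∀ x ∈ Ω, (lieBracket ℝ v (lieBracket ℝ v H) x).1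
      = -F x - b x • (lieBracket ℝ v H x).1)
    (hw : ∀ x ∈ Ω, wedge (lieBracket ℝ H (lieBracket ℝ v H) x).1 (lieBracket ℝ v H x).1 = 0) :
    IsBracketFrame F Ω H v b
      (fun x => (lieBracket ℝ H (lieBracket ℝ v H) x).2 / (v x).2) := by
  set Z := lieBracket ℝ v H with hZ
  have hZs : ContDiffOn ℝ ∞ Z Ω := hv.lieBracket_of_isOpen hH hΩ
  have hYs : ContDiffOn ℝ ∞ (lieBracket ℝ H Z) Ω := hH.lieBracket_of_isOpen hZs hΩ
  have hZc : ∀ x ∈ Ω, (Z x).1 = (v x).2 • dU F x := fun x hx =>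
    (eqOn_lieBracket_vertical_fst hΩ hv hH hv1 hH1 hx).trans
      (fderiv_vertical (hF.differentiableAt_of_isOpen hΩ hx) (hv1 x hx))
  have hc : ∀ x ∈ Ω, (v x).2 ≠ 0 := fun x hx => by
    have := hind x hx
    rw [hZc x hx, wedge_smul_right] at this
    exact left_ne_zero_of_mul this
  have hY1 : ∀ x ∈ Ω, (lieBracket ℝ H Z x).1 = 0 := by
    intro x hx
    -- Differentiate `[H, Z] ∧ Z = 0` (horizontal parts) along `v`. In `v[H, Z] ∧ Z` every term is
    -- parallel to `Z`, or is `b` times the wedge that already vanishes. In `[H, Z] ∧ vZ` only `-[H,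
    -- Z] ∧ F` survives, so `[H, Z]` is parallel to both `F` and `Z`.
    have e1 := fderiv_wedge (hYs.fst.differentiableAt_of_isOpen hΩ hx)
      (hZs.fst.differentiableAt_of_isOpen hΩ hx) (v x)
    rw [fderiv_eq_zero_of_eqOn_const hw hΩ hx, ← lieBracket_vertical_fst hΩ hv hYs hv1 hx,
      ← lieBracket_vertical_fst hΩ hv hZs hv1 hx, hnat x hx,
      lieBracket_vertical_curvature_fst hΩ hF hH hv hb hH1 hnat hx, ← hZ] at e1
    have hU : wedge (dU F x) (Z x).1 = 0 := by
      rw [hZc x hx, wedge_smul_right, wedge_self, mul_zero]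
    simp only [wedge_sub_left, wedge_smul_left, wedge_sub_right, wedge_smul_right,
      wedge_neg_right, wedge_self, hw x hx, hU] at e1
    have e2 : wedge (F x) (lieBracket ℝ H Z x).1 = 0 := by
      rw [wedge_swap]
      simp at e1
      linarith
    rw [eq_smul_add_smul (hind x hx) (lieBracket ℝ H Z x).1, e2, hw x hx]
    simp
  refine ⟨hH, hv, hb, hYs.snd.div hv.snd hc, hH1, hv1, hind, hnat, fun x hx => ?_⟩
  ext1
  · rw [hY1 x hx, Prod.smul_fst, hv1 x hx, smul_zero]
  · rw [Prod.smul_snd, smul_eq_mul, div_mul_cancel₀ _ (hc x hx)]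

/-- The vertical part of `[v, [v, H]] + H + b [v, H]` is governed by the derivative of `b` along
the Hamiltonian field. -/
theorem IsBracketFrame.fderiv_b (hΩ : IsOpen Ω) (hF : ContDiffOn ℝ ∞ F Ω)
    (h : IsBracketFrame F Ω H v b k) {x : Plane × ℝ} (hx : x ∈ Ω) :
    (lieBracket ℝ v (lieBracket ℝ v H) x + H x + b x • lieBracket ℝ v H x).2
      = -(fderiv ℝ b x (H x) * (v x).2) := by
  have hYs := h.smooth_H.lieBracket_of_isOpen (h.smooth_v.lieBracket_of_isOpen h.smooth_H hΩ) hΩ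
  have hY1 : ∀ y ∈ Ω, (lieBracket ℝ H (lieBracket ℝ v H) y).1 = 0 := fun y hy => by
    rw [h.curvature y hy, Prod.smul_fst, h.fst_v y hy, smul_zero]
  have e := lieBracket_vertical_curvature_fst hΩ hF h.smooth_H h.smooth_v h.smooth_b h.fst_H
    h.natural hx
  rw [lieBracket_vertical_fst hΩ h.smooth_v hYs h.fst_v hx,
    fderiv_eq_zero_of_eqOn_const hY1 hΩ hx, hY1 x hx, h.lieBracket_fst_eq hΩ hF hx] at e
  -- All terms that remain are multiples of `F_u`, so the coefficients can be compared once `F_u ≠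
  -- 0`.
  have hU : dU F x ≠ 0 := by
    intro h0
    have := h.indep x hx
    rw [h.lieBracket_fst_eq hΩ hF hx, h0] at this
    exact this (by simp)
  rw [smul_zero, sub_zero, smul_smul, ← sub_smul, zero_apply] at e
  have := (smul_eq_zero.1 e.symm).resolve_right hU
  linarith

/-- Every regular system has an invariant frame. -/
theorem exists_isBracketFrame (hΩ : IsOpen Ω) (hF : ContDiffOn ℝ ∞ F Ω)
    (hreg : ∀ x ∈ Ω, 0 < wedge (F x) (dU F x) * wedge (dU F x) (dU (dU F) x)) :
    ∃ H v b k, IsBracketFrame F Ω H v b k := by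
  have hF1 := contDiffOn_dU hΩ hF
  have hF2 := contDiffOn_dU hΩ hF1
  have hA0 : ∀ x ∈ Ω, wedge (F x) (dU F x) ≠ 0 := fun x hx => left_ne_zero_of_mul (hreg x hx).ne'
  have hB0 : ∀ x ∈ Ω, wedge (dU F x) (dU (dU F) x) ≠ 0 := fun x hx =>
    right_ne_zero_of_mul (hreg x hx).ne'
  have hpos : ∀ x ∈ Ω, 0 < wedge (F x) (dU F x) / wedge (dU F x) (dU (dU F) x) := fun x hx => by
    rw [← mul_div_mul_right _ _ (hB0 x hx)]
    exact div_pos (hreg x hx) (mul_self_pos.2 (hB0 x hx))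
  -- Wedging `vZ = -F - b Z` with `Z` forces `c² F_u ∧ F_uu = F ∧ F_u`. The convexity hypothesis
  -- makes this quotient positive, so that `c` is smooth.
  set c : Plane × ℝ → ℝ :=
    fun x => √(wedge (F x) (dU F x) / wedge (dU F x) (dU (dU F) x)) with hcdef
  have hcs : ContDiffOn ℝ ∞ c Ω :=
    ((hF.wedge hF1).div (hF1.wedge hF2) hB0).sqrt fun x hx => (hpos x hx).ne'
  have hc0 : ∀ x ∈ Ω, c x ≠ 0 := fun x hx => (Real.sqrt_pos.2 (hpos x hx)).ne'
  have hc2 : ∀ x ∈ Ω, c x ^ 2 * wedge (dU F x) (dU (dU F) x) = wedge (F x) (dU F x) :=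
    fun x hx => by
      simp only [hcdef]
      rw [Real.sq_sqrt (hpos x hx).le, div_mul_cancel₀ _ (hB0 x hx)]
  set v : Plane × ℝ → Plane × ℝ := fun x => (0, c x) with hvdef
  have hvs : ContDiffOn ℝ ∞ v Ω := contDiffOn_const.prodMk hcs
  have hv1 : ∀ x ∈ Ω, (v x).1 = 0 := fun _ _ => rfl
  set Z : Plane × ℝ → Plane := fun x => c x • dU F x with hZdef
  have hZs : ContDiffOn ℝ ∞ Z Ω := hcs.smul hF1
  have hFd {x} (hx : x ∈ Ω) := hF.differentiableAt_of_isOpen hΩ hx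
  have hZd {x} (hx : x ∈ Ω) := hZs.differentiableAt_of_isOpen hΩ hx
  have hFZ : ∀ x ∈ Ω, wedge (F x) (Z x) ≠ 0 := fun x hx => by
    simp only [hZdef, wedge_smul_right]
    exact mul_ne_zero (hc0 x hx) (hA0 x hx)
  have hZU : ∀ x ∈ Ω, wedge (dU Z x) (dU F x) = -(c x * wedge (dU F x) (dU (dU F) x)) := by
    intro x hx
    have hcd := hcs.differentiableAt_of_isOpen hΩ hx
    have hUd := hF1.differentiableAt_of_isOpen hΩ hx
    rw [dU_eq_fderiv (hZd hx)]
    simp only [hZdef]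
    rw [fderiv_fun_smul hcd hUd]
    simp only [add_apply, smul_apply, ContinuousLinearMap.smulRight_apply,
      ← dU_eq_fderiv hUd, wedge_add_left, wedge_smul_left, wedge_self]
    rw [wedge_swap (dU (dU F) x)]
    ring
  -- By the choice of `c`, the vector `vZ + F` is parallel to `Z`, and `-b` is the ratio.
  set b : Plane × ℝ → ℝ :=
    fun x => -(wedge (F x) (fderiv ℝ Z x (v x) + F x) / wedge (F x) (Z x)) with hbdef
  have hbs : ContDiffOn ℝ ∞ b Ω :=
    ((hF.wedge ((hZs.fderiv_along hvs hΩ).add hF)).div (hF.wedge hZs) hFZ).neg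
  -- The vertical component of `H` solves the linear equation `[H, Z] ∧ Z = 0` on horizontal parts,
  -- where `g` has the nonzero coefficient `Z_u ∧ Z`. The vertical component of `[v, H]`, which
  -- involves derivatives of `g`, enters only through a multiple of `F_u` and is killed by the wedge
  -- with `Z`.
  set g : Plane × ℝ → ℝ :=
    fun x => -(wedge (fderiv ℝ Z x (F x, 0) - fderiv ℝ F x (Z x, 0)) (Z x)
      / wedge (dU Z x) (Z x)) with hgdef
  have hZUZ : ∀ x ∈ Ω, wedge (dU Z x) (Z x) ≠ 0 := fun x hx => by
    have : Z x = c x • dU F x := rfl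
    rw [this, wedge_smul_right, hZU x hx]
    exact mul_ne_zero (hc0 x hx) (neg_ne_zero.2 (mul_ne_zero (hc0 x hx) (hB0 x hx)))
  have hgs : ContDiffOn ℝ ∞ g Ω :=
    ((((hZs.fderiv_along (hF.prodMk contDiffOn_const) hΩ).sub
      (hF.fderiv_along (hZs.prodMk contDiffOn_const) hΩ)).wedge hZs).div
      ((contDiffOn_dU hΩ hZs).wedge hZs) hZUZ).neg
  set H : Plane × ℝ → Plane × ℝ := fun x => (F x, g x) with hHdef
  have hHs : ContDiffOn ℝ ∞ H Ω := hF.prodMk hgs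
  have hH1 : ∀ x ∈ Ω, (H x).1 = F x := fun _ _ => rfl
  have eZ : EqOn (fun x => (lieBracket ℝ v H x).1) Z Ω := fun x hx =>
    (eqOn_lieBracket_vertical_fst hΩ hvs hHs hv1 hH1 hx).trans (fderiv_vertical (hFd hx) rfl)
  have eZ' : ∀ x ∈ Ω, (lieBracket ℝ v H x).1 = Z x := eZ
  refine ⟨H, v, b, _, isBracketFrame_of_wedge hΩ hF hHs hvs hbs hH1 hv1 (fun x hx => ?_)
    (fun x hx => ?_) (fun x hx => ?_)⟩
  · rw [eZ' x hx]
    exact hFZ x hx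
  · rw [lieBracket_vertical_fst hΩ hvs (hvs.lieBracket_of_isOpen hHs hΩ) hv1 hx,
      eZ.fderiv_eq_of_isOpen hΩ hx, eZ' x hx]
    have hw : wedge (fderiv ℝ Z x (v x) + F x) (Z x) = 0 := by
      rw [fderiv_vertical (hZd hx) (hv1 x hx), show Z x = c x • dU F x from rfl,
        wedge_smul_right, wedge_add_left, wedge_smul_left, hZU x hx, ← hc2 x hx,
        show (v x).2 = c x from rfl]
      ring
    have := eq_smul_add_smul (hFZ x hx) (fderiv ℝ Z x (v x) + F x)
    rw [hw, zero_div, zero_smul, zero_add] at this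
    simp only [hbdef, neg_smul, sub_neg_eq_add]
    rw [← this]
    abel
  · have hHd := hHs.differentiableAt_of_isOpen hΩ hx
    have hBd := (hvs.lieBracket_of_isOpen hHs hΩ).differentiableAt_of_isOpen hΩ hx
    have hUZ : wedge (dU F x) (Z x) = 0 := by
      rw [show Z x = c x • dU F x from rfl, wedge_smul_right, wedge_self, mul_zero]
    rw [lieBracket_fst hHd hBd, eZ.fderiv_eq_of_isOpen hΩ hx,
      show fderiv ℝ (fun y => (H y).1) x = fderiv ℝ F x from rfl, eZ' x hx,
      fderiv_eq_horizontal_add (hZd hx) (H x),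
      fderiv_eq_horizontal_add (hFd hx) (lieBracket ℝ v H x), eZ' x hx,
      show (H x).1 = F x from rfl, show (H x).2 = g x from rfl, wedge_sub_left,
      wedge_add_left, wedge_add_left, wedge_smul_left, wedge_smul_left, hUZ]
    simp only [hgdef, wedge_sub_left]
    have := hZUZ x hx
    field_simp
    ring

end Jacobi

/-! ### Feedback transformations of frames -/

section Pullback

open VectorField (pullback)

variable {F G : Plane × ℝ → Plane} {Ω Ω' : Set (Plane × ℝ)} {H v : Plane × ℝ → Plane × ℝ}
  {b k : Plane × ℝ → ℝ} {T : Plane × ℝ → Plane × ℝ}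

theorem contDiffOn_pullback {E : Type*} [NormedAddCommGroup E] [NormedSpace ℝ E]
    [CompleteSpace E] {Ω Ω' : Set E} {T X : E → E} (hΩ' : IsOpen Ω') (hT : ContDiffOn ℝ ∞ T Ω')
    (hmaps : MapsTo T Ω' Ω) (hinv : ∀ y ∈ Ω', (fderiv ℝ T y).IsInvertible)
    (hX : ContDiffOn ℝ ∞ X Ω) : ContDiffOn ℝ ∞ (pullback ℝ T X) Ω' := by
  refine ContDiffOn.clm_apply (fun y hy => ?_) (hX.comp hT hmaps)
  exact (hinv y hy).contDiffAt_map_inverse.comp_contDiffWithinAt y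
    ((hT.fderiv_infty hΩ') y hy)

theorem fderiv_pullback_apply {E : Type*} [NormedAddCommGroup E] [NormedSpace ℝ E]
    {T X : E → E} {y : E} (hinv : (fderiv ℝ T y).IsInvertible) :
    fderiv ℝ T y (pullback ℝ T X y) = X (T y) :=
  VectorField.fderiv_pullback T X y hinv

theorem pullback_eq_iff {E : Type*} [NormedAddCommGroup E] [NormedSpace ℝ E]
    {T X : E → E} {y ξ : E} (hinv : (fderiv ℝ T y).IsInvertible) :
    pullback ℝ T X y = ξ ↔ fderiv ℝ T y ξ = X (T y) := by
  rw [← fderiv_pullback_apply (X := X) hinv]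
  obtain ⟨e, he⟩ := hinv
  rw [← he]
  exact ⟨fun h => by rw [h], fun h => (e.injective h).symm⟩

theorem eqOn_pullback_lieBracket {E : Type*} [NormedAddCommGroup E] [NormedSpace ℝ E]
    [CompleteSpace E] {Ω Ω' : Set E} {T X Y : E → E} (hΩ : IsOpen Ω) (hΩ' : IsOpen Ω')
    (hT : ContDiffOn ℝ ∞ T Ω') (hmaps : MapsTo T Ω' Ω) (hX : ContDiffOn ℝ ∞ X Ω)
    (hY : ContDiffOn ℝ ∞ Y Ω) :
    EqOn (lieBracket ℝ (pullback ℝ T X) (pullback ℝ T Y)) (pullback ℝ T (lieBracket ℝ X Y)) Ω' :=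
  fun _ hy => (VectorField.pullback_lieBracket (n := ∞) minSmoothness_two_le_infty
    (hT.contDiffAt (hΩ'.mem_nhds hy)) (hX.differentiableAt_of_isOpen hΩ (hmaps hy))
    (hY.differentiableAt_of_isOpen hΩ (hmaps hy))).symm

/-- The invariant frame is carried along by feedback transformations. -/
theorem IsBracketFrame.pullback {L : Plane × ℝ → Plane →L[ℝ] Plane} (hΩ : IsOpen Ω)
    (hΩ' : IsOpen Ω') (hT : ContDiffOn ℝ ∞ T Ω') (hmaps : MapsTo T Ω' Ω)
    (hinv : ∀ y ∈ Ω', (fderiv ℝ T y).IsInvertible)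
    (hL : ∀ y ∈ Ω', ∀ ξ, (fderiv ℝ T y ξ).1 = L y ξ.1)
    (hLinj : ∀ y ∈ Ω', Function.Injective (L y)) (hG : ∀ y ∈ Ω', L y (G y) = F (T y))
    (h : IsBracketFrame F Ω H v b k) :
    IsBracketFrame G Ω' (pullback ℝ T H) (pullback ℝ T v) (b ∘ T) (k ∘ T) := by
  have hLp {y} (hy : y ∈ Ω') (X : Plane × ℝ → Plane × ℝ) :
      L y (VectorField.pullback ℝ T X y).1 = (X (T y)).1 := by
    rw [← hL y hy, fderiv_pullback_apply (hinv y hy)]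
  have hZs := h.smooth_v.lieBracket_of_isOpen h.smooth_H hΩ
  have eZ := eqOn_pullback_lieBracket hΩ hΩ' hT hmaps h.smooth_v h.smooth_H
  have eZ2 : ∀ y ∈ Ω', lieBracket ℝ (VectorField.pullback ℝ T v)
      (lieBracket ℝ (VectorField.pullback ℝ T v) (VectorField.pullback ℝ T H)) y
      = VectorField.pullback ℝ T (lieBracket ℝ v (lieBracket ℝ v H)) y := fun y hy => by
    rw [← eqOn_pullback_lieBracket hΩ hΩ' hT hmaps h.smooth_v hZs hy]
    exact Set.EqOn.lieBracket_eq_of_isOpen (fun _ _ => rfl) eZ hΩ' hy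
  have eY : ∀ y ∈ Ω', lieBracket ℝ (VectorField.pullback ℝ T H)
      (lieBracket ℝ (VectorField.pullback ℝ T v) (VectorField.pullback ℝ T H)) y
      = VectorField.pullback ℝ T (lieBracket ℝ H (lieBracket ℝ v H)) y := fun y hy => by
    rw [← eqOn_pullback_lieBracket hΩ hΩ' hT hmaps h.smooth_H hZs hy]
    exact Set.EqOn.lieBracket_eq_of_isOpen (fun _ _ => rfl) eZ hΩ' hy
  refine ⟨contDiffOn_pullback hΩ' hT hmaps hinv h.smooth_H,
    contDiffOn_pullback hΩ' hT hmaps hinv h.smooth_v, h.smooth_b.comp hT hmaps,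
    h.smooth_k.comp hT hmaps, fun y hy => hLinj y hy ?_, fun y hy => hLinj y hy ?_,
    fun y hy => ?_, fun y hy => hLinj y hy ?_, fun y hy => ?_⟩
  · rw [hLp hy, hG y hy, h.fst_H _ (hmaps hy)]
  · rw [hLp hy, h.fst_v _ (hmaps hy), map_zero]
  · rw [wedge_ne_zero_iff]
    intro s t hst
    have := congrArg (L y) hst
    rw [map_add, map_smul, map_smul, hG y hy, eZ hy, hLp hy, map_zero] at this
    exact wedge_ne_zero_iff.1 (h.indep _ (hmaps hy)) s t this
  · rw [eZ2 y hy, hLp hy, h.natural _ (hmaps hy), map_sub, map_neg, map_smul, hG y hy, eZ hy,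
      hLp hy]
    rfl
  · rw [eY y hy, pullback_eq_iff (hinv y hy), map_smul, fderiv_pullback_apply (hinv y hy),
      h.curvature _ (hmaps hy)]
    rfl

theorem fderiv_comp_pullback (hΩ : IsOpen Ω) (hΩ' : IsOpen Ω') (hT : ContDiffOn ℝ ∞ T Ω')
    (hmaps : MapsTo T Ω' Ω) {y : Plane × ℝ} (hinv : (fderiv ℝ T y).IsInvertible)
    (hb : ContDiffOn ℝ ∞ b Ω) (hy : y ∈ Ω') :
    fderiv ℝ (b ∘ T) y (pullback ℝ T H y) = fderiv ℝ b (T y) (H (T y)) := by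
  rw [fderiv_comp y (hb.differentiableAt_of_isOpen hΩ (hmaps hy))
    (hT.differentiableAt_of_isOpen hΩ' hy), ContinuousLinearMap.comp_apply,
    fderiv_pullback_apply hinv]

end Pullback

/-! ### Commuting systems -/

section Commuting

variable {F : Plane × ℝ → Plane} {Ω : Set (Plane × ℝ)} {H v H' v' : Plane × ℝ → Plane × ℝ}
  {b k b' k' : Plane × ℝ → ℝ}

/-- With `v = c ∂/∂u` and `Z = c F_u`, the product rule gives `vZ = c² F_uu + (vc) F_u`. -/
theorem IsBracketFrame.natural_dU (hΩ : IsOpen Ω) (hF : ContDiffOn ℝ ∞ F Ω)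
    (h : IsBracketFrame F Ω H v b k) {x : Plane × ℝ} (hx : x ∈ Ω) :
    ((v x).2 ^ 2) • dU (dU F) x
      = -F x - (b x * (v x).2 + fderiv ℝ (fun y => (v y).2) x (v x)) • dU F x := by
  have hF1 := contDiffOn_dU hΩ hF
  have hUd := hF1.differentiableAt_of_isOpen hΩ hx
  have hcd := h.smooth_v.snd.differentiableAt_of_isOpen hΩ hx
  have hZs := h.smooth_v.lieBracket_of_isOpen h.smooth_H hΩ
  have e1 : EqOn (fun y => (lieBracket ℝ v H y).1) (fun y => (v y).2 • dU F y) Ω :=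
    fun y hy => h.lieBracket_fst_eq hΩ hF hy
  have e2 := h.natural x hx
  rw [lieBracket_vertical_fst hΩ h.smooth_v hZs h.fst_v hx, e1.fderiv_eq_of_isOpen hΩ hx,
    fderiv_fun_smul hcd hUd, h.lieBracket_fst_eq hΩ hF hx] at e2
  simp only [add_apply, smul_apply, ContinuousLinearMap.smulRight_apply,
    fderiv_vertical hUd (h.fst_v x hx)] at e2
  rw [smul_smul] at e2
  rw [pow_two, eq_sub_of_add_eq e2]
  module

theorem IsBracketFrame.wedge_dU (hΩ : IsOpen Ω) (hF : ContDiffOn ℝ ∞ F Ω)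
    (h : IsBracketFrame F Ω H v b k) {x : Plane × ℝ} (hx : x ∈ Ω) :
    (v x).2 ^ 2 * wedge (dU F x) (dU (dU F) x) = wedge (F x) (dU F x) := by
  have := congrArg (wedge (dU F x)) (h.natural_dU hΩ hF hx)
  rw [wedge_smul_right, wedge_sub_right, wedge_smul_right, wedge_self, wedge_neg_right,
    mul_zero, sub_zero] at this
  rw [this, wedge_swap, neg_neg]

theorem IsBracketFrame.wedge_dU_ne_zero (hΩ : IsOpen Ω) (hF : ContDiffOn ℝ ∞ F Ω)
    (h : IsBracketFrame F Ω H v b k) {x : Plane × ℝ} (hx : x ∈ Ω) :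
    wedge (F x) (dU F x) ≠ 0 := by
  have := h.indep x hx
  rw [h.lieBracket_fst_eq hΩ hF hx, wedge_smul_right] at this
  exact right_ne_zero_of_mul this

/-- The vertical field is unique up to sign. -/
theorem IsBracketFrame.sq_snd_eq (hΩ : IsOpen Ω) (hF : ContDiffOn ℝ ∞ F Ω)
    (h : IsBracketFrame F Ω H v b k) (h' : IsBracketFrame F Ω H' v' b' k') {x : Plane × ℝ}
    (hx : x ∈ Ω) : (v x).2 ^ 2 = (v' x).2 ^ 2 := by
  have h0 := h.wedge_dU_ne_zero hΩ hF hx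
  have e := (h.wedge_dU hΩ hF hx).trans (h'.wedge_dU hΩ hF hx).symm
  rw [← h.wedge_dU hΩ hF hx] at h0
  exact mul_right_cancel₀ (right_ne_zero_of_mul h0) e

/-- The horizontal part of `[H, Z] = k v` reduces under commutation to `(Hc - Z₂) F_u + c H₂ F_uu =
0`, where `c`, `H₂`, `Z₂` are the vertical components of `v`, `H`, `Z`. Since `F_u` and `F_uu` are
independent, `H₂ = 0` and `Z₂ = Hc`. But `Z = [v, H]` with `H₂ = 0` gives `Z₂ = -Hc`, so `Z₂ = 0`.
Two horizontal fields have a horizontal bracket with respect to these coordinates, hence `k c = 0`.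
-/
theorem IsBracketFrame.of_commuting (hΩ : IsOpen Ω) (hF : ContDiffOn ℝ ∞ F Ω)
    (h : IsBracketFrame F Ω H v b k)
    (hcomm : ∀ x ∈ Ω, fderiv ℝ (dU F) x (F x, 0) = fderiv ℝ F x (dU F x, 0)) :
    ∀ x ∈ Ω, (H x).2 = 0 ∧ (lieBracket ℝ v H x).2 = 0 ∧ k x = 0 := by
  have hF1 := contDiffOn_dU hΩ hF
  have hZs := h.smooth_v.lieBracket_of_isOpen h.smooth_H hΩ
  have e1 : EqOn (fun y => (lieBracket ℝ v H y).1) (fun y => (v y).2 • dU F y) Ω :=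
    fun y hy => h.lieBracket_fst_eq hΩ hF hy
  have key : ∀ x ∈ Ω, (H x).2 = 0 ∧
      fderiv ℝ (fun y => (v y).2) x (H x) = (lieBracket ℝ v H x).2 := by
    intro x hx
    have hFd := hF.differentiableAt_of_isOpen hΩ hx
    have hUd := hF1.differentiableAt_of_isOpen hΩ hx
    have hcd := h.smooth_v.snd.differentiableAt_of_isOpen hΩ hx
    have hc := congrArg Prod.fst (h.curvature x hx)
    rw [lieBracket_fst (h.smooth_H.differentiableAt_of_isOpen hΩ hx)
      (hZs.differentiableAt_of_isOpen hΩ hx), e1.fderiv_eq_of_isOpen hΩ hx,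
      show fderiv ℝ (fun y => (H y).1) x = fderiv ℝ F x from
        Set.EqOn.fderiv_eq_of_isOpen h.fst_H hΩ hx, fderiv_fun_smul hcd hUd, Prod.smul_fst,
      h.fst_v x hx, smul_zero, fderiv_eq_horizontal_add hFd (lieBracket ℝ v H x),
      h.lieBracket_fst_eq hΩ hF hx] at hc
    simp only [add_apply, smul_apply, ContinuousLinearMap.smulRight_apply] at hc
    rw [fderiv_eq_horizontal_add hUd (H x), h.fst_H x hx, hcomm x hx,
      show (((v x).2 • dU F x, 0) : Plane × ℝ) = (v x).2 • (dU F x, 0) by simp, map_smul] at hc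
    have hB : wedge (dU F x) (dU (dU F) x) ≠ 0 := by
      have h0 := h.wedge_dU_ne_zero hΩ hF hx
      rw [← h.wedge_dU hΩ hF hx] at h0
      exact right_ne_zero_of_mul h0
    have hc' : (fderiv ℝ (fun y => (v y).2) x (H x) - (lieBracket ℝ v H x).2) • dU F x
        + ((v x).2 * (H x).2) • dU (dU F) x = 0 := by
      rw [← hc]
      module
    obtain ⟨i1, i2⟩ := wedge_ne_zero_iff.1 hB _ _ hc'
    exact ⟨(mul_eq_zero.1 i2).resolve_left (h.snd_v_ne_zero hΩ hF hx), sub_eq_zero.1 i1⟩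
  have hH2 : ∀ x ∈ Ω, (H x).2 = 0 := fun x hx => (key x hx).1
  have hZ2 : ∀ x ∈ Ω, (lieBracket ℝ v H x).2 = 0 := fun x hx => by
    have := lieBracket_snd (h.smooth_v.differentiableAt_of_isOpen hΩ hx)
      (h.smooth_H.differentiableAt_of_isOpen hΩ hx)
    rw [fderiv_eq_zero_of_eqOn_const hH2 hΩ hx, (key x hx).2, zero_apply] at this
    linarith
  refine fun x hx => ⟨hH2 x hx, hZ2 x hx, ?_⟩
  have := lieBracket_snd (h.smooth_H.differentiableAt_of_isOpen hΩ hx)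
      (hZs.differentiableAt_of_isOpen hΩ hx)
  rw [fderiv_eq_zero_of_eqOn_const hH2 hΩ hx, fderiv_eq_zero_of_eqOn_const hZ2 hΩ hx,
    h.curvature x hx] at this
  simpa [h.snd_v_ne_zero hΩ hF hx] using this

/-- In a natural control the invariant `b` of a commuting system is constant along the
Hamiltonian field. -/
theorem IsBracketFrame.fderiv_b_of_commuting (hΩ : IsOpen Ω) (hF : ContDiffOn ℝ ∞ F Ω)
    (h : IsBracketFrame F Ω H v b k)
    (hcomm : ∀ x ∈ Ω, fderiv ℝ (dU F) x (F x, 0) = fderiv ℝ F x (dU F x, 0))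
    (hv : ∀ x ∈ Ω, (v x).2 ^ 2 = 1) {x : Plane × ℝ} (hx : x ∈ Ω) :
    fderiv ℝ b x (H x) = 0 := by
  have hcom := h.of_commuting hΩ hF hcomm
  have hZs := h.smooth_v.lieBracket_of_isOpen h.smooth_H hΩ
  have hcd := h.smooth_v.snd.differentiableAt_of_isOpen hΩ hx
  have hc0 := h.snd_v_ne_zero hΩ hF hx
  -- As `c² = 1`, the derivative of `c` vanishes. Then `[v, Z]` has no vertical part, like `H` and
  -- `Z`, and the formula for the vertical part of `W` leaves `Hb = 0`.
  have hdc : fderiv ℝ (fun y => (v y).2) x = 0 := by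
    have e := fderiv_eq_zero_of_eqOn_const hv hΩ hx
    rw [fderiv_fun_pow 2 hcd] at e
    simpa [hc0] using e
  have e := h.fderiv_b hΩ hF hx
  rw [Prod.snd_add, Prod.snd_add, Prod.smul_snd, (hcom x hx).1, (hcom x hx).2.1,
    lieBracket_snd (h.smooth_v.differentiableAt_of_isOpen hΩ hx)
      (hZs.differentiableAt_of_isOpen hΩ hx), hdc,
    fderiv_eq_zero_of_eqOn_const (fun y hy => (hcom y hy).2.1) hΩ hx] at e
  simpa [hc0] using e

end Commuting

/-! ### Diffeomorphisms between open sets -/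

section Diffeo

variable {E F : Type*} [NormedAddCommGroup E] [NormedSpace ℝ E]
  [NormedAddCommGroup F] [NormedSpace ℝ F]

/-- By the inverse function theorem `f` is open on `Ω`; injectivity makes it a homeomorphism onto
its image, and the inverse inherits smoothness pointwise. -/
theorem exists_diffeo_of_injOn [CompleteSpace E] {f : E → F} {Ω : Set E} (hΩ : IsOpen Ω)
    (hf : ContDiffOn ℝ ∞ f Ω) (hinj : InjOn f Ω) (hinv : ∀ x ∈ Ω, (fderiv ℝ f x).IsInvertible) :
    ∃ ρ : OpenPartialHomeomorph E F, ρ.source = Ω ∧ (∀ x, ρ x = f x) ∧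
      ContDiffOn ℝ ∞ ρ.symm ρ.target := by
  have hopen : IsOpenMap (Ω.domRestrict f) := by
    rw [isOpenMap_iff_nhds_le]
    rintro ⟨x, hx⟩
    obtain ⟨e, he⟩ := hinv x hx
    have hs := (hf.contDiffAt (hΩ.mem_nhds hx)).hasStrictFDerivAt (by simp)
    rw [← he] at hs
    have h1 := hs.map_nhds_eq_of_equiv
    rw [Set.domRestrict_apply, ← h1, Set.domRestrict_eq, ← Filter.map_map,
      map_nhds_subtype_coe_eq_nhds hx (hΩ.mem_nhds hx)]
  let ρ : OpenPartialHomeomorph E F := OpenPartialHomeomorph.ofContinuousOpenRestrict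
    (hinj.toPartialEquiv f Ω) hf.continuousOn hopen hΩ
  refine ⟨ρ, rfl, fun _ => rfl, fun y hy => ?_⟩
  have hx : ρ.symm y ∈ Ω := ρ.map_target hy
  obtain ⟨e, he⟩ := hinv _ hx
  have hfa := hf.contDiffAt (hΩ.mem_nhds hx)
  refine (ρ.contDiffAt_symm (f₀' := e) hy ?_ hfa).contDiffWithinAt
  rw [he]
  exact (hfa.differentiableAt (by simp)).hasFDerivAt

theorem exists_local_diffeo [CompleteSpace E] {f : E → F} {Ω : Set E} (hΩ : IsOpen Ω)
    (hf : ContDiffOn ℝ ∞ f Ω) {x : E} (hx : x ∈ Ω)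
    (hinv : ∀ x ∈ Ω, (fderiv ℝ f x).IsInvertible) :
    ∃ ρ : OpenPartialHomeomorph E F, x ∈ ρ.source ∧ ρ.source ⊆ Ω ∧ (∀ x, ρ x = f x) ∧
      ContDiffOn ℝ ∞ ρ.symm ρ.target := by
  obtain ⟨e, he⟩ := hinv x hx
  have hs := (hf.contDiffAt (hΩ.mem_nhds hx)).hasStrictFDerivAt (by simp)
  rw [← he] at hs
  set ρ₀ := hs.toOpenPartialHomeomorph f
  obtain ⟨ρ, h1, h2, h3⟩ := exists_diffeo_of_injOn (Ω := Ω ∩ ρ₀.source)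
    (hΩ.inter ρ₀.open_source) (hf.mono inter_subset_left)
    (ρ₀.injOn.mono inter_subset_right) (fun x hx => hinv x hx.1)
  exact ⟨ρ, h1 ▸ ⟨hx, hs.mem_toOpenPartialHomeomorph_source⟩, h1 ▸ inter_subset_left, h2, h3⟩

theorem fderiv_symm_comp_fderiv {ρ : OpenPartialHomeomorph E F} (h : ContDiffOn ℝ ∞ ρ ρ.source)
    (h' : ContDiffOn ℝ ∞ ρ.symm ρ.target) {x : E} (hx : x ∈ ρ.source) (ξ : E) :
    fderiv ℝ ρ.symm (ρ x) (fderiv ℝ ρ x ξ) = ξ := by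
  have h1 := ((h'.differentiableAt_of_isOpen ρ.open_target (ρ.map_source hx)).hasFDerivAt).comp x
    (h.differentiableAt_of_isOpen ρ.open_source hx).hasFDerivAt
  have h2 : EqOn (ρ.symm ∘ ρ) id ρ.source := fun y hy => ρ.left_inv hy
  have h3 := h2.fderiv_eq_of_isOpen ρ.open_source hx
  rw [h1.fderiv, fderiv_id] at h3
  simpa using congrArg (fun l => l ξ) h3

theorem isInvertible_fderiv {ρ : OpenPartialHomeomorph E F} (h : ContDiffOn ℝ ∞ ρ ρ.source)
    (h' : ContDiffOn ℝ ∞ ρ.symm ρ.target) {x : E} (hx : x ∈ ρ.source) :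
    (fderiv ℝ ρ x).IsInvertible := by
  refine ContinuousLinearMap.IsInvertible.of_inverse (g := fderiv ℝ ρ.symm (ρ x)) ?_ ?_
  · refine ContinuousLinearMap.ext fun η => ?_
    have := fderiv_symm_comp_fderiv (ρ := ρ.symm) h' h (ρ.map_source hx) η
    simpa [ρ.left_inv hx] using this
  · exact ContinuousLinearMap.ext fun ξ => fderiv_symm_comp_fderiv h h' hx ξ

end Diffeo

theorem isInvertible_of_injective {E : Type*} [NormedAddCommGroup E] [NormedSpace ℝ E]
    [FiniteDimensional ℝ E] {l : E →L[ℝ] E} (h : Function.Injective l) : l.IsInvertible :=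
  ⟨(LinearEquiv.ofInjectiveEndo (l : E →ₗ[ℝ] E) h).toContinuousLinearEquiv, by ext; rfl⟩

/-! ### Natural controls for systems of zero curvature -/

section NaturalControl

variable {F : Plane × ℝ → Plane} {Ω : Set (Plane × ℝ)} {H v H' v' : Plane × ℝ → Plane × ℝ}
  {b k b' k' : Plane × ℝ → ℝ}

theorem IsBracketFrame.congr (hΩ : IsOpen Ω) (h : IsBracketFrame F Ω H v b k)
    (hH : EqOn H' H Ω) (hv : EqOn v' v Ω) (hb : EqOn b' b Ω) (hk : EqOn k' k Ω) :
    IsBracketFrame F Ω H' v' b' k' := by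
  have e : EqOn (lieBracket ℝ v' H') (lieBracket ℝ v H) Ω := fun x hx =>
    hv.lieBracket_eq_of_isOpen hH hΩ hx
  refine ⟨h.smooth_H.congr hH, h.smooth_v.congr hv, h.smooth_b.congr hb, h.smooth_k.congr hk,
    fun x hx => ?_, fun x hx => ?_, fun x hx => ?_, fun x hx => ?_, fun x hx => ?_⟩
  · rw [hH hx, h.fst_H x hx]
  · rw [hv hx, h.fst_v x hx]
  · rw [e hx]
    exact h.indep x hx
  · rw [hv.lieBracket_eq_of_isOpen e hΩ hx, e hx, hb hx, h.natural x hx]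
  · rw [hH.lieBracket_eq_of_isOpen e hΩ hx, hk hx, hv hx, h.curvature x hx]

/-- The defining equation of `b` controls only horizontal parts. The vertical defect is `-(Hb) v`,
so it disappears exactly under the extra hypothesis. -/
theorem IsBracketFrame.lieBracket_eq_of_fderiv_b (hΩ : IsOpen Ω) (hF : ContDiffOn ℝ ∞ F Ω)
    (h : IsBracketFrame F Ω H v b k) {x : Plane × ℝ} (hx : x ∈ Ω)
    (hb : fderiv ℝ b x (H x) = 0) :
    lieBracket ℝ v (lieBracket ℝ v H) x = -H x - b x • lieBracket ℝ v H x := by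
  have h1 := h.natural x hx
  have h2 := h.fderiv_b hΩ hF hx
  rw [hb, zero_mul, neg_zero, Prod.snd_add, Prod.snd_add] at h2
  ext1
  · rw [h1, Prod.fst_sub, Prod.fst_neg, h.fst_H x hx, Prod.smul_fst]
  · rw [Prod.snd_sub, Prod.snd_neg]
    linarith

/-- The one-form dual to `v` in the frame `H`, `v`, `[v, H]`. -/
theorem IsBracketFrame.exists_dual_form (hΩ : IsOpen Ω) (hF : ContDiffOn ℝ ∞ F Ω)
    (h : IsBracketFrame F Ω H v b k) :
    ∃ θ : Plane × ℝ → Plane × ℝ →L[ℝ] ℝ, ContDiffOn ℝ ∞ θ Ω ∧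
      ∀ x ∈ Ω, θ x (H x) = 0 ∧ θ x (lieBracket ℝ v H x) = 0 ∧ θ x (v x) = 1 := by
  set Z := lieBracket ℝ v H with hZ
  have hZs : ContDiffOn ℝ ∞ Z Ω := h.smooth_v.lieBracket_of_isOpen h.smooth_H hΩ
  have hw := (hF.wedge hZs.fst).inv h.indep
  have hc : ∀ x ∈ Ω, (v x).2 ≠ 0 := fun x hx => h.snd_v_ne_zero hΩ hF hx
  refine ⟨fun x => (v x).2⁻¹ • (ContinuousLinearMap.snd ℝ Plane ℝ
    - (H x).2 • ((wedge (F x) (Z x).1)⁻¹ • wedgeL.flip (Z x).1).comp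
      (ContinuousLinearMap.fst ℝ Plane ℝ)
    - (Z x).2 • ((wedge (F x) (Z x).1)⁻¹ • wedgeL (F x)).comp
      (ContinuousLinearMap.fst ℝ Plane ℝ)), ?_, fun x hx => ⟨?_, ?_, ?_⟩⟩
  · refine (h.smooth_v.snd.inv hc).smul ((contDiffOn_const.sub (h.smooth_H.snd.smul
      ((hw.smul (wedgeL.flip.contDiff.comp_contDiffOn hZs.fst)).clm_comp contDiffOn_const))).sub
      (hZs.snd.smul ((hw.smul (wedgeL.contDiff.comp_contDiffOn hF)).clm_comp contDiffOn_const)))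
  · have := h.indep x hx
    rw [← hZ] at this
    simp [h.fst_H x hx, this]
  · have := h.indep x hx
    rw [← hZ] at this
    simp [this]
  · simp [h.fst_v x hx, hc x hx]

theorem IsBracketFrame.span_eq (h : IsBracketFrame F Ω H v b k) {x : Plane × ℝ} (hx : x ∈ Ω)
    (hc : (v x).2 ≠ 0) (ξ : Plane × ℝ) :
    ∃ r s t : ℝ, ξ = r • H x + s • lieBracket ℝ v H x + t • v x := by
  set Z := lieBracket ℝ v H x
  set r := wedge ξ.1 Z.1 / wedge (F x) Z.1
  set s := wedge (F x) ξ.1 / wedge (F x) Z.1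
  refine ⟨r, s, (ξ.2 - r * (H x).2 - s * Z.2) / (v x).2, ?_⟩
  ext1
  · simp only [Prod.fst_add, Prod.smul_fst, h.fst_H x hx, h.fst_v x hx, smul_zero, add_zero]
    exact eq_smul_add_smul (h.indep x hx) ξ.1
  · simp only [Prod.snd_add, Prod.smul_snd, smul_eq_mul]
    field_simp
    ring

/-- Cartan's formula for `dθ (X, Y)`, in which the terms `X (θ Y)` and `Y (θ X)` vanish because both
values are constant. -/
theorem fderiv_form_sub {E G : Type*} [NormedAddCommGroup E] [NormedSpace ℝ E]
    [NormedAddCommGroup G] [NormedSpace ℝ G] {Ω : Set E}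
    {θ : E → E →L[ℝ] G} {X Y : E → E} {r s : G} (hΩ : IsOpen Ω) (hθ : ContDiffOn ℝ ∞ θ Ω)
    (hX : ContDiffOn ℝ ∞ X Ω) (hY : ContDiffOn ℝ ∞ Y Ω) (hr : ∀ x ∈ Ω, θ x (X x) = r)
    (hs : ∀ x ∈ Ω, θ x (Y x) = s) {x : E} (hx : x ∈ Ω) :
    fderiv ℝ θ x (X x) (Y x) - fderiv ℝ θ x (Y x) (X x) = -θ x (lieBracket ℝ X Y x) := by
  have hθd := hθ.differentiableAt_of_isOpen hΩ hx
  have e1 := fderiv_clm_apply_apply hθd (hX.differentiableAt_of_isOpen hΩ hx) (Y x)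
  have e2 := fderiv_clm_apply_apply hθd (hY.differentiableAt_of_isOpen hΩ hx) (X x)
  rw [fderiv_eq_zero_of_eqOn_const hr hΩ hx, zero_apply] at e1
  rw [fderiv_eq_zero_of_eqOn_const hs hΩ hx, zero_apply] at e2
  rw [lieBracket, map_sub, eq_neg_of_add_eq_zero_right e1.symm,
    eq_neg_of_add_eq_zero_right e2.symm]
  abel

/-- If the curvature and the derivative of `b` along `H` vanish, there is locally a function that
is constant along `H` and `[v, H]` and has derivative `1` along `v`. -/
theorem IsBracketFrame.exists_first_integral (hΩ : IsOpen Ω) (hF : ContDiffOn ℝ ∞ F Ω)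
    (h : IsBracketFrame F Ω H v b k) (hk : ∀ x ∈ Ω, k x = 0)
    (hb : ∀ x ∈ Ω, fderiv ℝ b x (H x) = 0) {x₀ : Plane × ℝ} (hx₀ : x₀ ∈ Ω) :
    ∃ (B : Set (Plane × ℝ)) (ψ : Plane × ℝ → ℝ), IsOpen B ∧ x₀ ∈ B ∧ B ⊆ Ω ∧
      ContDiffOn ℝ ∞ ψ B ∧ ∀ x ∈ B, fderiv ℝ ψ x (H x) = 0 ∧ fderiv ℝ ψ x (v x) = 1 := by
  obtain ⟨θ, hθ, hval⟩ := h.exists_dual_form hΩ hF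
  have hZs : ContDiffOn ℝ ∞ (lieBracket ℝ v H) Ω := h.smooth_v.lieBracket_of_isOpen h.smooth_H hΩ
  have hsymm : ∀ x ∈ Ω, ∀ ξ η, fderiv ℝ θ x ξ η = fderiv ℝ θ x η ξ := by
    intro x hx ξ η
    have hH := fun y hy => (hval y hy).1
    have hZ := fun y hy => (hval y hy).2.1
    have hv := fun y hy => (hval y hy).2.2
    -- Closedness of `θ` is tested on the frame `H`, `Z`, `v`. The brackets `[v, H] = Z`, `[H, Z] =
    -- 0` and `[v, Z] = -H - b Z` all lie in the kernel of `θ`.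
    have e1 := fderiv_form_sub hΩ hθ h.smooth_v h.smooth_H hv hH hx
    have e2 := fderiv_form_sub hΩ hθ h.smooth_H hZs hH hZ hx
    have e3 := fderiv_form_sub hΩ hθ h.smooth_v hZs hv hZ hx
    rw [hZ x hx] at e1
    rw [h.curvature x hx, hk x hx, zero_smul, map_zero] at e2
    rw [h.lieBracket_eq_of_fderiv_b hΩ hF hx (hb x hx), map_sub, map_neg, map_smul, hH x hx,
      hZ x hx] at e3
    simp only [neg_zero, smul_zero, sub_zero] at e1 e2 e3
    obtain ⟨r, s, t, rfl⟩ := h.span_eq hx (h.snd_v_ne_zero hΩ hF hx) ξ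
    obtain ⟨r', s', t', rfl⟩ := h.span_eq hx (h.snd_v_ne_zero hΩ hF hx) η
    simp only [map_add, map_smul, add_apply, smul_apply, smul_eq_mul]
    linear_combination (t * r' - r * t') * e1 + (r * s' - s * r') * e2 + (t * s' - s * t') * e3
  obtain ⟨ε, hε, hball⟩ := Metric.isOpen_iff.1 hΩ x₀ hx₀
  obtain ⟨ψ, hψ⟩ := (convex_ball x₀ ε).exists_forall_hasFDerivAt_of_fderiv_symmetric
    Metric.isOpen_ball (fun x hx => (hθ.differentiableAt_of_isOpen hΩ
      (hball hx)).differentiableWithinAt) (fun x hx => hsymm x (hball hx))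
  refine ⟨Metric.ball x₀ ε, ψ, Metric.isOpen_ball, Metric.mem_ball_self hε, hball, ?_,
    fun x hx => ?_⟩
  · rw [contDiffOn_infty_iff_fderiv_of_isOpen Metric.isOpen_ball]
    exact ⟨fun x hx => (hψ x hx).differentiableAt.differentiableWithinAt,
      (hθ.mono hball).congr fun x hx => (hψ x hx).fderiv⟩
  · rw [(hψ x hx).fderiv]
    exact ⟨(hval x (hball hx)).1, (hval x (hball hx)).2.2⟩

/-- Systems with vanishing curvature and vanishing derivative of `b` along `H` have a natural
control for which the Hamiltonian field is horizontal. -/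
theorem IsBracketFrame.exists_natural_control (hΩ : IsOpen Ω) (hF : ContDiffOn ℝ ∞ F Ω)
    (h : IsBracketFrame F Ω H v b k) (hk : ∀ x ∈ Ω, k x = 0)
    (hb : ∀ x ∈ Ω, fderiv ℝ b x (H x) = 0) {x₀ : Plane × ℝ} (hx₀ : x₀ ∈ Ω) :
    ∃ (Θ : OpenPartialHomeomorph (Plane × ℝ) (Plane × ℝ)) (O : Set Plane) (V : Set ℝ),
      IsOpen O ∧ IsOpen V ∧ x₀ ∈ Θ.source ∧ Θ.source ⊆ Ω ∧ Θ.target = O ×ˢ V ∧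
      ContDiffOn ℝ ∞ Θ Θ.source ∧ ContDiffOn ℝ ∞ Θ.symm Θ.target ∧
      (∀ x ∈ Θ.source, (Θ x).1 = x.1) ∧
      IsBracketFrame (F ∘ Θ.symm) (O ×ˢ V) (fun y => (F (Θ.symm y), 0)) (fun _ => (0, 1))
        (b ∘ Θ.symm) (fun _ => 0) := by
  obtain ⟨B, ψ, hB, hxB, hBΩ, hψ, hval⟩ := h.exists_first_integral hΩ hF hk hb hx₀
  -- The function `ψ` is the new control. The equations `Hψ = 0` and `vψ = 1` say that in the
  -- coordinates `(q, ψ)` the field `H` is horizontal and `v` is the coordinate field.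
  have hΦs : ContDiffOn ℝ ∞ (fun x : Plane × ℝ => (x.1, ψ x)) B := contDiff_fst.contDiffOn.prodMk hψ
  have hΦ : ∀ x ∈ B, ∀ ξ, fderiv ℝ (fun x : Plane × ℝ => (x.1, ψ x)) x ξ
      = (ξ.1, fderiv ℝ ψ x ξ) := fun x hx ξ => by
    rw [(hasFDerivAt_fst.prodMk (hψ.differentiableAt_of_isOpen hB hx).hasFDerivAt).fderiv]
    rfl
  have hinv : ∀ x ∈ B, (fderiv ℝ (fun x : Plane × ℝ => (x.1, ψ x)) x).IsInvertible := by
    intro x hx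
    apply isInvertible_of_injective
    rw [injective_iff_map_eq_zero]
    intro ξ hξ
    rw [hΦ x hx, Prod.mk_eq_zero] at hξ
    have hc := h.snd_v_ne_zero hΩ hF (hBΩ hx)
    have : ξ = (ξ.2 / (v x).2) • v x := by
      ext1
      · simp [hξ.1, h.fst_v x (hBΩ hx)]
      · simp [hc]
    have h2 := hξ.2
    rw [this, map_smul, (hval x hx).2] at h2
    rw [this]
    simp at h2
    rcases h2 with h2 | h2
    · simp [h2]
    · exact absurd h2 hc
  obtain ⟨ρ, hρx, hρB, hρ, hρs⟩ := exists_local_diffeo hB hΦs hxB hinv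
  have htgt : ρ.target ∈ 𝓝 ((ρ x₀).1, (ρ x₀).2) := ρ.open_target.mem_nhds (ρ.map_source hρx)
  obtain ⟨O, V, hO, hxO, hV, hxV, hOV⟩ := mem_nhds_prod_iff'.1 htgt
  have hW : IsOpen (O ×ˢ V) := hO.prod hV
  -- The inverse is the map that is restricted, so that the target is the product `O ×ˢ V`; the
  -- source need not be a product.
  set Θ := (ρ.symm.restrOpen (O ×ˢ V) hW).symm with hΘ
  have hΘt : Θ.target = O ×ˢ V := by
    simp only [hΘ, OpenPartialHomeomorph.symm_target, OpenPartialHomeomorph.restrOpen_source,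
      OpenPartialHomeomorph.symm_source]
    exact inter_eq_right.2 hOV
  have hΘsρ : Θ.source ⊆ ρ.source := by
    intro x hx
    have h1 : Θ x ∈ ρ.target := hOV (hΘt ▸ Θ.map_source hx)
    have h2 : Θ.symm (Θ x) = x := Θ.left_inv hx
    rw [← h2]
    exact ρ.map_target h1
  have hΘx : ∀ x, Θ x = (x.1, ψ x) := fun x => hρ x
  have hx₀Θ : x₀ ∈ Θ.source := by
    have : Θ.symm (ρ x₀) ∈ Θ.source := Θ.map_target (by rw [hΘt]; exact ⟨hxO, hxV⟩)
    have h2 : Θ.symm (ρ x₀) = x₀ := ρ.left_inv hρx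
    rwa [h2] at this
  have hΘfun : (Θ : Plane × ℝ → Plane × ℝ) = fun x => (x.1, ψ x) := funext hΘx
  have hΘs : ContDiffOn ℝ ∞ Θ Θ.source := by
    rw [hΘfun]
    exact hΦs.mono (hΘsρ.trans hρB)
  have hΘsymm : ContDiffOn ℝ ∞ Θ.symm Θ.target := by
    rw [hΘt]
    exact hρs.mono hOV
  have hmaps : MapsTo Θ.symm (O ×ˢ V) Ω := fun y hy =>
    hBΩ (hρB (hΘsρ (Θ.map_target (hΘt ▸ hy))))
  have hmapsB : MapsTo Θ.symm (O ×ˢ V) B := fun y hy =>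
    hρB (hΘsρ (Θ.map_target (hΘt ▸ hy)))
  have hfst : ∀ y ∈ O ×ˢ V, (Θ.symm y).1 = y.1 := fun y hy => by
    have := congrArg Prod.fst (Θ.right_inv (hΘt ▸ hy : y ∈ Θ.target))
    rwa [hΘx] at this
  have hTs : ContDiffOn ℝ ∞ Θ.symm (O ×ˢ V) := hΘt ▸ hΘsymm
  have hTinv : ∀ y ∈ O ×ˢ V, (fderiv ℝ Θ.symm y).IsInvertible := fun y hy =>
    isInvertible_fderiv (ρ := Θ.symm) hΘsymm hΘs (by rw [Θ.symm_source, hΘt]; exact hy)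
  have hpull : ∀ y ∈ O ×ˢ V, ∀ X : Plane × ℝ → Plane × ℝ, VectorField.pullback ℝ Θ.symm X y
      = ((X (Θ.symm y)).1, fderiv ℝ ψ (Θ.symm y) (X (Θ.symm y))) := by
    intro y hy X
    have hy' : y ∈ Θ.target := hΘt ▸ hy
    rw [pullback_eq_iff (hTinv y hy), ← hΦ _ (hmapsB hy), ← hΘfun]
    have := fderiv_symm_comp_fderiv hΘs hΘsymm (Θ.map_target hy') (X (Θ.symm y))
    rwa [Θ.right_inv hy'] at this
  have hframe := h.pullback (G := F ∘ Θ.symm) (L := fun _ => ContinuousLinearMap.id ℝ Plane) hΩ hW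
    hTs hmaps hTinv (fun y hy ξ => by
      rw [fderiv_fst_apply' (hTs.differentiableAt_of_isOpen hW hy),
        show fderiv ℝ (fun y => (Θ.symm y).1) y = fderiv ℝ Prod.fst y from
          Set.EqOn.fderiv_eq_of_isOpen hfst hW hy, fderiv_fst]
      rfl)
    (fun y hy => Function.injective_id) (fun y hy => rfl)
  refine ⟨Θ, O, V, hO, hV, hx₀Θ, (hΘsρ.trans hρB).trans hBΩ, hΘt, hΘs, hΘsymm,
    fun x _ => by rw [hΘx], hframe.congr hW (fun y hy => ?_) (fun y hy => ?_)
      (fun _ _ => rfl) (fun y hy => ?_)⟩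
  · rw [hpull y hy, (hval _ (hmapsB hy)).1, h.fst_H _ (hmaps hy)]
  · rw [hpull y hy, (hval _ (hmapsB hy)).2, h.fst_v _ (hmaps hy)]
  · exact (hk _ (hmaps hy)).symm

/-- A frame with horizontal `H` and `v = ∂/∂u` belongs to a commuting system. -/
theorem IsBracketFrame.commuting (hΩ : IsOpen Ω) (hF : ContDiffOn ℝ ∞ F Ω)
    (h : IsBracketFrame F Ω (fun y => (F y, 0)) (fun _ => (0, 1)) b k) {x : Plane × ℝ}
    (hx : x ∈ Ω) : fderiv ℝ (dU F) x (F x, 0) = fderiv ℝ F x (dU F x, 0) := by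
  have hZs := h.smooth_v.lieBracket_of_isOpen h.smooth_H hΩ
  have e1 : EqOn (fun y => (lieBracket ℝ (fun _ => ((0 : Plane), (1 : ℝ)))
      (fun y => (F y, (0 : ℝ))) y).1) (dU F) Ω := fun y hy => by
    simp only [h.lieBracket_fst_eq hΩ hF hy, one_smul]
  have hc := congrArg Prod.fst (h.curvature x hx)
  rw [lieBracket_fst (h.smooth_H.differentiableAt_of_isOpen hΩ hx)
    (hZs.differentiableAt_of_isOpen hΩ hx), e1.fderiv_eq_of_isOpen hΩ hx,
    fderiv_eq_horizontal_add (hF.differentiableAt_of_isOpen hΩ hx) (lieBracket _ _ _ _)] at hc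
  have e2 : (lieBracket ℝ (fun _ => ((0 : Plane), (1 : ℝ))) (fun y => (F y, (0 : ℝ))) x).2 = 0 := by
    rw [lieBracket_snd (h.smooth_v.differentiableAt_of_isOpen hΩ hx)
      (h.smooth_H.differentiableAt_of_isOpen hΩ hx)]
    simp
  have e3 := e1 hx
  simp only at e3
  rw [e2, e3] at hc
  simpa [sub_eq_zero] using hc

end NaturalControl

/-! ### Systems given by a natural control with commuting fields -/

section NaturalCommuting

variable {G : Plane × ℝ → Plane} {Ω : Set (Plane × ℝ)} {b k : Plane × ℝ → ℝ}

/-- Bracketing a horizontal field with `∂/∂u` differentiates it in `u` and keeps it horizontal. So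
`Z = (G_u, 0)`, the equation for `b` is the hypothesis on `G_uu`, and `[H, Z]` is the commutator at
fixed `u`, which is zero. -/
theorem isBracketFrame_of_natural_commuting (hΩ : IsOpen Ω) (hG : ContDiffOn ℝ ∞ G Ω)
    (hb : ContDiffOn ℝ ∞ b Ω) (hind : ∀ x ∈ Ω, wedge (G x) (dU G x) ≠ 0)
    (hnat : ∀ x ∈ Ω, dU (dU G) x = -G x - b x • dU G x)
    (hcomm : ∀ x ∈ Ω, fderiv ℝ (dU G) x (G x, 0) = fderiv ℝ G x (dU G x, 0)) :
    IsBracketFrame G Ω (fun x => (G x, 0)) (fun _ => (0, 1)) b (fun _ => 0) := by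
  have hHs : ContDiffOn ℝ ∞ (fun x => (G x, (0 : ℝ))) Ω := hG.prodMk contDiffOn_const
  have hvs : ContDiffOn ℝ ∞ (fun _ : Plane × ℝ => ((0 : Plane), (1 : ℝ))) Ω := contDiffOn_const
  have hU := contDiffOn_dU hΩ hG
  have bracket {K : Plane × ℝ → Plane} (hK : ContDiffOn ℝ ∞ K Ω) :
      EqOn (lieBracket ℝ (fun _ : Plane × ℝ => ((0 : Plane), (1 : ℝ))) (fun x => (K x, (0 : ℝ))))
        (fun x => (dU K x, 0)) Ω := by
    intro x hx
    have hKs : ContDiffOn ℝ ∞ (fun x => (K x, (0 : ℝ))) Ω := hK.prodMk contDiffOn_const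
    ext1
    · rw [lieBracket_vertical_fst hΩ hvs hKs (fun _ _ => rfl) hx]
      exact (dU_eq_fderiv (hK.differentiableAt_of_isOpen hΩ hx)).symm
    · rw [lieBracket_snd (hvs.differentiableAt_of_isOpen hΩ hx)
        (hKs.differentiableAt_of_isOpen hΩ hx)]
      simp
  have e1 := bracket hG
  refine ⟨hHs, hvs, hb, contDiffOn_const, fun _ _ => rfl, fun _ _ => rfl, fun x hx => ?_,
    fun x hx => ?_, fun x hx => ?_⟩
  · rw [e1 hx]
    exact hind x hx
  · rw [Set.EqOn.lieBracket_eq_of_isOpen (fun _ _ => rfl) e1 hΩ hx, bracket hU hx, e1 hx]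
    exact hnat x hx
  · have hUs : ContDiffOn ℝ ∞ (fun x => (dU G x, (0 : ℝ))) Ω := hU.prodMk contDiffOn_const
    have hd := hHs.differentiableAt_of_isOpen hΩ hx
    have hd' := hUs.differentiableAt_of_isOpen hΩ hx
    rw [Set.EqOn.lieBracket_eq_of_isOpen (fun _ _ => rfl) e1 hΩ hx]
    ext1
    · rw [lieBracket_fst hd hd']
      simp [hcomm x hx]
    · rw [lieBracket_snd hd hd']
      simp

theorem commuting_iff {O : Set Plane} {V : Set ℝ} (hO : IsOpen O) (hV : IsOpen V)
    (hG : ContDiffOn ℝ ∞ G (O ×ˢ V)) :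
    Commuting G O V ↔
      ∀ x ∈ O ×ˢ V, fderiv ℝ (dU G) x (G x, 0) = fderiv ℝ G x (dU G x, 0) := by
  constructor
  · intro h x hx
    have := lieBracket_slice_eq (hO.prod hV) hG hx
    rw [h x.1 hx.1 x.2 hx.2] at this
    exact (sub_eq_zero.1 this.symm)
  · intro h q hq u hu
    have := lieBracket_slice_eq (hO.prod hV) hG (x := (q, u)) ⟨hq, hu⟩
    rw [h (q, u) ⟨hq, hu⟩, sub_self] at this
    exact this

theorem IsNaturalControl.exists_isBracketFrame {O : Set Plane} {V : Set ℝ} (hO : IsOpen O)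
    (hV : IsOpen V) (hG : ContDiffOn ℝ ∞ G (O ×ˢ V)) (h : IsNaturalControl G O V) :
    ∃ H b k, IsBracketFrame G (O ×ˢ V) H (fun _ => (0, 1)) b k := by
  obtain ⟨p, H, b, k, hfr⟩ := h
  exact ⟨H, b, k, hfr.isBracketFrame hO hV hG⟩

theorem IsBracketFrame.isNaturalControl {O : Set Plane} {V : Set ℝ}
    {H : Plane × ℝ → Plane × ℝ} (hO : IsOpen O) (hV : IsOpen V)
    (hG : ContDiffOn ℝ ∞ G (O ×ˢ V))
    (h : IsBracketFrame G (O ×ˢ V) H (fun _ => (0, 1)) b k) : IsNaturalControl G O V := by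
  obtain ⟨p, hp⟩ := h.exists_isMovingFrame hO hV hG
  exact ⟨p, H, b, k, hp⟩

end NaturalCommuting

/-! ### Systems defined by generated families -/

theorem fderiv_coord {E : Type*} [NormedAddCommGroup E] [NormedSpace ℝ E] {f : E → Plane} {x : E}
    (hf : DifferentiableAt ℝ f x) (ξ : E) (i : Fin 2) :
    (fderiv ℝ f x ξ) i = fderiv ℝ (fun y => f y i) x ξ := by
  have := ((EuclideanSpace.proj (𝕜 := ℝ) i).hasFDerivAt.comp x hf.hasFDerivAt).fderiv
  change fderiv ℝ (fun y => f y i) x = _ at this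
  rw [this]
  rfl

theorem contDiffOn_coord {E : Type*} [NormedAddCommGroup E] [NormedSpace ℝ E] {f : E → Plane}
    {Ω : Set E} (hf : ContDiffOn ℝ ∞ f Ω) (i : Fin 2) : ContDiffOn ℝ ∞ (fun y => f y i) Ω :=
  (EuclideanSpace.proj (𝕜 := ℝ) i).contDiff.comp_contDiffOn hf

section Generated

variable {a₁ : ℝ → ℝ} {a₂ : ℝ × ℝ → ℝ} {P : ℝ → Plane → Plane} {O : Set Plane} {V : Set ℝ}

theorem IsGeneratedFamily.fderiv_control (h : IsGeneratedFamily a₁ a₂ P O V) :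
    EqOn (fun x => fderiv ℝ (fun x : Plane × ℝ => P x.2 x.1) x (0, 1))
      (fun x => fieldX a₁ a₂ x.2 (P x.2 x.1)) (O ×ˢ V) := by
  intro x hx
  have hd := h.smooth_P.differentiableAt_of_isOpen (h.isOpen_O.prod h.isOpen_V) hx
  exact (hasDerivAt_control hd).unique (h.generated x.1 hx.1 x.2 hx.2)

theorem IsGeneratedFamily.fderiv_slice (h : IsGeneratedFamily a₁ a₂ P O V) {x : Plane × ℝ}
    (hx : x ∈ O ×ˢ V) (ξ : Plane) : fderiv ℝ (P x.2) x.1 ξ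
      = fderiv ℝ (fun x : Plane × ℝ => P x.2 x.1) x (ξ, 0) :=
  fderiv_partial_fst (f := fun x : Plane × ℝ => P x.2 x.1)
    (h.smooth_P.differentiableAt_of_isOpen (h.isOpen_O.prod h.isOpen_V) hx) ξ

/-- The derivative of the generating field in the state direction. -/
theorem IsGeneratedFamily.exists_fderiv_fieldX (h : IsGeneratedFamily a₁ a₂ P O V) :
    ∃ β : Plane × ℝ → ℝ, ContDiffOn ℝ ∞ β (O ×ˢ V) ∧ ∀ x ∈ O ×ˢ V, ∀ ξ : Plane,
      fderiv ℝ (fun x : Plane × ℝ => fieldX a₁ a₂ x.2 (P x.2 x.1)) x (ξ, 0)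
        = !₂[fderiv ℝ (P x.2) x.1 ξ 1,
            β x * fderiv ℝ (P x.2) x.1 ξ 1 - fderiv ℝ (P x.2) x.1 ξ 0] := by
  have hΩ := h.isOpen_O.prod h.isOpen_V
  obtain ⟨D, hD, ha₂, hmem⟩ := h.smooth_a₂
  have hP := h.smooth_P
  have hpair : ContDiffOn ℝ ∞ (fun x : Plane × ℝ => (x.2, P x.2 x.1 1)) (O ×ˢ V) :=
    contDiff_snd.contDiffOn.prodMk (contDiffOn_coord hP 1)
  have hmaps : MapsTo (fun x : Plane × ℝ => (x.2, P x.2 x.1 1)) (O ×ˢ V) D :=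
    fun x hx => hmem x.1 hx.1 x.2 hx.2
  refine ⟨fun x => fderiv ℝ a₂ (x.2, P x.2 x.1 1) (0, 1),
    ((ha₂.fderiv_infty hD).comp hpair hmaps).clm_apply contDiffOn_const, fun x hx ξ => ?_⟩
  have hPd := hP.differentiableAt_of_isOpen hΩ hx
  have hP0 := (contDiffOn_coord hP 0).differentiableAt_of_isOpen hΩ hx
  have hP1 := (contDiffOn_coord hP 1).differentiableAt_of_isOpen hΩ hx
  -- The field along the family is the derivative of `P` in the control, hence differentiable.
  have hXd : DifferentiableAt ℝ (fun x : Plane × ℝ => fieldX a₁ a₂ x.2 (P x.2 x.1)) x :=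
    ((hP.fderiv_along contDiffOn_const hΩ).congr
      h.fderiv_control.symm).differentiableAt_of_isOpen hΩ hx
  have ha1 : HasFDerivAt (fun y : Plane × ℝ => a₁ y.2)
      ((fderiv ℝ a₁ x.2).comp (ContinuousLinearMap.snd ℝ Plane ℝ)) x :=
    HasFDerivAt.comp x (h.smooth_a₁.differentiableAt_of_isOpen h.isOpen_V hx.2).hasFDerivAt
      hasFDerivAt_snd
  have ha2 : HasFDerivAt (fun y : Plane × ℝ => a₂ (y.2, P y.2 y.1 1))
      ((fderiv ℝ a₂ (x.2, P x.2 x.1 1)).comp ((ContinuousLinearMap.snd ℝ Plane ℝ).prod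
        (fderiv ℝ (fun y : Plane × ℝ => P y.2 y.1 1) x))) x :=
    HasFDerivAt.comp x (f := fun x : Plane × ℝ => (x.2, P x.2 x.1 1)) (g := a₂)
      (ha₂.differentiableAt_of_isOpen hD (hmaps hx)).hasFDerivAt
      (hasFDerivAt_snd.prodMk hP1.hasFDerivAt)
  have e0 : (fun y : Plane × ℝ => fieldX a₁ a₂ y.2 (P y.2 y.1) 0)
      = fun y => a₁ y.2 + P y.2 y.1 1 := by
    ext y
    simp [fieldX]
  have e1 : (fun y : Plane × ℝ => fieldX a₁ a₂ y.2 (P y.2 y.1) 1)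
      = fun y => a₂ (y.2, P y.2 y.1 1) - P y.2 y.1 0 := by
    ext y
    simp [fieldX]
  ext i
  rw [fderiv_coord hXd]
  fin_cases i
  · simp only [Fin.zero_eta, Fin.isValue]
    rw [e0, (ha1.fun_add hP1.hasFDerivAt).fderiv, h.fderiv_slice hx]
    simp [fderiv_coord hPd]
  · simp only [Fin.mk_one, Fin.isValue]
    rw [e1, (ha2.fun_sub hP0.hasFDerivAt).fderiv, h.fderiv_slice hx]
    have hlin (r : ℝ) : fderiv ℝ a₂ (x.2, P x.2 x.1 1) (0, r)
        = fderiv ℝ a₂ (x.2, P x.2 x.1 1) (0, 1) * r := by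
      rw [show ((0 : ℝ), r) = r • ((0 : ℝ), (1 : ℝ)) by simp, map_smul, smul_eq_mul, mul_comm]
    simp only [sub_apply, ContinuousLinearMap.comp_apply, ContinuousLinearMap.prod_apply,
      ContinuousLinearMap.coe_snd']
    rw [hlin]
    simp [fderiv_coord hPd]

/-- The system straightened by a generated family is smooth, and its fields commute in a natural
control. -/
theorem IsGeneratedFamily.straightens (h : IsGeneratedFamily a₁ a₂ P O V) {G : Plane × ℝ → Plane}
    (hG1 : ∀ q ∈ O, ∀ w ∈ V, fderiv ℝ (P w) q (G (q, w)) = e₁) :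
    ContDiffOn ℝ ∞ G (O ×ˢ V) ∧ Straightens P G O V ∧ IsNaturalControl G O V ∧
      Commuting G O V := by
  have hΩ := h.isOpen_O.prod h.isOpen_V
  set Φ : Plane × ℝ → Plane := fun x => P x.2 x.1 with hΦ
  have hΦs : ContDiffOn ℝ ∞ Φ (O ×ˢ V) := h.smooth_P
  have hA : ∀ x ∈ O ×ˢ V, ∀ ξ, fderiv ℝ (P x.2) x.1 ξ = fderiv ℝ Φ x (ξ, 0) :=
    fun x hx ξ => h.fderiv_slice hx ξ
  have hinj : ∀ x ∈ O ×ˢ V, ∀ ξ η : Plane, fderiv ℝ Φ x (ξ, 0) = fderiv ℝ Φ x (η, 0) → ξ = η :=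
    fun x hx ξ η he => (h.bijective x.1 hx.1 x.2 hx.2).1 (by rw [hA x hx, hA x hx, he])
  have hGe : ∀ x ∈ O ×ˢ V, fderiv ℝ Φ x (G x, 0) = e₁ := fun x hx => by
    rw [← hA x hx]
    exact hG1 x.1 hx.1 x.2 hx.2
  -- The field is `(DP_w)⁻¹ e₁`, and inversion of linear maps is smooth.
  have hGs : ContDiffOn ℝ ∞ G (O ×ˢ V) := by
    have hAs : ContDiffOn ℝ ∞ (fun x => (fderiv ℝ Φ x).comp (ContinuousLinearMap.inl ℝ Plane ℝ))
        (O ×ˢ V) := (hΦs.fderiv_infty hΩ).clm_comp contDiffOn_const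
    have hAinv : ∀ x ∈ O ×ˢ V,
        ((fderiv ℝ Φ x).comp (ContinuousLinearMap.inl ℝ Plane ℝ)).IsInvertible := fun x hx =>
      isInvertible_of_injective fun ξ η he => hinj x hx ξ η (by simpa using he)
    have : ContDiffOn ℝ ∞ (fun x =>
        ((fderiv ℝ Φ x).comp (ContinuousLinearMap.inl ℝ Plane ℝ)).inverse e₁) (O ×ˢ V) := by
      refine ContDiffOn.clm_apply (fun x hx => ?_) contDiffOn_const
      exact (hAinv x hx).contDiffAt_map_inverse.comp_contDiffWithinAt x (hAs x hx)
    refine this.congr fun x hx => ?_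
    symm
    rw [(hAinv x hx).inverse_apply_eq]
    simp [hGe x hx]
  obtain ⟨β, hβs, hβ⟩ := h.exists_fderiv_fieldX
  -- The equation of variations: the control derivative of `DP_w` is the Jacobian of `X_w`, with
  -- rows `(0, 1)` and `(-1, β)`, applied to `DP_w`.
  have hmixed : ∀ x ∈ O ×ˢ V, ∀ ξ : Plane, fderiv ℝ (fderiv ℝ Φ) x (0, 1) (ξ, 0)
      = !₂[fderiv ℝ Φ x (ξ, 0) 1, β x * fderiv ℝ Φ x (ξ, 0) 1 - fderiv ℝ Φ x (ξ, 0) 0] := by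
    intro x hx ξ
    have e := fderiv_fderiv_along hΦs (contDiffOn_const (c := ((0 : Plane), (1 : ℝ)))) hΩ hx (ξ, 0)
    rw [h.fderiv_control.fderiv_eq_of_isOpen hΩ hx, hβ x hx, hA x hx] at e
    rw [hΦs.fderiv_fderiv_symm hΩ hx, e]
    simp
  have hdiff {K : Plane × ℝ → Plane} {c : Plane} (hK : ContDiffOn ℝ ∞ K (O ×ˢ V))
      (hc : ∀ x ∈ O ×ˢ V, fderiv ℝ Φ x (K x, 0) = c) {x : Plane × ℝ} (hx : x ∈ O ×ˢ V)
      (ξ : Plane × ℝ) : fderiv ℝ Φ x (fderiv ℝ K x ξ, 0)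
        = - fderiv ℝ (fderiv ℝ Φ) x ξ (K x, 0) := by
    have hKd := hK.differentiableAt_of_isOpen hΩ hx
    have e := fderiv_fderiv_along hΦs (hK.prodMk (contDiffOn_const (c := (0 : ℝ)))) hΩ hx ξ
    rw [fderiv_eq_zero_of_eqOn_const hc hΩ hx, zero_apply,
      (hKd.hasFDerivAt.prodMk (hasFDerivAt_const (0 : ℝ) x)).fderiv] at e
    exact eq_neg_of_add_eq_zero_left e.symm
  have hU := contDiffOn_dU hΩ hGs
  -- Differentiating `DP_w G = e₁` in `w` gives minus the Jacobian of `X_w` on `e₁`, which is `e₂`.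
  -- The same step on `e₂` gives `-e₁ - β e₂`, so `β` is the invariant `b`.
  have hUe : ∀ x ∈ O ×ˢ V, fderiv ℝ Φ x (dU G x, 0) = e₂ := fun x hx => by
    rw [dU_eq_fderiv (hGs.differentiableAt_of_isOpen hΩ hx), hdiff hGs hGe hx, hmixed x hx,
      hGe x hx]
    ext i
    fin_cases i <;> simp [e₁, e₂]
  have hUU : ∀ x ∈ O ×ˢ V, dU (dU G) x = -G x - β x • dU G x := fun x hx => by
    apply hinj x hx
    have : ((-G x - β x • dU G x, 0) : Plane × ℝ) = -(G x, 0) - β x • (dU G x, 0) := by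
      ext1 <;> simp
    rw [this, map_sub, map_neg, map_smul, hGe x hx, hUe x hx,
      dU_eq_fderiv (hU.differentiableAt_of_isOpen hΩ hx), hdiff hU hUe hx, hmixed x hx, hUe x hx]
    ext i
    fin_cases i <;> simp [e₁, e₂]
  -- For fixed `w` both fields are mapped to constants, so each side is minus the second derivative
  -- of `Φ` on the same pair of vectors, in opposite orders.
  have hcomm : ∀ x ∈ O ×ˢ V, fderiv ℝ (dU G) x (G x, 0) = fderiv ℝ G x (dU G x, 0) :=
    fun x hx => by
      apply hinj x hx
      rw [hdiff hU hUe hx, hdiff hGs hGe hx, hΦs.fderiv_fderiv_symm hΩ hx]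
  have hind : ∀ x ∈ O ×ˢ V, wedge (G x) (dU G x) ≠ 0 := fun x hx => by
    rw [wedge_ne_zero_iff]
    intro s t hst
    have : s • e₁ + t • e₂ = 0 := by
      rw [← hGe x hx, ← hUe x hx, ← map_smul, ← map_smul, ← map_add]
      simp [hst, Prod.mk_zero_zero]
    exact ⟨by simpa [e₁, e₂] using congrArg (fun z : Plane => z 0) this,
      by simpa [e₁, e₂] using congrArg (fun z : Plane => z 1) this⟩
  refine ⟨hGs, fun q hq u hu => ⟨hG1 q hq u hu, ?_⟩, ?_, ?_⟩
  · rw [hA (q, u) ⟨hq, hu⟩]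
    exact hUe (q, u) ⟨hq, hu⟩
  · exact (isBracketFrame_of_natural_commuting hΩ hGs hβs hind hUU hcomm).isNaturalControl
      h.isOpen_O h.isOpen_V hGs
  · exact (commuting_iff h.isOpen_O h.isOpen_V hGs).2 hcomm

end Generated

/-! ### Integrals depending smoothly on parameters -/

/-- The integral is the convolution at `0` of the indicator of `(0, 1]` with `y ↦ χ y • f (x, -y)`.
The bump `χ` is `1` on `[-1, 0]` and supported in `[-3/2, 1/2]`, so the compact support required for
smooth dependence on parameters costs nothing on the range of integration. -/
theorem ContDiffOn.integral_param {E G : Type*} [NormedAddCommGroup E] [NormedSpace ℝ E]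
    [NormedAddCommGroup G] [NormedSpace ℝ G] {s : Set E} (hs : IsOpen s)
    {f : E × ℝ → G} (hf : ContDiffOn ℝ ∞ f (s ×ˢ Ioo (-1) 2)) :
    ContDiffOn ℝ ∞ (fun x => ∫ t in (0 : ℝ)..1, f (x, t)) s := by
  let χ : ContDiffBump (-1 / 2 : ℝ) := ⟨1 / 2, 1, by norm_num, by norm_num⟩
  let g : E → ℝ → G := fun x y => χ y • f (x, -y)
  have hts : tsupport χ = Icc (-3 / 2) (1 / 2) := by
    rw [χ.tsupport_eq, Real.closedBall_eq_Icc]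
    norm_num [χ]
  have hg : ContDiffOn ℝ ∞ (Function.uncurry g) (s ×ˢ univ) := by
    rintro ⟨x, y⟩ ⟨hx, -⟩
    apply ContDiffAt.contDiffWithinAt
    by_cases hy : y ∈ Ioo (-2 : ℝ) 1
    · refine (χ.contDiff.contDiffAt.comp (x, y) contDiffAt_snd).smul ?_
      have hmem : (x, -y) ∈ s ×ˢ Ioo (-1 : ℝ) 2 := ⟨hx, by constructor <;> linarith [hy.1, hy.2]⟩
      exact ContDiffAt.comp (x, y) (f := fun z : E × ℝ => (z.1, -z.2)) (g := f)
        (hf.contDiffAt ((hs.prod isOpen_Ioo).mem_nhds hmem))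
        (contDiffAt_fst.prodMk contDiffAt_snd.neg)
    · have hy' : y ∉ tsupport χ := by
        rw [hts]
        exact fun h => hy ⟨by linarith [h.1], by linarith [h.2]⟩
      have h0 : ∀ᶠ z : E × ℝ in 𝓝 (x, y), χ z.2 = 0 := by
        have h1 : ∀ᶠ z in 𝓝 y, χ z = 0 := notMem_tsupport_iff_eventuallyEq.1 hy'
        exact (continuous_snd.tendsto (x, y)).eventually h1
      refine (contDiffAt_const (c := (0 : G))).congr_of_eventuallyEq ?_
      filter_upwards [h0] with z hz
      simp [Function.uncurry, g, hz]
  have hloc : MeasureTheory.LocallyIntegrable ((Ioc (0 : ℝ) 1).indicator fun _ => (1 : ℝ)) :=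
    (MeasureTheory.locallyIntegrable_const (1 : ℝ)).indicator measurableSet_Ioc
  have key := MeasureTheory.contDiffOn_convolution_right_with_param_comp (n := ⊤) (𝕜 := ℝ)
    (ContinuousLinearMap.lsmul ℝ ℝ) (contDiffOn_const (c := (0 : ℝ)) (s := s)) hs
    (isCompact_Icc (a := (-3 / 2 : ℝ)) (b := 1 / 2)) (g := g) (fun x y _ hy => by
      rw [← hts] at hy
      simp [g, image_eq_zero_of_notMem_tsupport hy]) hloc hg
  refine key.congr fun x _ => ?_
  rw [MeasureTheory.convolution_def, intervalIntegral.integral_of_le zero_le_one,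
    ← MeasureTheory.integral_indicator measurableSet_Ioc]
  congr 1
  ext t
  by_cases ht : t ∈ Ioc (0 : ℝ) 1
  · have h1 : χ (-t) = 1 := by
      apply χ.one_of_mem_closedBall
      rw [Real.closedBall_eq_Icc]
      constructor <;> norm_num [χ] <;> linarith [ht.1, ht.2]
    simp [ht, g, h1]
  · simp [ht]

/-- A smooth family of closed one-forms on a ball has a smooth family of primitives. -/
theorem exists_smooth_primitive {A : Plane × ℝ → Plane →L[ℝ] Plane} {q₀ : Plane} {r : ℝ}
    {V : Set ℝ} (hr : 0 < r) (hV : IsOpen V)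
    (hA : ContDiffOn ℝ ∞ A (Metric.ball q₀ (2 * r) ×ˢ V))
    (hsymm : ∀ x ∈ Metric.ball q₀ (2 * r) ×ˢ V, ∀ ξ η,
      fderiv ℝ A x (ξ, 0) η = fderiv ℝ A x (η, 0) ξ) :
    ∃ P : ℝ → Plane → Plane,
      ContDiffOn ℝ ∞ (fun x : Plane × ℝ => P x.2 x.1) (Metric.ball q₀ r ×ˢ V) ∧
      (∀ q ∈ Metric.ball q₀ r, ∀ w ∈ V, HasFDerivAt (P w) (A (q, w)) q) ∧
      ∀ w, P w q₀ = q₀ := by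
  have hball : Metric.ball q₀ r ⊆ Metric.ball q₀ (2 * r) := Metric.ball_subset_ball (by linarith)
  have hB : IsOpen (Metric.ball q₀ (2 * r) ×ˢ V) := Metric.isOpen_ball.prod hV
  -- The primitive of the Poincaré lemma, integrated along segments from `q₀`.
  refine ⟨fun w q => q₀ + ∫ t in (0 : ℝ)..1, A (q₀ + t • (q - q₀), w) (q - q₀), ?_, ?_, ?_⟩
  · refine contDiffOn_const.add (ContDiffOn.integral_param
      (f := fun z : (Plane × ℝ) × ℝ => A (q₀ + z.2 • (z.1.1 - q₀), z.1.2) (z.1.1 - q₀))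
      (Metric.isOpen_ball.prod hV) ?_)
    refine ContDiffOn.clm_apply (hA.comp (t := Metric.ball q₀ (2 * r) ×ˢ V)
      (f := fun z : (Plane × ℝ) × ℝ => (q₀ + z.2 • (z.1.1 - q₀), z.1.2)) ?_ ?_) ?_
    · exact ContDiff.contDiffOn (by fun_prop)
    · rintro ⟨⟨q, w⟩, t⟩ ⟨⟨hq, hw⟩, ht⟩
      refine ⟨?_, hw⟩
      simp only [Metric.mem_ball, dist_eq_norm, add_sub_cancel_left] at hq ⊢
      rw [norm_smul]
      -- Smoothness of the integral needs the integrand for `t` in `(-1, 2)`; this is why `A` is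
      -- given on a ball of twice the radius.
      have h2 : ‖t‖ ≤ 2 := by
        rw [Real.norm_eq_abs, abs_le]
        constructor <;> linarith [ht.1, ht.2]
      calc ‖t‖ * ‖q - q₀‖ ≤ 2 * ‖q - q₀‖ := by gcongr
        _ < 2 * r := by linarith
    · exact ContDiff.contDiffOn (by fun_prop)
  · intro q hq w hw
    apply HasFDerivAt.const_add
    have hs : ∀ y ∈ Metric.ball q₀ r, (y, w) ∈ Metric.ball q₀ (2 * r) ×ˢ V :=
      fun y hy => ⟨hball hy, hw⟩
    have hAd {y} (hy : y ∈ Metric.ball q₀ r) := hA.differentiableAt_of_isOpen hB (hs y hy)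
    have hslice {y} (hy : y ∈ Metric.ball q₀ r) :
        DifferentiableAt ℝ (fun y => A (y, w)) y :=
      DifferentiableAt.comp y (g := A) (f := fun y => (y, w)) (hAd hy) (by fun_prop)
    have := (convex_ball q₀ r).hasFDerivWithinAt_curveIntegral_segment_of_hasFDerivWithinAt_symmetric
      (show ∀ y ∈ Metric.ball q₀ r, HasFDerivWithinAt (fun y => A (y, w))
        (fderiv ℝ (fun y => A (y, w)) y) (Metric.ball q₀ r) y from
        fun y hy => (hslice hy).hasFDerivAt.hasFDerivWithinAt)
      (fun y hy ξ _ η _ => by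
        rw [fderiv_partial_fst (hAd hy), fderiv_partial_fst (hAd hy)]
        exact hsymm _ (hs y hy) ξ η)
      (Metric.mem_ball_self hr) hq
    have := this.hasFDerivAt (Metric.isOpen_ball.mem_nhds hq)
    refine this.congr_of_eventuallyEq (Eventually.of_forall fun y => ?_)
    simp only [curveIntegral_segment]
    congr 1
    ext1 t
    simp [AffineMap.lineMap_apply, add_comm]
  · intro w
    simp

/-! ### Straightening commuting systems in a natural control -/

section Straighten

variable {G : Plane × ℝ → Plane} {Ω : Set (Plane × ℝ)} {b : Plane × ℝ → ℝ}

theorem exists_coframe (hΩ : IsOpen Ω) (hG : ContDiffOn ℝ ∞ G Ω)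
    (hind : ∀ x ∈ Ω, wedge (G x) (dU G x) ≠ 0) :
    ∃ A : Plane × ℝ → Plane →L[ℝ] Plane, ContDiffOn ℝ ∞ A Ω ∧
      ∀ x ∈ Ω, A x (G x) = e₁ ∧ A x (dU G x) = e₂ := by
  have hU := contDiffOn_dU hΩ hG
  have hw := (hG.wedge hU).inv hind
  refine ⟨fun x => (wedge (G x) (dU G x))⁻¹ • ((wedgeL.flip (dU G x)).smulRight e₁
    + (wedgeL (G x)).smulRight e₂), ?_, fun x hx => ?_⟩
  · exact hw.smul (((wedgeL.flip.contDiff.comp_contDiffOn hU).smulRight contDiffOn_const).add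
      ((wedgeL.contDiff.comp_contDiffOn hG).smulRight contDiffOn_const))
  · have := hind x hx
    constructor <;> simp [smul_smul, this]

/-- The coframe of commuting fields is closed. -/
theorem fderiv_coframe_symm {A : Plane × ℝ → Plane →L[ℝ] Plane} (hΩ : IsOpen Ω)
    (hG : ContDiffOn ℝ ∞ G Ω) (hind : ∀ x ∈ Ω, wedge (G x) (dU G x) ≠ 0)
    (hcomm : ∀ x ∈ Ω, fderiv ℝ (dU G) x (G x, 0) = fderiv ℝ G x (dU G x, 0))
    (hA : ContDiffOn ℝ ∞ A Ω) (hAe : ∀ x ∈ Ω, A x (G x) = e₁ ∧ A x (dU G x) = e₂)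
    {x : Plane × ℝ} (hx : x ∈ Ω) (ξ η : Plane) :
    fderiv ℝ A x (ξ, 0) η = fderiv ℝ A x (η, 0) ξ := by
  have hAd := hA.differentiableAt_of_isOpen hΩ hx
  have d1 := fderiv_clm_apply_apply hAd (hG.differentiableAt_of_isOpen hΩ hx) (dU G x, 0)
  have d2 := fderiv_clm_apply_apply hAd
    ((contDiffOn_dU hΩ hG).differentiableAt_of_isOpen hΩ hx) (G x, 0)
  rw [fderiv_eq_zero_of_eqOn_const (fun y hy => (hAe y hy).1) hΩ hx, zero_apply] at d1
  rw [fderiv_eq_zero_of_eqOn_const (fun y hy => (hAe y hy).2) hΩ hx, zero_apply, hcomm x hx] at d2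
  -- Differentiating `A G = e₁` along `G_u` and `A G_u = e₂` along `G`, commutation makes the two
  -- results equal: this is closedness on the basis `G`, `G_u`.
  have e : fderiv ℝ A x (G x, 0) (dU G x) = fderiv ℝ A x (dU G x, 0) (G x) := by
    rw [eq_neg_of_add_eq_zero_right d1.symm, eq_neg_of_add_eq_zero_right d2.symm]
  have hpair (r s : ℝ) (y z : Plane) :
      ((r • y + s • z, 0) : Plane × ℝ) = r • (y, 0) + s • (z, 0) := by
    ext1 <;> simp
  rw [eq_smul_add_smul (hind x hx) ξ, eq_smul_add_smul (hind x hx) η]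
  simp only [hpair, map_add, map_smul, add_apply, smul_apply, e]
  module

/-- The derivative of the coframe in a natural control. -/
theorem fderiv_coframe_control {A : Plane × ℝ → Plane →L[ℝ] Plane} (hΩ : IsOpen Ω)
    (hG : ContDiffOn ℝ ∞ G Ω) (hind : ∀ x ∈ Ω, wedge (G x) (dU G x) ≠ 0)
    (hnat : ∀ x ∈ Ω, dU (dU G) x = -G x - b x • dU G x)
    (hA : ContDiffOn ℝ ∞ A Ω) (hAe : ∀ x ∈ Ω, A x (G x) = e₁ ∧ A x (dU G x) = e₂)
    {x : Plane × ℝ} (hx : x ∈ Ω) (ξ : Plane) :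
    fderiv ℝ A x (0, 1) ξ = !₂[A x ξ 1, b x * A x ξ 1 - A x ξ 0] := by
  have hAd := hA.differentiableAt_of_isOpen hΩ hx
  have hGd := hG.differentiableAt_of_isOpen hΩ hx
  have hUd := (contDiffOn_dU hΩ hG).differentiableAt_of_isOpen hΩ hx
  have d1 := fderiv_clm_apply_apply hAd hGd (0, 1)
  have d2 := fderiv_clm_apply_apply hAd hUd (0, 1)
  rw [fderiv_eq_zero_of_eqOn_const (fun y hy => (hAe y hy).1) hΩ hx, zero_apply,
    ← dU_eq_fderiv hGd, (hAe x hx).2] at d1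
  rw [fderiv_eq_zero_of_eqOn_const (fun y hy => (hAe y hy).2) hΩ hx, zero_apply,
    ← dU_eq_fderiv hUd, hnat x hx, map_sub, map_neg, map_smul, (hAe x hx).1, (hAe x hx).2] at d2
  have d1' := eq_neg_of_add_eq_zero_right d1.symm
  have d2' := eq_neg_of_add_eq_zero_right d2.symm
  rw [eq_smul_add_smul (hind x hx) ξ]
  simp only [map_add, map_smul, d1', d2', (hAe x hx).1, (hAe x hx).2]
  ext i
  fin_cases i
  · simp [e₁, e₂]
  · simp [e₁, e₂]
    ring

end Straighten

theorem plane_eq_smul_add_smul (q : Plane) : q = q 0 • e₁ + q 1 • e₂ := by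
  ext i
  fin_cases i <;> simp [e₁, e₂]

theorem wedge_e₁_e₂ : wedge e₁ e₂ ≠ 0 := by
  simp [wedge, e₁, e₂]

/-- A function on an open set of the plane times the line whose derivative along `∂/∂q₁`
vanishes after straightening is a function of the remaining variables. -/
theorem exists_reduced_function {Φ : Plane × ℝ → Plane} {R : Plane × ℝ → ℝ}
    {G : Plane × ℝ → Plane} {Ω : Set (Plane × ℝ)} (hΩ : IsOpen Ω) (hΦ : ContDiffOn ℝ ∞ Φ Ω)
    (hR : ContDiffOn ℝ ∞ R Ω)
    (hinj : ∀ x ∈ Ω, ∀ ξ : Plane, fderiv ℝ Φ x (ξ, 0) = 0 → ξ = 0)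
    (hG : ∀ x ∈ Ω, fderiv ℝ Φ x (G x, 0) = e₁) (hRG : ∀ x ∈ Ω, fderiv ℝ R x (G x, 0) = 0)
    {x₀ : Plane × ℝ} (hx₀ : x₀ ∈ Ω) :
    ∃ (S : Set (Plane × ℝ)) (D : Set (ℝ × ℝ)) (a : ℝ × ℝ → ℝ), IsOpen S ∧ x₀ ∈ S ∧ S ⊆ Ω ∧
      InjOn (fun x => (Φ x, x.2)) S ∧ IsOpen D ∧ ContDiffOn ℝ ∞ a D ∧
      ∀ x ∈ S, (x.2, Φ x 1) ∈ D ∧ R x = a (x.2, Φ x 1) := by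
  have hΞs : ContDiffOn ℝ ∞ (fun x => (Φ x, x.2)) Ω := hΦ.prodMk contDiff_snd.contDiffOn
  have hΞ : ∀ x ∈ Ω, ∀ ξ, fderiv ℝ (fun x => (Φ x, x.2)) x ξ = (fderiv ℝ Φ x ξ, ξ.2) :=
    fun x hx ξ => by
      rw [((hΦ.differentiableAt_of_isOpen hΩ hx).hasFDerivAt.prodMk hasFDerivAt_snd).fderiv]
      rfl
  obtain ⟨ρ, hρx, hρΩ, hρ, hρs⟩ := exists_local_diffeo hΩ hΞs hx₀ (fun x hx => by
    apply isInvertible_of_injective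
    rw [injective_iff_map_eq_zero]
    intro ξ hξ
    rw [hΞ x hx, Prod.mk_eq_zero] at hξ
    have h1 : ξ = (ξ.1, 0) := Prod.ext rfl hξ.2
    have h2 := hinj x hx ξ.1 (h1 ▸ hξ.1)
    rw [h1, h2, Prod.mk_zero_zero])
  have hρfun : (ρ : Plane × ℝ → Plane × ℝ) = fun x => (Φ x, x.2) := funext hρ
  have hρsm : ContDiffOn ℝ ∞ ρ ρ.source := by
    rw [hρfun]
    exact hΞs.mono hρΩ
  -- Coordinates `(Φ₀, Φ₁, u)` in a product of lines: balls of the maximum norm are boxes, so the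
  -- first coordinate can be moved while the others stay fixed.
  let σ : ℝ × ℝ × ℝ → Plane × ℝ := fun z => (z.1 • e₁ + z.2.1 • e₂, z.2.2)
  have hσs : ContDiff ℝ ∞ σ := by
    simp only [σ]
    fun_prop
  let c : Plane × ℝ → ℝ × ℝ × ℝ := fun x => (Φ x 0, Φ x 1, x.2)
  have hσc : ∀ x, σ (c x) = ρ x := fun x => by
    rw [hρ]
    exact Prod.ext (plane_eq_smul_add_smul (Φ x)).symm rfl
  have hopen : IsOpen (σ ⁻¹' ρ.target) := ρ.open_target.preimage hσs.continuous
  obtain ⟨ε, hε, hball⟩ := Metric.isOpen_iff.1 hopen (c x₀) (by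
    change σ (c x₀) ∈ ρ.target
    rw [hσc]
    exact ρ.map_source hρx)
  let f : ℝ × ℝ × ℝ → ℝ := fun z => R (ρ.symm (σ z))
  have hmap : ∀ z ∈ Metric.ball (c x₀) ε, ρ.symm (σ z) ∈ Ω := fun z hz =>
    hρΩ (ρ.map_target (hball hz))
  have hfs : ContDiffOn ℝ ∞ f (Metric.ball (c x₀) ε) :=
    hR.comp (hρs.comp hσs.contDiffOn hball) hmap
  have hf1 : ∀ z ∈ Metric.ball (c x₀) ε, fderiv ℝ f z (1, 0) = 0 := by
    intro z hz
    have hy : ρ.symm (σ z) ∈ ρ.source := ρ.map_target (hball hz)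
    set y := ρ.symm (σ z) with hydef
    have hρy : ρ y = σ z := ρ.right_inv (hball hz)
    have d1 := (hR.differentiableAt_of_isOpen hΩ (hρΩ hy)).hasFDerivAt
    have d2 := (hρs.differentiableAt_of_isOpen ρ.open_target (hball hz)).hasFDerivAt
    have d3 := (hσs.differentiable (by simp) z).hasFDerivAt
    have d4 := HasFDerivAt.comp z (g := R) d1 (HasFDerivAt.comp z (g := ρ.symm) d2 d3)
    -- The straightening map carries `(G, 0)` to the first coordinate field, so `R` has zero
    -- derivative in the first coordinate.
    have e1 : fderiv ℝ σ z (1, 0) = fderiv ℝ ρ y (G y, 0) := by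
      rw [hρfun, hΞ y (hρΩ hy), hG y (hρΩ hy)]
      have h1 : HasFDerivAt σ (((ContinuousLinearMap.fst ℝ ℝ (ℝ × ℝ)).smulRight e₁
          + ((ContinuousLinearMap.fst ℝ ℝ ℝ).comp
            (ContinuousLinearMap.snd ℝ ℝ (ℝ × ℝ))).smulRight e₂).prod
          ((ContinuousLinearMap.snd ℝ ℝ ℝ).comp (ContinuousLinearMap.snd ℝ ℝ (ℝ × ℝ)))) z := by
        refine (ContinuousLinearMap.hasFDerivAt _).congr_of_eventuallyEq (.of_forall fun y => ?_)
        simp [σ]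
      rw [h1.fderiv]
      simp
    have e2 : fderiv ℝ ρ.symm (σ z) (fderiv ℝ σ z (1, 0)) = (G y, 0) := by
      rw [e1, ← hρy]
      exact fderiv_symm_comp_fderiv hρsm hρs hy _
    have e3 : fderiv ℝ f z = _ := d4.fderiv
    rw [e3, ContinuousLinearMap.comp_apply, ContinuousLinearMap.comp_apply, e2]
    exact hRG y (hρΩ hy)
  have hconst : ∀ z ∈ Metric.ball (c x₀) ε, f z = f ((c x₀).1, z.2) := by
    rintro ⟨s, z⟩ hz
    rw [← ball_prod_same] at hz
    have hmem : ∀ t ∈ Metric.ball (c x₀).1 ε, (t, z) ∈ Metric.ball (c x₀) ε := fun t ht => by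
      rw [← ball_prod_same]
      exact ⟨ht, hz.2⟩
    have hd : ∀ t ∈ Metric.ball (c x₀).1 ε, HasDerivAt (fun t => f (t, z)) 0 t := fun t ht => by
      have h1 : HasDerivAt (fun t : ℝ => (t, z)) ((1 : ℝ), (0 : ℝ × ℝ)) t :=
        (hasDerivAt_id t).prodMk (hasDerivAt_const t z)
      have h2 := HasFDerivAt.comp_hasDerivAt t (f := fun t : ℝ => (t, z))
        (hfs.differentiableAt_of_isOpen Metric.isOpen_ball (hmem t ht)).hasFDerivAt h1
      rwa [hf1 _ (hmem t ht)] at h2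
    exact Metric.isOpen_ball.is_const_of_deriv_eq_zero (convex_ball _ _).isPreconnected
      (fun t ht => (hd t ht).differentiableAt.differentiableWithinAt)
      (fun t ht => (hd t ht).deriv) hz.1 (Metric.mem_ball_self hε)
  have hcs : ContDiffOn ℝ ∞ c Ω :=
    (contDiffOn_coord hΦ 0).prodMk ((contDiffOn_coord hΦ 1).prodMk contDiff_snd.contDiffOn)
  -- The reduced function is `R` with the first coordinate frozen at its value at `x₀`.
  refine ⟨ρ.source ∩ c ⁻¹' Metric.ball (c x₀) ε,
    Metric.ball x₀.2 ε ×ˢ Metric.ball (Φ x₀ 1) ε, fun z => f ((c x₀).1, z.2, z.1),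
    (hcs.continuousOn.mono hρΩ).isOpen_inter_preimage ρ.open_source Metric.isOpen_ball,
    ⟨hρx, Metric.mem_ball_self hε⟩, inter_subset_left.trans hρΩ, ?_,
    Metric.isOpen_ball.prod Metric.isOpen_ball, ?_, ?_⟩
  · rw [← hρfun]
    exact ρ.injOn.mono inter_subset_left
  · refine hfs.comp (ContDiff.contDiffOn (by fun_prop)) fun z hz => ?_
    rw [← ball_prod_same, ← ball_prod_same]
    exact ⟨Metric.mem_ball_self hε, hz.2, hz.1⟩
  · rintro x ⟨hx, hxc⟩
    have hxc' : c x ∈ Metric.ball (c x₀) ε := hxc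
    refine ⟨?_, ?_⟩
    · rw [← ball_prod_same, ← ball_prod_same] at hxc'
      exact ⟨hxc'.2.2, hxc'.2.1⟩
    · have h1 : f (c x) = R x := by
        simp only [f, hσc, ρ.left_inv hx]
      rw [← h1, hconst _ hxc']

/-- The coframe `A` dual to `G`, `G_w` is closed in `q` and integrates to `P_w`. Its control
derivative gives the Jacobian of `∂P_w/∂w` as a function of `P_w`, with rows `(0, 1)` and `(-1, b)`.
The first row says that `∂P₀/∂w - P₁` depends on `w` only, and the second that `∂P₁/∂w + P₀` does
not vary along `G`, that is, depends on `w` and `P₁` only. These two functions are `a₁` and `a₂`. -/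
theorem exists_generatedFamily {G : Plane × ℝ → Plane} {b : Plane × ℝ → ℝ} {O : Set Plane}
    {V : Set ℝ} (hO : IsOpen O) (hV : IsOpen V) (hGs : ContDiffOn ℝ ∞ G (O ×ˢ V))
    (hind : ∀ x ∈ O ×ˢ V, wedge (G x) (dU G x) ≠ 0)
    (hnat : ∀ x ∈ O ×ˢ V, dU (dU G) x = -G x - b x • dU G x)
    (hcomm : ∀ x ∈ O ×ˢ V, fderiv ℝ (dU G) x (G x, 0) = fderiv ℝ G x (dU G x, 0))
    {q₀ : Plane} (hq₀ : q₀ ∈ O) {w₀ : ℝ} (hw₀ : w₀ ∈ V) :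
    ∃ O' ⊆ O, ∃ V' ⊆ V, q₀ ∈ O' ∧ w₀ ∈ V' ∧
      ∃ a₁ a₂ P, IsGeneratedFamily a₁ a₂ P O' V' ∧ Straightens P G O' V' ∧
        ((∀ q ∈ O, G (q, w₀) = e₁ ∧ dU G (q, w₀) = e₂) → ∀ q ∈ O', P w₀ q = q) := by
  have hOV := hO.prod hV
  obtain ⟨A, hAs, hAe⟩ := exists_coframe hOV hGs hind
  obtain ⟨ε, hε, hεO⟩ := Metric.isOpen_iff.1 hO q₀ hq₀
  set r := ε / 2 with hr
  have hr0 : 0 < r := by positivity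
  have h2r : 2 * r = ε := by rw [hr]; ring
  have hB2 : Metric.ball q₀ (2 * r) ×ˢ V ⊆ O ×ˢ V := Set.prod_mono (h2r ▸ hεO) Subset.rfl
  obtain ⟨P, hPs, hPA, hP0⟩ := exists_smooth_primitive hr0 hV (hAs.mono hB2)
    (fun x hx ξ η => fderiv_coframe_symm hOV hGs hind hcomm hAs hAe (hB2 hx) ξ η)
  set Ω := Metric.ball q₀ r ×ˢ V with hΩdef
  have hΩ : IsOpen Ω := Metric.isOpen_ball.prod hV
  have hΩO : Ω ⊆ O ×ˢ V :=
    (Set.prod_mono (Metric.ball_subset_ball (by linarith)) Subset.rfl).trans hB2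
  set Φ : Plane × ℝ → Plane := fun x => P x.2 x.1 with hΦ
  have hΦs : ContDiffOn ℝ ∞ Φ Ω := hPs
  have hΦd {x} (hx : x ∈ Ω) := hΦs.differentiableAt_of_isOpen hΩ hx
  have hΦA : ∀ x ∈ Ω, ∀ ξ, fderiv ℝ Φ x (ξ, 0) = A x ξ := fun x hx ξ => by
    have := fderiv_partial_fst (f := Φ) (q := x.1) (u := x.2) (hΦd hx) ξ
    rw [show (fun y => Φ (y, x.2)) = P x.2 from rfl, (hPA x.1 hx.1 x.2 hx.2).fderiv] at this
    exact this.symm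
  have hAinj : ∀ x ∈ Ω, ∀ ξ, A x ξ = 0 → ξ = 0 := fun x hx ξ hξ => by
    have h1 := eq_smul_add_smul (hind x (hΩO hx)) ξ
    have h2 := congrArg (A x) h1
    rw [hξ, map_add, map_smul, map_smul, (hAe x (hΩO hx)).1, (hAe x (hΩO hx)).2] at h2
    obtain ⟨i1, i2⟩ := wedge_ne_zero_iff.1 wedge_e₁_e₂ _ _ h2.symm
    rw [h1, i1, i2]
    simp
  set Ψ : Plane × ℝ → Plane := fun x => fderiv ℝ Φ x (0, 1) with hΨ
  have hΨs : ContDiffOn ℝ ∞ Ψ Ω := hΦs.fderiv_along contDiffOn_const hΩ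
  -- Symmetry of the second derivative of `Φ` exchanges the derivatives in `q` and `w`, so the state
  -- derivative of `Ψ` is the control derivative of `A`.
  have hΨd : ∀ x ∈ Ω, ∀ ξ : Plane, fderiv ℝ Ψ x (ξ, 0)
      = !₂[A x ξ 1, b x * A x ξ 1 - A x ξ 0] := by
    intro x hx ξ
    rw [← fderiv_coframe_control hOV hGs hind hnat hAs hAe (hΩO hx) ξ]
    have d1 := fderiv_fderiv_along hΦs (contDiffOn_const (c := ((0 : Plane), (1 : ℝ)))) hΩ hx (ξ, 0)
    have d2 := fderiv_fderiv_along hΦs (contDiffOn_const (c := (ξ, (0 : ℝ)))) hΩ hx (0, 1)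
    have e : EqOn (fun y => fderiv ℝ Φ y (ξ, 0)) (fun y => A y ξ) Ω := fun y hy => hΦA y hy ξ
    have d3 := fderiv_clm_apply_apply
      ((hAs.mono hΩO).differentiableAt_of_isOpen hΩ hx) (differentiableAt_const ξ) (0, 1)
    rw [e.fderiv_eq_of_isOpen hΩ hx, d3, hΦs.fderiv_fderiv_symm hΩ hx] at d2
    rw [hΨ, d1]
    simpa using d2.symm
  have hΨdiff {x} (hx : x ∈ Ω) := hΨs.differentiableAt_of_isOpen hΩ hx
  have dΦ {x} (hx : x ∈ Ω) (i : Fin 2) (ξ : Plane) :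
      fderiv ℝ (fun y => Φ y i) x (ξ, 0) = A x ξ i := by
    rw [← fderiv_coord (hΦd hx), hΦA x hx]
  have dΨ {x} (hx : x ∈ Ω) (i : Fin 2) (ξ : Plane) :
      fderiv ℝ (fun y => Ψ y i) x (ξ, 0) = !₂[A x ξ 1, b x * A x ξ 1 - A x ξ 0] i := by
    rw [← fderiv_coord (hΨdiff hx), hΨd x hx]
  have cd {K : Plane × ℝ → Plane} (hK : ContDiffOn ℝ ∞ K Ω) (i : Fin 2) {x} (hx : x ∈ Ω) :=
    (contDiffOn_coord hK i).differentiableAt_of_isOpen hΩ hx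
  -- The state derivative of this sum is `b` times the second component of `A`, which is zero on `G`
  -- because `A G = e₁`.
  have hR : ∀ x ∈ Ω, fderiv ℝ (fun x => Ψ x 1 + Φ x 0) x (G x, 0) = 0 := by
    intro x hx
    rw [fderiv_fun_add (cd hΨs 1 hx) (cd hΦs 0 hx), add_apply, dΨ hx, dΦ hx,
      (hAe x (hΩO hx)).1]
    simp [e₁]
  have hmem₀ : (q₀, w₀) ∈ Ω := ⟨Metric.mem_ball_self hr0, hw₀⟩
  have hfirst : ∀ x ∈ Ω, Ψ x 0 = (Ψ (q₀, x.2) 0 - Φ (q₀, x.2) 1) + Φ x 1 := by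
    rintro ⟨q, w⟩ ⟨hq, hw⟩
    have hd : ∀ y ∈ Metric.ball q₀ r,
        HasFDerivAt (fun y => Ψ (y, w) 0 - Φ (y, w) 1) (0 : Plane →L[ℝ] ℝ) y := by
      intro y hy
      have hyw : (y, w) ∈ Ω := ⟨hy, hw⟩
      have hdd : DifferentiableAt ℝ (fun x => Ψ x 0 - Φ x 1) (y, w) :=
        (cd hΨs 0 hyw).sub (cd hΦs 1 hyw)
      have hdy : DifferentiableAt ℝ (fun y => Ψ (y, w) 0 - Φ (y, w) 1) y :=
        DifferentiableAt.comp y (g := fun x => Ψ x 0 - Φ x 1) (f := fun y => (y, w)) hdd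
          (by fun_prop)
      convert hdy.hasFDerivAt using 1
      refine ContinuousLinearMap.ext fun ξ => ?_
      rw [fderiv_partial_fst (f := fun x => Ψ x 0 - Φ x 1) hdd,
        fderiv_fun_sub (cd hΨs 0 hyw) (cd hΦs 1 hyw), sub_apply, dΨ hyw, dΦ hyw]
      simp
    have := Metric.isOpen_ball.is_const_of_fderiv_eq_zero (𝕜 := ℝ)
      (convex_ball q₀ r).isPreconnected
      (fun y hy => (hd y hy).differentiableAt.differentiableWithinAt)
      (fun y hy => (hd y hy).fderiv) hq (Metric.mem_ball_self hr0)
    simp only at this ⊢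
    rw [← this]
    ring
  obtain ⟨S, D, a, hS, hxS, hSΩ, hSinj, hD, ha, hRa⟩ := exists_reduced_function hΩ hΦs
    ((contDiffOn_coord hΨs 1).add (contDiffOn_coord hΦs 0))
    (fun x hx ξ hξ => hAinj x hx ξ (by rw [← hΦA x hx, hξ]))
    (fun x hx => by rw [hΦA x hx, (hAe x (hΩO hx)).1]) hR hmem₀
  obtain ⟨O', V', hO', hqO', hV', hwV', hOV'⟩ := mem_nhds_prod_iff'.1 (hS.mem_nhds hxS)
  have hsub {q w} (hq : q ∈ O') (hw : w ∈ V') : (q, w) ∈ Ω := hSΩ (hOV' ⟨hq, hw⟩)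
  have hV'V : V' ⊆ V := fun w hw => (hsub hqO' hw).2
  refine ⟨O', fun q hq => (hΩO (hsub hq hwV')).1, V', hV'V, hqO', hwV',
    fun w => Ψ (q₀, w) 0 - Φ (q₀, w) 1, a, P, ?_, ?_, ?_⟩
  · refine ⟨hO', hV', ?_, ⟨D, hD, ha, fun q hq w hw => (hRa (q, w) (hOV' ⟨hq, hw⟩)).1⟩,
      hPs.mono (hOV'.trans hSΩ), fun w hw q hq q' hq' he => ?_, fun q hq w hw => ?_,
      fun q hq w hw => ?_⟩
    · refine ((contDiffOn_coord hΨs 0).sub (contDiffOn_coord hΦs 1)).comp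
        (f := fun w => (q₀, w)) (ContDiff.contDiffOn (by fun_prop)) fun w hw => hsub hqO' hw
    · have := hSinj (hOV' ⟨hq, hw⟩) (hOV' ⟨hq', hw⟩) 
        (show (Φ (q, w), w) = (Φ (q', w), w) from Prod.ext he rfl)
      exact congrArg Prod.fst this
    · rw [(hPA q (hsub hq hw).1 w (hV'V hw)).fderiv]
      have hi : Function.Injective (A (q, w)) := by
        rw [injective_iff_map_eq_zero]
        exact hAinj _ (hsub hq hw)
      obtain ⟨e, he⟩ := isInvertible_of_injective hi
      rw [← he]
      exact e.bijective
    · have hx := hsub hq hw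
      have h1 := hasDerivAt_control (hΦd hx)
      suffices e : fieldX (fun w => Ψ (q₀, w) 0 - Φ (q₀, w) 1) a w (P w q) = Ψ (q, w) by
        rw [e]
        exact h1
      have h2 := hfirst _ hx
      have h3 := (hRa (q, w) (hOV' ⟨hq, hw⟩)).2
      ext i
      fin_cases i
      · simp only [fieldX]
        simpa using h2.symm
      · simp only [fieldX]
        simp only [Fin.mk_one, Fin.isValue, Matrix.cons_val_one, Matrix.cons_val_fin_one]
        change a (w, Φ (q, w) 1) - Φ (q, w) 0 = _
        rw [← h3]
        ring
  · intro q hq w hw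
    rw [(hPA q (hsub hq hw).1 w (hV'V hw)).fderiv]
    exact hAe _ (hΩO (hsub hq hw))
  · intro hid q hq
    have hd : ∀ y ∈ Metric.ball q₀ r, HasFDerivAt (fun y => P w₀ y - y) (0 : Plane →L[ℝ] Plane) y := by
      intro y hy
      have hyO : (y, w₀) ∈ O ×ˢ V := hΩO ⟨hy, hw₀⟩
      -- If the frame at `w₀` is `e₁`, `e₂`, then `DP_w₀` is the identity. Since `P_w₀` fixes `q₀`
      -- by construction, it is the identity on the ball.
      have hAid : A (y, w₀) = ContinuousLinearMap.id ℝ Plane := by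
        have h1 := hAe _ hyO
        rw [(hid y hyO.1).1, (hid y hyO.1).2] at h1
        exact clm_ext_of_wedge wedge_e₁_e₂ h1.1 h1.2
      have h2 := (hPA y hy w₀ hw₀).fun_sub (hasFDerivAt_id y)
      rw [hAid, sub_self] at h2
      exact h2
    have := Metric.isOpen_ball.is_const_of_fderiv_eq_zero (𝕜 := ℝ)
      (convex_ball q₀ r).isPreconnected
      (fun y hy => (hd y hy).differentiableAt.differentiableWithinAt)
      (fun y hy => (hd y hy).fderiv) (hsub hq hwV').1 (Metric.mem_ball_self hr0)
    simp only [hP0, sub_self] at this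
    exact sub_eq_zero.1 this

/-! ### Feedback transformations -/

section Feedback

variable {M : Type*} [TopologicalSpace M] [ChartedSpace Plane M]
  {U : Type*} [TopologicalSpace U] [ChartedSpace ℝ U]
  {f : (q : M) → U → TangentSpace (𝓡 2) q} {q₀ q₁ : M} {u₀ u₁ : U}
  {Θ Θ₁ : OpenPartialHomeomorph (M × U) (Plane × ℝ)} {φ φ₁ : OpenPartialHomeomorph M Plane}
  {O O₁ : Set Plane} {V V₁ : Set ℝ} {F G : Plane × ℝ → Plane}

theorem IsSmoothSystem.contDiffOn_chart [IsManifold (𝓡 2) ∞ M] (hf : IsSmoothSystem f)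
    (hφ : φ ∈ IsManifold.maximalAtlas (𝓡 2) ∞ M) {s : Plane × ℝ → M × U} {Ω : Set (Plane × ℝ)}
    (hs : ContMDiffOn 𝓘(ℝ, Plane × ℝ) ((𝓡 2).prod 𝓘(ℝ, ℝ)) ∞ s Ω)
    (hmem : ∀ y ∈ Ω, (s y).1 ∈ φ.source) :
    ContDiffOn ℝ ∞ (fun y => (mfderiv (𝓡 2) 𝓘(ℝ, Plane) φ (s y).1 (f (s y).1 (s y).2) : Plane))
      Ω := by
  have h1 : ContMDiffOn (𝓡 2) 𝓘(ℝ, Plane) ∞ φ φ.source := contMDiffOn_of_mem_maximalAtlas hφ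
  have h2 := h1.contMDiffOn_tangentMapWithin (m := ∞) (by simp) φ.open_source.uniqueMDiffOn
  have h3 : ContMDiffOn 𝓘(ℝ, Plane × ℝ) (𝓡 2).tangent ∞
      (fun y => (⟨(s y).1, f (s y).1 (s y).2⟩ : TangentBundle (𝓡 2) M)) Ω :=
    ContMDiff.comp_contMDiffOn hf hs
  have h4 := h2.comp h3 hmem
  have h5 := (contMDiff_snd_tangentBundle_modelSpace Plane 𝓘(ℝ, Plane)
    (n := ∞)).comp_contMDiffOn h4
  refine (contMDiffOn_iff_contDiffOn.1 h5).congr fun y hy => ?_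
  rw [← mfderivWithin_of_isOpen φ.open_source (hmem y hy)]
  rfl

theorem IsSmoothSystem.contDiffOn_localRep [IsManifold (𝓡 2) ∞ M] (hf : IsSmoothSystem f)
    {e : OpenPartialHomeomorph M Plane} {e' : OpenPartialHomeomorph U ℝ}
    (he : e ∈ IsManifold.maximalAtlas (𝓡 2) ∞ M)
    (he' : e' ∈ IsManifold.maximalAtlas 𝓘(ℝ, ℝ) ∞ U) :
    ContDiffOn ℝ ∞ (localRep f e e') (e.target ×ˢ e'.target) := by
  refine hf.contDiffOn_chart he (s := fun x => (e.symm x.1, e'.symm x.2)) ?_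
    fun y hy => e.map_target hy.1
  have h1 : ContMDiffOn (𝓡 2) (𝓡 2) ∞ e.symm e.target := contMDiffOn_symm_of_mem_maximalAtlas he
  have h2 : ContMDiffOn 𝓘(ℝ, ℝ) 𝓘(ℝ, ℝ) ∞ e'.symm e'.target :=
    contMDiffOn_symm_of_mem_maximalAtlas he'
  exact (h1.comp contDiff_fst.contMDiff.contMDiffOn fun x hx => hx.1).prodMk
    (h2.comp contDiff_snd.contMDiff.contMDiffOn fun x hx => hx.2)

/-- Coordinate charts are themselves feedback transformations, so coordinate frames and transformed
systems can be compared by one transition lemma. -/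
theorem isLocalFeedback_prod
    {e : OpenPartialHomeomorph M Plane} {e' : OpenPartialHomeomorph U ℝ}
    (he : e ∈ IsManifold.maximalAtlas (𝓡 2) ∞ M)
    (he' : e' ∈ IsManifold.maximalAtlas 𝓘(ℝ, ℝ) ∞ U) (hq : q₀ ∈ e.source) (hu : u₀ ∈ e'.source) :
    IsLocalFeedback f q₀ u₀ (e.prod e') e e.target e'.target (localRep f e e') := by
  have h1 : ContMDiffOn (𝓡 2) (𝓡 2) ∞ e.symm e.target := contMDiffOn_symm_of_mem_maximalAtlas he
  have h2 : ContMDiffOn 𝓘(ℝ, ℝ) 𝓘(ℝ, ℝ) ∞ e'.symm e'.target :=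
    contMDiffOn_symm_of_mem_maximalAtlas he'
  have h3 : ContMDiffOn (𝓡 2) (𝓡 2) ∞ e e.source := contMDiffOn_of_mem_maximalAtlas he
  have h4 : ContMDiffOn 𝓘(ℝ, ℝ) 𝓘(ℝ, ℝ) ∞ e' e'.source := contMDiffOn_of_mem_maximalAtlas he'
  refine ⟨⟨hq, hu⟩, rfl, ?_, ?_, he, rfl, fun x hx => ⟨hx.1, rfl⟩, fun x hx => ?_⟩
  · exact (h3.comp contMDiff_fst.contMDiffOn fun x hx => hx.1).prodMk_space
      (h4.comp contMDiff_snd.contMDiffOn fun x hx => hx.2)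
  · exact (h1.comp contDiff_fst.contMDiff.contMDiffOn fun x hx => hx.1).prodMk
      (h2.comp contDiff_snd.contMDiff.contMDiffOn fun x hx => hx.2)
  · have e1 : e.symm (e x.1) = x.1 := e.left_inv hx.1
    have e2 : e'.symm (e' x.2) = x.2 := e'.left_inv hx.2
    change _ = mfderiv (𝓡 2) 𝓘(ℝ, Plane) e (e.symm (e x.1)) (f (e.symm (e x.1)) (e'.symm (e' x.2)))
    rw [e1, e2]

namespace IsLocalFeedback

theorem isOpen_left (h : IsLocalFeedback f q₀ u₀ Θ φ O V G) : IsOpen O :=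
  h.chart_target ▸ φ.open_target

theorem map_mem (h : IsLocalFeedback f q₀ u₀ Θ φ O V G) : Θ (q₀, u₀) ∈ O ×ˢ V :=
  h.target_eq ▸ Θ.map_source h.mem_source

theorem isOpen_right (h : IsLocalFeedback f q₀ u₀ Θ φ O V G) : IsOpen V := by
  have h1 : (fun w => ((Θ (q₀, u₀)).1, w)) ⁻¹' (O ×ˢ V) = V := by
    ext w
    exact ⟨fun hw => hw.2, fun hw => ⟨h.map_mem.1, hw⟩⟩
  rw [← h1, ← h.target_eq]
  exact Θ.open_target.preimage (by fun_prop)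

theorem contDiffOn [IsManifold (𝓡 2) ∞ M] (h : IsLocalFeedback f q₀ u₀ Θ φ O V G)
    (hf : IsSmoothSystem f) :
    ContDiffOn ℝ ∞ G (O ×ˢ V) := by
  rw [← h.target_eq]
  refine (hf.contDiffOn_chart h.chart h.smooth_symm fun y hy =>
    (h.triangular _ (Θ.map_target hy)).1).congr fun y hy => ?_
  have := h.transforms _ (Θ.map_target hy)
  rw [Θ.right_inv hy] at this
  exact this.symm

theorem mdifferentiableAt_chart (h : IsLocalFeedback f q₀ u₀ Θ φ O V G) {q : M}
    (hq : q ∈ φ.source) : MDifferentiableAt (𝓡 2) 𝓘(ℝ, Plane) φ q :=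
  (contMDiffAt_of_mem_maximalAtlas h.chart hq).mdifferentiableAt (by simp)

/-- Feedback transformations can be followed by triangular changes of the coordinates. -/
theorem trans [IsManifold (𝓡 2) ∞ M] (h : IsLocalFeedback f q₀ u₀ Θ φ O V G)
    {Θ' : OpenPartialHomeomorph (Plane × ℝ) (Plane × ℝ)} {ρ : OpenPartialHomeomorph Plane Plane}
    (hmem : Θ (q₀, u₀) ∈ Θ'.source) (htarget : Θ'.target = ρ.target ×ˢ V₁)
    (hΘ : ContDiffOn ℝ ∞ Θ' Θ'.source) (hΘs : ContDiffOn ℝ ∞ Θ'.symm Θ'.target)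
    (hρ : ContDiffOn ℝ ∞ ρ ρ.source) (hρs : ContDiffOn ℝ ∞ ρ.symm ρ.target)
    (hsub : Θ'.source ⊆ O ×ˢ V) (hρO : ρ.source ⊆ O)
    (htri : ∀ x ∈ Θ'.source, x.1 ∈ ρ.source ∧ (Θ' x).1 = ρ x.1)
    (hF : ∀ x ∈ Θ'.source, fderiv ℝ ρ x.1 (G x) = F (Θ' x)) :
    IsLocalFeedback f q₀ u₀ (Θ.trans Θ') (φ.trans ρ) ρ.target V₁ F := by
  have hsub' : Θ'.source ⊆ Θ.target := h.target_eq ▸ hsub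
  have hρφ : ρ.source ⊆ φ.target := h.chart_target ▸ hρO
  have hφ : ContMDiffOn (𝓡 2) (𝓡 2) ∞ φ φ.source := contMDiffOn_of_mem_maximalAtlas h.chart
  have hφs : ContMDiffOn (𝓡 2) (𝓡 2) ∞ φ.symm φ.target :=
    contMDiffOn_symm_of_mem_maximalAtlas h.chart
  have htar : (φ.trans ρ).target = ρ.target := by
    rw [OpenPartialHomeomorph.trans_target]
    exact inter_eq_left.2 fun y hy => hρφ (ρ.map_target hy)
  have htar' : (Θ.trans Θ').target = Θ'.target := by
    rw [OpenPartialHomeomorph.trans_target]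
    exact inter_eq_left.2 fun y hy => hsub' (Θ'.map_target hy)
  refine ⟨?_, by rw [htar', htarget], ?_, ?_, ?_, htar, ?_, ?_⟩
  · rw [OpenPartialHomeomorph.trans_source]
    exact ⟨h.mem_source, hmem⟩
  · rw [OpenPartialHomeomorph.trans_source]
    exact hΘ.contMDiffOn.comp (h.smooth.mono inter_subset_left) fun x hx => hx.2
  · rw [htar']
    exact h.smooth_symm.comp hΘs.contMDiffOn fun x hx => hsub' (Θ'.map_target hx)
  · rw [IsManifold.mem_maximalAtlas_iff_contMDiffOn, htar, OpenPartialHomeomorph.trans_source]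
    exact ⟨hρ.contMDiffOn.comp (hφ.mono inter_subset_left) fun x hx => hx.2,
      hφs.comp hρs.contMDiffOn fun x hx => hρφ (ρ.map_target hx)⟩
  · rintro x ⟨hx, hx'⟩
    have h1 := h.triangular x hx
    have h2 := htri (Θ x) hx'
    rw [h1.2] at h2
    exact ⟨⟨h1.1, h2.1⟩, h2.2⟩
  · rintro x ⟨hx, hx'⟩
    have h1 := h.triangular x hx
    have h2 := htri (Θ x) hx'
    have h3 := hF (Θ x) hx'
    rw [h1.2] at h2 h3
    have d1 := (hρ.differentiableAt_of_isOpen ρ.open_source h2.1).mdifferentiableAt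
    have d2 := mfderiv_comp x.1 d1 (h.mdifferentiableAt_chart h1.1)
    rw [mfderiv_eq_fderiv] at d2
    rw [← h.transforms x hx] at h3
    refine Eq.trans ?_ h3
    exact congrArg (fun l => l (f x.1 x.2)) d2

theorem contDiffOn_transition (h : IsLocalFeedback f q₀ u₀ Θ φ O V G)
    (h₁ : IsLocalFeedback f q₁ u₁ Θ₁ φ₁ O₁ V₁ F) :
    ContDiffOn ℝ ∞ (Θ.symm.trans Θ₁) (Θ.symm.trans Θ₁).source := by
  rw [← contMDiffOn_iff_contDiffOn, OpenPartialHomeomorph.trans_source]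
  exact h₁.smooth.comp (h.smooth_symm.mono inter_subset_left) fun x hx => hx.2

/-- The transition between two feedback coordinates is triangular, over the chart change `ρ`, and
the derivative of `ρ` carries one system to the other. A frame and its invariants are therefore
transported, which makes the vanishing conditions independent of coordinates. -/
theorem isBracketFrame_transition (h : IsLocalFeedback f q₀ u₀ Θ φ O V G)
    (h₁ : IsLocalFeedback f q₁ u₁ Θ₁ φ₁ O₁ V₁ F) {H v : Plane × ℝ → Plane × ℝ}
    {b k : Plane × ℝ → ℝ} (hfr : IsBracketFrame F (O₁ ×ˢ V₁) H v b k) :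
    IsBracketFrame G (Θ.symm.trans Θ₁).source
      (VectorField.pullback ℝ (Θ.symm.trans Θ₁) H) (VectorField.pullback ℝ (Θ.symm.trans Θ₁) v)
      (b ∘ Θ.symm.trans Θ₁) (k ∘ Θ.symm.trans Θ₁) ∧
    ∀ y ∈ (Θ.symm.trans Θ₁).source, fderiv ℝ (b ∘ Θ.symm.trans Θ₁) y
      (VectorField.pullback ℝ (Θ.symm.trans Θ₁) H y)
        = fderiv ℝ b (Θ.symm.trans Θ₁ y) (H (Θ.symm.trans Θ₁ y)) := by
  set T := Θ.symm.trans Θ₁ with hT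
  have hTs : ContDiffOn ℝ ∞ T T.source := h.contDiffOn_transition h₁
  have hTi : ContDiffOn ℝ ∞ T.symm T.target := by
    have := h₁.contDiffOn_transition h
    rwa [show Θ₁.symm.trans Θ = T.symm by
      rw [hT, OpenPartialHomeomorph.trans_symm_eq_symm_trans_symm,
        OpenPartialHomeomorph.symm_symm]] at this
  have hΩ : IsOpen (O₁ ×ˢ V₁) := h₁.isOpen_left.prod h₁.isOpen_right
  have hmaps : MapsTo T T.source (O₁ ×ˢ V₁) := fun y hy => by
    rw [← h₁.target_eq]
    exact Θ₁.map_source hy.2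
  have hinv : ∀ y ∈ T.source, (fderiv ℝ T y).IsInvertible := fun y hy =>
    isInvertible_fderiv hTs hTi hy
  set ρ := φ.symm.trans φ₁ with hρ
  have hφs : ContMDiffOn (𝓡 2) (𝓡 2) ∞ φ.symm φ.target :=
    contMDiffOn_symm_of_mem_maximalAtlas h.chart
  have hφ : ContMDiffOn (𝓡 2) (𝓡 2) ∞ φ φ.source := contMDiffOn_of_mem_maximalAtlas h.chart
  have hφ₁ : ContMDiffOn (𝓡 2) (𝓡 2) ∞ φ₁ φ₁.source := contMDiffOn_of_mem_maximalAtlas h₁.chart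
  have hφ₁s : ContMDiffOn (𝓡 2) (𝓡 2) ∞ φ₁.symm φ₁.target :=
    contMDiffOn_symm_of_mem_maximalAtlas h₁.chart
  have hρs : ContDiffOn ℝ ∞ ρ ρ.source := by
    rw [← contMDiffOn_iff_contDiffOn]
    exact hφ₁.comp (hφs.mono inter_subset_left) fun x hx => hx.2
  have hρi : ContDiffOn ℝ ∞ ρ.symm ρ.target := by
    rw [← contMDiffOn_iff_contDiffOn]
    exact hφ.comp (hφ₁s.mono inter_subset_left) fun x hx => hx.2
  have hbase : ∀ y ∈ T.source, φ.symm y.1 = (Θ.symm y).1 ∧ y.1 ∈ ρ.source ∧ (T y).1 = ρ y.1 := by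
    rintro y ⟨hy, hy'⟩
    have hy0 : y ∈ Θ.target := hy
    have h1 := h.triangular _ (Θ.map_target hy0)
    have h2 := h₁.triangular (Θ.symm y) hy'
    rw [Θ.right_inv hy0] at h1
    have e : φ.symm y.1 = (Θ.symm y).1 := by rw [h1.2, φ.left_inv h1.1]
    refine ⟨e, ⟨?_, ?_⟩, ?_⟩
    · change y.1 ∈ φ.target
      rw [h1.2]
      exact φ.map_source h1.1
    · change φ.symm y.1 ∈ φ₁.source
      rw [e]
      exact h2.1
    · change (Θ₁ (Θ.symm y)).1 = φ₁ (φ.symm y.1)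
      rw [h2.2, e]
  have hρd {y} (hy : y ∈ T.source) :=
    hρs.differentiableAt_of_isOpen ρ.open_source (hbase y hy).2.1
  refine ⟨hfr.pullback (L := fun y => fderiv ℝ ρ y.1) hΩ T.open_source hTs hmaps hinv ?_ ?_ ?_,
    fun y hy => fderiv_comp_pullback hΩ T.open_source hTs hmaps (hinv y hy) hfr.smooth_b hy⟩
  · intro y hy ξ
    have e : EqOn (fun y => (T y).1) (fun y => ρ y.1) T.source := fun y hy => (hbase y hy).2.2
    have e1 := e.fderiv_eq_of_isOpen T.open_source hy
    have d1 := (hTs.differentiableAt_of_isOpen T.open_source hy).hasFDerivAt.fst.fderiv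
    have d2 := ((hρd hy).hasFDerivAt.comp y hasFDerivAt_fst).fderiv
    have e2 := d1.symm.trans (e1.trans d2)
    exact congrArg (fun l => l ξ) e2
  · intro y hy
    obtain ⟨e, he⟩ := isInvertible_fderiv hρs hρi (hbase y hy).2.1
    rw [← he]
    exact e.injective
  · intro y hy
    have hy0 : y ∈ Θ.target := hy.1
    have hq := (h.triangular _ (Θ.map_target hy0))
    have hG := h.transforms _ (Θ.map_target hy0)
    have hF := h₁.transforms (Θ.symm y) hy.2
    rw [Θ.right_inv hy0] at hG hq
    set x := Θ.symm y
    have d1 := (hρd hy).mdifferentiableAt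
    rw [hq.2] at d1
    have d2 := mfderiv_comp x.1 d1 (h.mdifferentiableAt_chart hq.1)
    have e : φ₁ =ᶠ[𝓝 x.1] ρ ∘ φ := by
      filter_upwards [φ.open_source.mem_nhds hq.1] with z hz
      change φ₁ z = φ₁ (φ.symm (φ z))
      rw [φ.left_inv hz]
    rw [mfderiv_eq_fderiv, ← e.mfderiv_eq] at d2
    change _ = F (Θ₁ x)
    rw [← hF, ← hG, hq.2]
    exact (congrArg (fun l => l (f x.1 x.2)) d2).symm

end IsLocalFeedback

end Feedback

/-! ### Characterization of the systems with vanishing invariants -/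

section Characterization

theorem IsBracketFrame.mono {F : Plane × ℝ → Plane} {Ω Ω' : Set (Plane × ℝ)}
    {H v : Plane × ℝ → Plane × ℝ} {b k : Plane × ℝ → ℝ} (h : IsBracketFrame F Ω H v b k)
    (hsub : Ω' ⊆ Ω) : IsBracketFrame F Ω' H v b k :=
  ⟨h.smooth_H.mono hsub, h.smooth_v.mono hsub, h.smooth_b.mono hsub, h.smooth_k.mono hsub,
    fun x hx => h.fst_H x (hsub hx), fun x hx => h.fst_v x (hsub hx),
    fun x hx => h.indep x (hsub hx), fun x hx => h.natural x (hsub hx),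
    fun x hx => h.curvature x (hsub hx)⟩

theorem IsNaturalControl.exists_generatedFamily {G : Plane × ℝ → Plane} {O : Set Plane}
    {V : Set ℝ} (hO : IsOpen O) (hV : IsOpen V) (hG : ContDiffOn ℝ ∞ G (O ×ˢ V))
    (hnat : IsNaturalControl G O V) (hcomm : Commuting G O V) {q₀ : Plane} (hq₀ : q₀ ∈ O) {w₀ : ℝ}
    (hw₀ : w₀ ∈ V) :
    ∃ O' ⊆ O, ∃ V' ⊆ V, q₀ ∈ O' ∧ w₀ ∈ V' ∧
      ∃ a₁ a₂ P, IsGeneratedFamily a₁ a₂ P O' V' ∧ Straightens P G O' V' ∧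
        ((∀ q ∈ O, G (q, w₀) = e₁ ∧ dU G (q, w₀) = e₂) → ∀ q ∈ O', P w₀ q = q) := by
  obtain ⟨H, b, k, h⟩ := hnat.exists_isBracketFrame hO hV hG
  refine _root_.exists_generatedFamily (b := b) hO hV hG
    (fun x hx => h.wedge_dU_ne_zero (hO.prod hV) hG hx) (fun x hx => ?_)
    ((commuting_iff hO hV hG).1 hcomm) hq₀ hw₀
  simpa using h.natural_dU (hO.prod hV) hG hx

variable {M : Type*} [TopologicalSpace M] [ChartedSpace Plane M] [IsManifold (𝓡 2) ∞ M]
  {U : Type*} [TopologicalSpace U] [ChartedSpace ℝ U]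
  {f : (q : M) → U → TangentSpace (𝓡 2) q}

theorem hasInvariants (hf : IsSmoothSystem f) (hreg : IsRegularSystem f) : HasInvariants f := by
  intro e he e' he'
  have hF := hf.contDiffOn_localRep he he'
  obtain ⟨H, v, b, k, h⟩ := exists_isBracketFrame (e.open_target.prod e'.open_target) hF
    (hreg e he e' he')
  obtain ⟨p, hp⟩ := h.exists_isMovingFrame e.open_target e'.open_target hF
  exact ⟨p, H, v, b, k, hp⟩

/-- An arbitrary frame given in charts is pulled back to the coordinates where the fields commute,
and its invariants are evaluated there. -/
theorem IsLocalFeedback.eq_zero_of_commuting (hf : IsSmoothSystem f)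
    {e : OpenPartialHomeomorph M Plane} {e' : OpenPartialHomeomorph U ℝ}
    (he : e ∈ IsManifold.maximalAtlas (𝓡 2) ∞ M)
    (he' : e' ∈ IsManifold.maximalAtlas 𝓘(ℝ, ℝ) ∞ U)
    {p : Plane × ℝ → Coplane} {H v : Plane × ℝ → Plane × ℝ} {b k : Plane × ℝ → ℝ}
    (hfr : IsMovingFrame (localRep f e e') e.target e'.target p H v b k)
    {x : Plane × ℝ} (hx : x ∈ e.target ×ˢ e'.target)
    {Θ : OpenPartialHomeomorph (M × U) (Plane × ℝ)} {φ : OpenPartialHomeomorph M Plane}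
    {O : Set Plane} {V : Set ℝ} {G : Plane × ℝ → Plane}
    (h : IsLocalFeedback f (e.symm x.1) (e'.symm x.2) Θ φ O V G) (hcomm : Commuting G O V) :
    k x = 0 ∧ (IsNaturalControl G O V → fderiv ℝ b x (H x) = 0) := by
  have hq := e.map_target hx.1
  have hu := e'.map_target hx.2
  have h₁ := isLocalFeedback_prod (f := f) he he' hq hu
  have hG := h.contDiffOn hf
  obtain ⟨hT, hTb⟩ := h.isBracketFrame_transition h₁ (hfr.isBracketFrame e.open_target
    e'.open_target (hf.contDiffOn_localRep he he'))
  set T := Θ.symm.trans (e.prod e') with hTdef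
  set y := Θ (e.symm x.1, e'.symm x.2) with hy
  have hΘy : Θ.symm y = (e.symm x.1, e'.symm x.2) := Θ.left_inv h.mem_source
  have hyT : y ∈ T.source := by
    refine ⟨Θ.map_source h.mem_source, ?_⟩
    change Θ.symm y ∈ (e.prod e').source
    rw [hΘy]
    exact ⟨hq, hu⟩
  have hTy : T y = x := by
    change e.prod e' (Θ.symm y) = x
    rw [hΘy]
    exact Prod.ext (e.right_inv hx.1) (e'.right_inv hx.2)
  have hsub : T.source ⊆ O ×ˢ V := by
    rw [← h.target_eq]
    exact fun z hz => hz.1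
  have hc : ∀ z ∈ T.source, fderiv ℝ (dU G) z (G z, 0) = fderiv ℝ G z (dU G z, 0) :=
    fun z hz => (commuting_iff h.isOpen_left h.isOpen_right hG).1 hcomm z (hsub hz)
  have hGT := hG.mono hsub
  refine ⟨?_, fun hnat => ?_⟩
  · have := (hT.of_commuting T.open_source hGT hc y hyT).2.2
    rwa [Function.comp_apply, hTy] at this
  · obtain ⟨H', b', k', h'⟩ := hnat.exists_isBracketFrame h.isOpen_left h.isOpen_right hG
    -- The pulled-back vertical field need not be `∂/∂w`, but by uniqueness up to sign it is
    -- `±∂/∂w`, which suffices.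
    have := hT.fderiv_b_of_commuting T.open_source hGT hc (fun z hz => by
      rw [hT.sq_snd_eq T.open_source hGT (h'.mono hsub) hz]
      norm_num) hyT
    rwa [hTb y hyT, hTy] at this

theorem curvatureVanishes_of_commuting (hf : IsSmoothSystem f)
    (h : ∀ (q₀ : M) (u₀ : U), ∃ Θ φ O V G, IsLocalFeedback f q₀ u₀ Θ φ O V G ∧
      Commuting G O V) : CurvatureVanishes f := by
  intro e he e' he' p H v b k hfr x hx
  obtain ⟨Θ, φ, O, V, G, hΘ, hcomm⟩ := h (e.symm x.1) (e'.symm x.2)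
  exact (hΘ.eq_zero_of_commuting hf he he' hfr hx hcomm).1

theorem derivBVanishes_of_natural_commuting (hf : IsSmoothSystem f)
    (h : ∀ (q₀ : M) (u₀ : U), ∃ Θ φ O V G, IsLocalFeedback f q₀ u₀ Θ φ O V G ∧
      IsNaturalControl G O V ∧ Commuting G O V) : DerivBVanishes f := by
  intro e he e' he' p H v b k hfr x hx
  obtain ⟨Θ, φ, O, V, G, hΘ, hnat, hcomm⟩ := h (e.symm x.1) (e'.symm x.2)
  exact (hΘ.eq_zero_of_commuting hf he he' hfr hx hcomm).2 hnat

theorem vanish_of_natural_commuting (hf : IsSmoothSystem f)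
    (h : ∀ (q₀ : M) (u₀ : U), ∃ Θ φ O V G, IsLocalFeedback f q₀ u₀ Θ φ O V G ∧
      IsNaturalControl G O V ∧ Commuting G O V) : CurvatureVanishes f ∧ DerivBVanishes f :=
  ⟨curvatureVanishes_of_commuting hf fun q₀ u₀ => by
    obtain ⟨Θ, φ, O, V, G, hΘ, -, hcomm⟩ := h q₀ u₀
    exact ⟨Θ, φ, O, V, G, hΘ, hcomm⟩, derivBVanishes_of_natural_commuting hf h⟩

theorem exists_natural_commuting [IsManifold 𝓘(ℝ, ℝ) ∞ U] (hf : IsSmoothSystem f)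
    (hreg : IsRegularSystem f) (hk : CurvatureVanishes f) (hb : DerivBVanishes f) (q₀ : M)
    (u₀ : U) :
    ∃ Θ φ O V G, IsLocalFeedback f q₀ u₀ Θ φ O V G ∧
      IsNaturalControl G O V ∧ Commuting G O V := by
  set e := chartAt Plane q₀
  set e' := chartAt ℝ u₀
  have he : e ∈ IsManifold.maximalAtlas (𝓡 2) ∞ M := IsManifold.chart_mem_maximalAtlas q₀
  have he' : e' ∈ IsManifold.maximalAtlas 𝓘(ℝ, ℝ) ∞ U := IsManifold.chart_mem_maximalAtlas u₀
  have hF := hf.contDiffOn_localRep he he'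
  obtain ⟨p, H, v, b, k, hfr⟩ := hasInvariants hf hreg e he e' he'
  have h₀ := isLocalFeedback_prod (f := f) he he' (mem_chart_source Plane q₀) (mem_chart_source ℝ u₀)
  obtain ⟨Θ, O, V, hO, hV, hx, hsub, htar, hΘ, hΘs, htri, hG⟩ :=
    (hfr.isBracketFrame e.open_target e'.open_target hF).exists_natural_control
      (e.open_target.prod e'.open_target) hF (hk e he e' he' p H v b k hfr)
      (hb e he e' he' p H v b k hfr) h₀.map_mem
  have hGs : ContDiffOn ℝ ∞ (localRep f e e' ∘ Θ.symm) (O ×ˢ V) := by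
    rw [← htar]
    exact hF.comp hΘs fun y hy => hsub (Θ.map_target hy)
  -- The straightening changes only the control, so the new chart of the state space is the old one
  -- cut down to `O`. Each point of `O` is lifted to `Θ.target` with one fixed control value, and
  -- its preimage has the same state.
  have hOs : (OpenPartialHomeomorph.ofSet O hO).source ⊆ e.target := by
    intro q hq
    have hw : (Θ (e.prod e' (q₀, u₀))).2 ∈ V := (htar ▸ Θ.map_source hx).2
    have hqw : (q, (Θ (e.prod e' (q₀, u₀))).2) ∈ Θ.target := htar ▸ ⟨hq, hw⟩
    have := htri _ (Θ.map_target hqw)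
    rw [Θ.right_inv hqw] at this
    have h2 := (hsub (Θ.map_target hqw)).1
    rw [← this] at h2
    exact h2
  refine ⟨_, _, O, V, _, h₀.trans (ρ := OpenPartialHomeomorph.ofSet O hO) hx htar hΘ hΘs
    contDiffOn_id contDiffOn_id hsub hOs (fun y hy => ⟨?_, htri y hy⟩) (fun y hy => ?_),
    hG.isNaturalControl hO hV hGs, (commuting_iff hO hV hGs).2 fun y hy =>
      hG.commuting (hO.prod hV) hGs hy⟩
  · have := (htar ▸ Θ.map_source hy : Θ y ∈ O ×ˢ V).1
    rw [htri y hy] at this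
    exact this
  · rw [Function.comp_apply, Θ.left_inv hy]
    change fderiv ℝ id y.1 _ = _
    rw [fderiv_id]
    rfl

/-- A generated family can be normalized to be the identity at a given time. -/
theorem IsLocalFeedback.exists_normalized (hf : IsSmoothSystem f) {q₀ : M} {u₀ : U}
    {Θ : OpenPartialHomeomorph (M × U) (Plane × ℝ)} {φ : OpenPartialHomeomorph M Plane}
    {O : Set Plane} {V : Set ℝ} {G : Plane × ℝ → Plane} (h : IsLocalFeedback f q₀ u₀ Θ φ O V G)
    (hnat : IsNaturalControl G O V) (hcomm : Commuting G O V) :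
    ∃ Θ φ O V G, IsLocalFeedback f q₀ u₀ Θ φ O V G ∧
      ∃ a₁ a₂ P, IsGeneratedFamily a₁ a₂ P O V ∧
        (∀ q ∈ O, P (Θ (q₀, u₀)).2 q = q) ∧ Straightens P G O V := by
  obtain ⟨O', hO', V', hV', hq, hw, a₁, a₂, P, hP, hS, -⟩ :=
    hnat.exists_generatedFamily h.isOpen_left h.isOpen_right (h.contDiffOn hf) hcomm
      h.map_mem.1 h.map_mem.2
  set w₀ := (Θ (q₀, u₀)).2 with hw₀
  have hslice {w} (hw : w ∈ V') : ContDiffOn ℝ ∞ (P w) O' :=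
    hP.smooth_P.comp (f := fun q => (q, w)) (ContDiff.contDiffOn (by fun_prop))
      fun q hq => ⟨hq, hw⟩
  obtain ⟨ρ, hρO, hρP, hρs⟩ := exists_diffeo_of_injOn hP.isOpen_O (hslice hw) (hP.injOn _ hw)
    fun q hq => isInvertible_of_injective (hP.bijective q hq _ hw).1
  have hρfun : (ρ : Plane → Plane) = P w₀ := funext hρP
  have hρsm : ContDiffOn ℝ ∞ ρ ρ.source := by
    rw [hρfun, hρO]
    exact hslice hw
  have hmem {q} (hq : q ∈ ρ.target) : ρ.symm q ∈ O' := hρO ▸ ρ.map_target hq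
  -- The state is changed by `P w₀`, and the family becomes `P w ∘ (P w₀)⁻¹`. Composition on the
  -- right with a map independent of `w` keeps the generating field, so `a₁` and `a₂` are unchanged.
  set Θ' := ρ.prod (OpenPartialHomeomorph.ofSet V' hP.isOpen_V) with hΘ'
  set G' : Plane × ℝ → Plane := fun y => fderiv ℝ ρ (ρ.symm y.1) (G (ρ.symm y.1, y.2)) with hG'
  have hGG {q} (hq : q ∈ ρ.target) {w} (hw : w ∈ V') :
      dU G' (q, w) = fderiv ℝ ρ (ρ.symm q) (dU G (ρ.symm q, w)) := by
    have hx : (ρ.symm q, w) ∈ O ×ˢ V := ⟨hO' (hmem hq), hV' hw⟩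
    have hd := hasDerivAt_control ((h.contDiffOn hf).differentiableAt_of_isOpen
      (h.isOpen_left.prod h.isOpen_right) hx)
    have h1 := (fderiv ℝ ρ (ρ.symm q)).hasFDerivAt.comp_hasDerivAt w hd
    rw [dU_eq_fderiv ((h.contDiffOn hf).differentiableAt_of_isOpen
      (h.isOpen_left.prod h.isOpen_right) hx)]
    exact h1.deriv
  have hfd {q} (hq : q ∈ ρ.target) {w} (hw : w ∈ V') (ξ : Plane) :
      fderiv ℝ (fun q => P w (ρ.symm q)) q (fderiv ℝ ρ (ρ.symm q) ξ)
        = fderiv ℝ (P w) (ρ.symm q) ξ := by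
    have d1 := ((hslice hw).differentiableAt_of_isOpen hP.isOpen_O (hmem hq)).hasFDerivAt.comp q
      (hρs.differentiableAt_of_isOpen ρ.open_target hq).hasFDerivAt
    have d2 := fderiv_symm_comp_fderiv hρsm hρs (ρ.map_target hq) ξ
    rw [ρ.right_inv hq] at d2
    have d3 : fderiv ℝ (fun q => P w (ρ.symm q)) q = _ := d1.fderiv
    rw [d3, ContinuousLinearMap.comp_apply, d2]
  refine ⟨Θ.trans Θ', φ.trans ρ, ρ.target, V', G', h.trans ?_ rfl ?_ ?_ hρsm hρs ?_ ?_ ?_ ?_,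
    a₁, a₂, fun w q => P w (ρ.symm q), ?_, ?_, ?_⟩
  · exact ⟨hρO ▸ hq, hw⟩
  · exact (hρsm.comp contDiff_fst.contDiffOn fun x hx => hx.1).prodMk contDiff_snd.contDiffOn
  · exact (hρs.comp contDiff_fst.contDiffOn fun x hx => hx.1).prodMk contDiff_snd.contDiffOn
  · exact fun x hx => ⟨hO' (hρO ▸ hx.1), hV' hx.2⟩
  · exact hρO ▸ hO'
  · exact fun x hx => ⟨hx.1, rfl⟩
  · intro x hx
    change _ = fderiv ℝ ρ (ρ.symm (ρ x.1)) (G (ρ.symm (ρ x.1), x.2))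
    rw [ρ.left_inv hx.1]
  · obtain ⟨D, hD, hDa, hDP⟩ := hP.smooth_a₂
    refine ⟨ρ.open_target, hP.isOpen_V, hP.smooth_a₁, ⟨D, hD, hDa, fun q hq u hu =>
      hDP _ (hmem hq) u hu⟩, ?_, fun u hu => ?_, fun q hq u hu => ?_,
      fun q hq u hu => hP.generated _ (hmem hq) u hu⟩
    · exact hP.smooth_P.comp (f := fun x : Plane × ℝ => (ρ.symm x.1, x.2))
        ((hρs.comp contDiff_fst.contDiffOn fun x hx => hx.1).prodMk contDiff_snd.contDiffOn)
        fun x hx => ⟨hmem hx.1, hx.2⟩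
    · exact (hP.injOn u hu).comp ρ.symm.injOn fun q hq => hmem hq
    · obtain ⟨i, hi⟩ := isInvertible_fderiv hρsm hρs (ρ.map_target hq)
      have hb := hP.bijective _ (hmem hq) u hu
      have hc : (fderiv ℝ (fun q => P u (ρ.symm q)) q : Plane → Plane)
          = fderiv ℝ (P u) (ρ.symm q) ∘ i.symm := by
        funext η
        have := hfd hq hu (i.symm η)
        rw [← hi] at this
        simpa using this
      rw [hc]
      exact hb.comp i.symm.bijective
  · intro q hq
    change P w₀ (ρ.symm q) = q
    rw [← hρP, ρ.right_inv hq]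
  · intro q hq w hw
    have hs := hS _ (hmem hq) w hw
    refine ⟨?_, ?_⟩
    · rw [← hs.1]
      exact hfd hq hw _
    · rw [← hs.2, hGG hq hw]
      exact hfd hq hw _

end Characterization

theorem theorem5 {M : Type*} [TopologicalSpace M] [ChartedSpace Plane M] [IsManifold (𝓡 2) ∞ M]
    {U : Type*} [TopologicalSpace U] [ChartedSpace ℝ U] [IsManifold 𝓘(ℝ, ℝ) ∞ U]
    (f : (q : M) → U → TangentSpace (𝓡 2) q)
    (hf : IsSmoothSystem f) (hreg : IsRegularSystem f) :
    -- the invariants are defined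
    HasInvariants f ∧
    -- the characterization
    ((CurvatureVanishes f ∧ DerivBVanishes f) ↔
      ∀ (q₀ : M) (u₀ : U), ∃ Θ φ O V G, IsLocalFeedback f q₀ u₀ Θ φ O V G ∧
        IsNaturalControl G O V ∧ Commuting G O V) ∧
    -- commutation in any control, natural or not, forces zero curvature
    ((∀ (q₀ : M) (u₀ : U), ∃ Θ φ O V G, IsLocalFeedback f q₀ u₀ Θ φ O V G ∧
        Commuting G O V) → CurvatureVanishes f) ∧
    -- normal form of these systems, in suitable local coordinates
    ((CurvatureVanishes f ∧ DerivBVanishes f) ↔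
      ∀ (q₀ : M) (u₀ : U), ∃ Θ φ O V G, IsLocalFeedback f q₀ u₀ Θ φ O V G ∧
        ∃ a₁ a₂ P, IsGeneratedFamily a₁ a₂ P O V ∧
          (∀ q ∈ O, P (Θ (q₀, u₀)).2 q = q) ∧ Straightens P G O V) ∧
    -- in arbitrary local coordinates, every system with commuting fields in a natural control is
    -- obtained from a generated family
    (∀ (O : Set Plane) (V : Set ℝ) (G : Plane × ℝ → Plane), IsOpen O → IsOpen V →
      ContDiffOn ℝ ∞ G (O ×ˢ V) → IsNaturalControl G O V → Commuting G O V →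
      ∀ q₀ ∈ O, ∀ w₀ ∈ V, ∃ O' ⊆ O, ∃ V' ⊆ V, q₀ ∈ O' ∧ w₀ ∈ V' ∧
        ∃ a₁ a₂ P, IsGeneratedFamily a₁ a₂ P O' V' ∧ Straightens P G O' V' ∧
          ((∀ q ∈ O, G (q, w₀) = e₁ ∧ dU G (q, w₀) = e₂) → ∀ q ∈ O', P w₀ q = q)) ∧
    -- conversely, every generated family gives such a system
    (∀ (O : Set Plane) (V : Set ℝ) (a₁ : ℝ → ℝ) (a₂ : ℝ × ℝ → ℝ) (P : ℝ → Plane → Plane)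
      (G : Plane × ℝ → Plane), IsGeneratedFamily a₁ a₂ P O V →
      (∀ q ∈ O, ∀ w ∈ V, fderiv ℝ (P w) q (G (q, w)) = e₁) →
      ContDiffOn ℝ ∞ G (O ×ˢ V) ∧ Straightens P G O V ∧ IsNaturalControl G O V ∧
        Commuting G O V) := by
  refine ⟨hasInvariants hf hreg, ⟨fun h => exists_natural_commuting hf hreg h.1 h.2,
    vanish_of_natural_commuting hf⟩, curvatureVanishes_of_commuting hf, ⟨fun h q₀ u₀ => ?_,
    fun h => vanish_of_natural_commuting hf fun q₀ u₀ => ?_⟩, ?_, ?_⟩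
  · obtain ⟨Θ, φ, O, V, G, hΘ, hnat, hcomm⟩ := exists_natural_commuting hf hreg h.1 h.2 q₀ u₀
    exact hΘ.exists_normalized hf hnat hcomm
  · obtain ⟨Θ, φ, O, V, G, hΘ, a₁, a₂, P, hP, -, hS⟩ := h q₀ u₀
    have := hP.straightens (G := G) fun q hq w hw => (hS q hq w hw).1
    exact ⟨Θ, φ, O, V, G, hΘ, this.2.2⟩
  · intro O V G hO hV hG hnat hcomm q₀ hq₀ w₀ hw₀
    exact hnat.exists_generatedFamily hO hV hG hcomm hq₀ hw₀
  · intro O V a₁ a₂ P G hP hG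
    exact hP.straightens hG
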